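/- **Approximation properties of the projection.** Let $p\ge 0$ be an integer and $c_r,\alpha,T$ be real numbers with $\alpha,T>0$. Consider space-time prisms $\mathcal K=K\times I_n$, where $K\subset\mathbb R^2$ is a nondegenerate triangle with circumradius $h_K$ and inradius $\rho_K$, $h_K/\rho_K\le c_r$, and $I_n=(t_n,t_n+\Delta t)$ with $0<\Delta t\le T$. Let $\mathcal Q_{\mathcal K}=\partial K\times I_n$, with its three lateral faces $\mathcal F$ and outward unit (spatial) normal $\boldsymbol n$, and $\partial\mathcal K_0=K\times\{t_n,t_n+\Delta t\}$. Put $f_n(t)=e^{-\alpha(t-t_n)}$ and let $\|g\|_{f_n,D}=(\int_D f_n|g|^2)^{1/2}$, with the surface measure when $D\subset\partial\mathcal K$. Let $$W_h(\mathcal K)=P_p(K)\otimes P_p(I_n),\quad \boldsymbol V_h(\mathcal K)=[W_h(\mathcal K)]^2,\quad \widetilde W_h(\mathcal K)=P_{p-1}(K)\otimes P_p(I_n),\quad \widetilde{\boldsymbol V}_h(\mathcal K)=[\widetilde W_h(\mathcal K)]^2,\quad M_h(\mathcal F)=Q_p(\mathcal F),$$ with $P_{-1}=\{0\}$, where $Q_p$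 denotes tensor-product polynomials of degree $p$. Let $P_W^{f_n},P_{\widetilde W}^{f_n},\boldsymbol P_V^{f_n}$ be the $f_n$-weighted $L^2(\mathcal K)$-projections onto $W_h(\mathcal K)$, $\widetilde W_h(\mathcal K)$, $\boldsymbol V_h(\mathcal K)$. Let $\tau$ be a measurable function on $\mathcal Q_{\mathcal K}$ with $0<C_\tau^{\min}\le\tau\le C_\tau^{\max}$ a.e., and put $C_\tau=C_\tau^{\max}/C_\tau^{\min}$. For $(\boldsymbol q,v)\in[H^1(\mathcal K)]^2\times H^1(\mathcal K)$ the projection $\Pi_h(\boldsymbol q,v)=(\boldsymbol{\Pi_Vq},\Pi_Wv)\in\boldsymbol V_h(\mathcal K)\times W_h(\mathcal K)$ is defined by $$\begin{aligned} (\boldsymbol{\Pi_Vq},\boldsymbol s_hf_n)_{\mathcal K}&=(\boldsymbol q,\boldsymbol s_hf_n)_{\mathcal K}&&\forall\,\boldsymbol s_h\in\widetilde{\boldsymbol V}_h(\mathcal K),\\ (\Pi_Wv,z_hf_n)_{\mathcal K}&=(v,z_hf_n)_{\mathcal K}&&\forall\,z_h\in\widetilde W_h(\mathcal K),\\ \langle\boldsymbol{\Pi_Vq}\cdot\boldsymbol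 n-\tau\Pi_Wv,\sigma_hf_n\rangle_{\mathcal F}&=\langle\boldsymbol q\cdot\boldsymbol n-\tau v,\sigma_hf_n\rangle_{\mathcal F}&&\forall\,\sigma_h\in M_h(\mathcal F),\ \mathcal F\subset\mathcal Q_{\mathcal K}, \end{aligned}$$ where $\boldsymbol q$ and $v$ on $\partial\mathcal K$ are understood as traces. There is a constant $C>0$ depending only on $p,c_r,\alpha,T$ (in particular not on $K$, $h_K$, $t_n$, $\Delta t$, $\tau$, $\boldsymbol q$, $v$) such that, for all such data, $\Pi_h(\boldsymbol q,v)$ exists and is unique, and $$\|v-\Pi_Wv\|_{f_n,\mathcal K}\le\|v-P_W^{f_n}v\|_{f_n,\mathcal K}+CC_\tau h_K^{1/2}\|v-P_W^{f_n}v\|_{f_n,\mathcal Q_{\mathcal K}}+\frac{C}{C_\tau^{\min}}h_K\|\nabla\cdot\boldsymbol q-P_{\widetilde W}^{f_n}\nabla\cdot\boldsymbol q\|_{f_n,\mathcal K},\tag{a}$$ $$\|\boldsymbol q-\boldsymbol{\Pi_Vq}\|_{f_n,\mathcal K}\le\|\boldsymbol q-\boldsymbol P_V^{f_n}\boldsymbol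 q\|_{f_n,\mathcal K}+C'h_K^{1/2}\|(\boldsymbol q-\boldsymbol P_V^{f_n}\boldsymbol q)\cdot\boldsymbol n\|_{f_n,\mathcal Q_{\mathcal K}}+C'C_\tau^{\max}h_K^{1/2}\|v-P_W^{f_n}v\|_{f_n,\mathcal Q_{\mathcal K}},\tag{b}$$ $$\|\boldsymbol q-\boldsymbol{\Pi_Vq}\|_{f_n,\partial\mathcal K_0}\le\|\boldsymbol q-\boldsymbol P_V^{f_n}\boldsymbol q\|_{f_n,\partial\mathcal K_0}+C\Delta t^{-1/2}\|\boldsymbol q-\boldsymbol P_V^{f_n}\boldsymbol q\|_{f_n,\mathcal K}+C\Delta t^{-1/2}\|\boldsymbol q-\boldsymbol{\Pi_Vq}\|_{f_n,\mathcal K},\tag{c}$$ where in (b) $C'=C$ if $\tau$ is constant on each lateral face, and $C'=C\,C_\tau$ for general $\tau$. -/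

import Mathlib

open MeasureTheory Filter Topology
open scoped ContDiff

noncomputable section

/-- The spatial plane `ℝ²` with the Euclidean norm. -/
abbrev Plane : Type := EuclideanSpace ℝ (Fin 2)

/-- Space-time `ℝ × ℝ²`; a point is `(t, x)`. -/
abbrev SpaceTime : Type := ℝ × Plane

/-- A triangular space-time prism `𝒦 = K × (tₙ, tₙ + Δt)`. -/
structure Prism where
  /-- the nondegenerate spatial triangle `K` -/
  tri : Affine.Triangle ℝ Plane
  /-- the initial time `tₙ` -/
  t0 : ℝ
  /-- the length `Δt` of the time interval -/
  dt : ℝ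
  dt_pos : 0 < dt

namespace Prism

variable (K : Prism)

/-- The radius `h_K` of the circumscribed circle of the spatial triangle. -/
def h : ℝ := K.tri.circumradius

/-- The radius `ρ_K` of the inscribed circle of the spatial triangle. -/
def rho : ℝ := K.tri.inradius

/-- The time interval `Iₙ = (tₙ, tₙ + Δt)`. -/
def interval : Set ℝ := Set.Ioo K.t0 (K.t0 + K.dt)

/-- The closed spatial triangle `K`. -/
def triangle : Set Plane := convexHull ℝ (Set.range K.tri.points)

/-- The open space-time element `𝒦`. -/
def carrier : Set SpaceTime := K.interval ×ˢ interior K.triangle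

/-- Lebesgue measure on the element `𝒦`. -/
def vol : Measure SpaceTime := volume.restrict K.carrier

/-- The `i`-th edge of the triangle (opposite to the vertex `i`) runs from `edgeStart i` to
`edgeEnd i`. -/
def edgeStart (i : Fin 3) : Plane := K.tri.points (i + 1)

/-- The second end point of the `i`-th edge. -/
def edgeEnd (i : Fin 3) : Plane := K.tri.points (i + 2)

/-- The parametrization `(t, s) ↦ (t, (1 - s) a + s b)` of the `i`-th lateral face, where `a`, `b`
are the end points of the `i`-th edge. -/
def faceParam (i : Fin 3) (y : ℝ × ℝ) : SpaceTime :=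
  (y.1, AffineMap.lineMap (K.edgeStart i) (K.edgeEnd i) y.2)

/-- The surface measure of the `i`-th lateral face `Fᵢ = eᵢ × Iₙ`, as the image of Lebesgue measure
on `Iₙ × (0,1)` multiplied by the area factor `|eᵢ|` of the parametrization. -/
def faceMeasure (i : Fin 3) : Measure SpaceTime :=
  ENNReal.ofReal (dist (K.edgeStart i) (K.edgeEnd i)) •
    ((volume.restrict (K.interval ×ˢ Set.Ioo (0 : ℝ) 1)).map (K.faceParam i))

/-- The surface measure of the lateral boundary `𝒬_𝒦`, the union of the three lateral faces. -/
def sideMeasure : Measure SpaceTime := ∑ i, K.faceMeasure i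

/-- The surface measure of `∂𝒦₀ = K × {tₙ} ∪ K × {tₙ + Δt}`. -/
def endMeasure : Measure SpaceTime :=
  (volume.restrict K.triangle).map (fun x => (K.t0, x)) +
    (volume.restrict K.triangle).map (fun x => (K.t0 + K.dt, x))

/-- The outward unit normal (its spatial part) on the `i`-th lateral face: the edge vector
`d = b - a` is rotated by a right angle, normalized, and given the sign for which it points away
from the opposite vertex. -/
def normal (i : Fin 3) : Plane :=
  let d : Plane := K.edgeEnd i - K.edgeStart i
  let r : Plane := !₂[d 1, -d 0]
  (SignType.sign (inner ℝ r (K.edgeStart i - K.tri.points i)) : ℝ) • (‖d‖⁻¹ • r)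

/-- The weight `fₙ(t) = exp (-α (t - tₙ))`. -/
def weight (a : ℝ) (t : ℝ) : ℝ := Real.exp (-a * (t - K.t0))

/-- The `fₙ`-weighted `L²` norm `(∫ fₙ |g|² dμ)^{1/2}`. -/
def wnorm {F : Type*} [NormedAddCommGroup F] (a : ℝ) (μ : Measure SpaceTime)
    (g : SpaceTime → F) : ℝ :=
  Real.sqrt (∫ z, K.weight a z.1 * ‖g z‖ ^ 2 ∂μ)

/-- The `fₙ`-weighted `L²` norm over `𝒬_𝒦` of the normal component of the vector field `g`. -/
def normalNorm (a : ℝ) (g : SpaceTime → Plane) : ℝ :=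
  Real.sqrt (∑ i, ∫ z, K.weight a z.1 * (inner ℝ (g z) (K.normal i)) ^ 2 ∂(K.faceMeasure i))

end Prism

/-- The polynomial space spanned by `t^k x₁^i x₂^j` with `i + j < r` and `k < m`, i.e.
`P_{r-1} ⊗ P_{m-1}` (which is `0` if `r = 0`). -/
def tensorPoly (r m : ℕ) : Submodule ℝ (SpaceTime → ℝ) :=
  Submodule.span ℝ {w | ∃ i j k : ℕ, i + j < r ∧ k < m ∧
    w = fun z => z.1 ^ k * (z.2 0 ^ i * z.2 1 ^ j)}

/-- `W_h(𝒦) = P_p(K) ⊗ P_p(Iₙ)`. -/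
def spaceW (p : ℕ) : Submodule ℝ (SpaceTime → ℝ) := tensorPoly (p + 1) (p + 1)

/-- `W̃_h(𝒦) = P_{p-1}(K) ⊗ P_p(Iₙ)`. -/
def spaceWt (p : ℕ) : Submodule ℝ (SpaceTime → ℝ) := tensorPoly p (p + 1)

/-- The vector fields `[S]²` with both components in `S`. -/
def vecSpace (S : Submodule ℝ (SpaceTime → ℝ)) : Set (SpaceTime → Plane) :=
  {s | ∀ i : Fin 2, (fun z => s z i) ∈ S}

/-- The tensor product polynomials in two variables of degree at most `p` in each of them. -/
def tensorQ (p : ℕ) : Submodule ℝ (ℝ × ℝ → ℝ) :=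
  Submodule.span ℝ {w | ∃ k l : ℕ, k ≤ p ∧ l ≤ p ∧ w = fun y => y.1 ^ k * y.2 ^ l}

/-- The coordinate directions of space-time: index `0` is time, `1` and `2` are space. -/
def coordDir : Fin 3 → SpaceTime :=
  ![(1, 0), (0, EuclideanSpace.single 0 1), (0, EuclideanSpace.single 1 1)]

namespace Prism

variable (K : Prism)

/-- `M_h(Fᵢ) = Q_p(Fᵢ)`: functions that are, in the affine coordinates of the face, tensor product
polynomials of degree `p`. -/
def spaceM (p : ℕ) (i : Fin 3) : Set (SpaceTime → ℝ) :=
  {σ | (fun y => σ (K.faceParam i y)) ∈ tensorQ p}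

/-- `Pg` is the `fₙ`-weighted `L²(𝒦)` projection of `g` onto the space `S`. -/
def IsWeightedProj {F : Type*} [NormedAddCommGroup F] [InnerProductSpace ℝ F] (a : ℝ)
    (S : Set (SpaceTime → F)) (g Pg : SpaceTime → F) : Prop :=
  Pg ∈ S ∧ ∀ s ∈ S, ∫ z, K.weight a z.1 * inner ℝ (Pg z) (s z) ∂K.vol =
    ∫ z, K.weight a z.1 * inner ℝ (g z) (s z) ∂K.vol

/-- `v ∈ H¹(𝒦)` with weak derivatives `G 0 = ∂ₜ v`, `G 1 = ∂₁ v`, `G 2 = ∂₂ v`. -/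
def HasH1Grad (v : SpaceTime → ℝ) (G : Fin 3 → SpaceTime → ℝ) : Prop :=
  MemLp v 2 K.vol ∧ (∀ j, MemLp (G j) 2 K.vol) ∧
    ∀ φ : SpaceTime → ℝ, ContDiff ℝ ∞ φ → HasCompactSupport φ → tsupport φ ⊆ K.carrier →
      ∀ j, ∫ z, v z * fderiv ℝ φ z (coordDir j) ∂K.vol = -∫ z, G j z * φ z ∂K.vol

/-- `γ ∈ L²(∂𝒦)` is the trace of the function `v ∈ H¹(𝒦)` with weak derivatives `G`: it is the
`L²(∂𝒦)` limit of the restrictions to `∂𝒦` of smooth functions that converge to `v` in `H¹(𝒦)`. -/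
def IsTrace (v : SpaceTime → ℝ) (G : Fin 3 → SpaceTime → ℝ) (γ : SpaceTime → ℝ) : Prop :=
  MemLp γ 2 (K.sideMeasure + K.endMeasure) ∧
    ∃ φ : ℕ → SpaceTime → ℝ, (∀ k, ContDiff ℝ ∞ (φ k)) ∧
      Tendsto (fun k => eLpNorm (fun z => φ k z - v z) 2 K.vol) atTop (𝓝 0) ∧
      (∀ j, Tendsto (fun k => eLpNorm (fun z => fderiv ℝ (φ k) z (coordDir j) - G j z) 2 K.vol)
        atTop (𝓝 0)) ∧
      Tendsto (fun k => eLpNorm (fun z => φ k z - γ z) 2 (K.sideMeasure + K.endMeasure))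
        atTop (𝓝 0)

/-- `(PV, PW) = (Π_V q, Π_W v)` is the HDG projection of `(q, v)` on the element, where `γq`, `γv`
are the boundary traces of `q`, `v`, and `τ` is the stabilization function. -/
def IsHDGProj (p : ℕ) (a : ℝ) (τ : SpaceTime → ℝ) (q γq : SpaceTime → Plane)
    (v γv : SpaceTime → ℝ) (PV : SpaceTime → Plane) (PW : SpaceTime → ℝ) : Prop :=
  PV ∈ vecSpace (spaceW p) ∧ PW ∈ spaceW p ∧
  (∀ s ∈ vecSpace (spaceWt p), ∫ z, K.weight a z.1 * inner ℝ (PV z) (s z) ∂K.vol =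
    ∫ z, K.weight a z.1 * inner ℝ (q z) (s z) ∂K.vol) ∧
  (∀ w ∈ spaceWt p, ∫ z, K.weight a z.1 * (PW z * w z) ∂K.vol =
    ∫ z, K.weight a z.1 * (v z * w z) ∂K.vol) ∧
  ∀ i, ∀ σ ∈ K.spaceM p i,
    ∫ z, K.weight a z.1 * ((inner ℝ (PV z) (K.normal i) - τ z * PW z) * σ z) ∂(K.faceMeasure i) =
    ∫ z, K.weight a z.1 * ((inner ℝ (γq z) (K.normal i) - τ z * γv z) * σ z) ∂(K.faceMeasure i)

/-- `τ` is constant on each of the three lateral faces. -/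
def FacewiseConst (τ : SpaceTime → ℝ) : Prop :=
  ∀ i, ∃ c : ℝ, ∀ᵐ z ∂(K.faceMeasure i), τ z = c

end Prism

end

/-!
The unknowns of the projection are compared with the weighted `L²` projections `P_V q`, `P_W v`.
The differences `dV = Π_V q - P_V q` and `dW = Π_W v - P_W v` are of *top order* (`IsTop`): they
lie in `W_h` and are orthogonal to `W̃_h`. Moreover, on every lateral face, `dV · n - τ dW` and
the known function `b = (q - P_V q) · n - τ (v - P_W v)` agree when tested with `W_h`; this is the
notion of an error pair (`IsErrorPair`).

Two facts drive everything.

* A top order function is controlled on the element by its values on any *single* lateral face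
  (`exists_vol_le_face`). As the weight depends on time only, orthogonality to `P_{p-1}(K) ⊗
  P_p(Iₙ)` is orthogonality of every time slice to `P_{p-1}(K)`. In reference coordinates in which
  the face is `r = 0`, a slice that vanishes there is `r u` with `u` of lower degree, and testing
  with `u` gives `u = 0`; the inequality then follows from finite dimensionality, with powers of
  `h_K` from the affine change of variables. Together with the discrete trace inequality
  (`exists_face_le_vol`) it makes the norms of a top order function on the three faces comparable
  (`l2norm_face_le_face`).
* By the divergence theorem `∑ ∫ (dV · n) dW = 0` over the lateral boundary, since the spatial
  derivatives of top order functions belong to `W̃_h` (`sum_integral_normal_mul`). Testing the face equations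
  with `dW` therefore gives the energy identity `∑ ∫ τ dW² = -∑ ∫ b dW` (`IsErrorPair.energy`).

*Existence and uniqueness.* For zero data the energy identity gives `dW = 0` on the faces, hence
`dW = 0`; then `dV · n = 0` on every face, hence `dV · n = 0` in the element for three directions
that span the plane. As the system is square (`finrank_testDual_le`), it is uniquely solvable
(`existsUnique_isHDGProj`).

*Estimate of `v`.* Green's formula for `q`, which passes to `H¹` and its traces by density
(`green`), turns `∑ ∫ ((q - P_V q) · n) dW` into `∫ (div q - P div q) dW`
(`sum_integral_normal_error`), and the energy identity bounds `dW` on the faces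
(`exists_l2norm_scalar_le`).

*Estimate of `q`.* Testing with `dV · n` bounds `dV · n` on each face by `τ dW` and `b`, and shape
regularity recovers `dV` from its normal components (`l2norm_vec_vol_le`). In general `‖τ dW‖`
costs the factor `Cmax / Cmin` (`exists_l2norm_vec_le`). If `τ` is constant on the faces, the
energy identity bounds `τ dW` on the face with the largest `τ`, and the comparability of the faces
does the rest, without that factor (`exists_l2norm_vec_le_of_facewiseConst`).

*Estimate on the bases.* This is the triangle inequality with an inverse inequality in time
(`exists_vec_end_le_vol`); `Δt ≤ T` enters through the bounds of the weight.

Weights are absorbed into the measures: `wmeas a μ` is `μ` with the density `fₙ`, so that all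
norms are plain `L²` norms (`l2norm`).
-/

/-! ### The `L²` seminorm and finite-dimensional spaces of functions -/

section L2

variable {X : Type*} [MeasurableSpace X] {ν : Measure X}
variable {F : Type*} [NormedAddCommGroup F]

/-- The `L²(ν)` seminorm `(∫ ‖g‖² dν)^{1/2}`. -/
noncomputable def l2norm (ν : Measure X) (g : X → F) : ℝ := Real.sqrt (∫ z, ‖g z‖ ^ 2 ∂ν)

lemma l2norm_nonneg (g : X → F) : 0 ≤ l2norm ν g := Real.sqrt_nonneg _

lemma sq_l2norm (g : X → F) : l2norm ν g ^ 2 = ∫ z, ‖g z‖ ^ 2 ∂ν :=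
  Real.sq_sqrt (integral_nonneg fun _ => by positivity)

lemma sq_l2norm_real (g : X → ℝ) : l2norm ν g ^ 2 = ∫ z, g z ^ 2 ∂ν := by
  simp [sq_l2norm]

lemma l2norm_eq_toReal {g : X → F} (hg : MemLp g 2 ν) :
    l2norm ν g = (eLpNorm g 2 ν).toReal := by
  rw [hg.eLpNorm_eq_integral_rpow_norm (by norm_num) (by norm_num),
    ENNReal.toReal_ofReal (by positivity), l2norm, Real.sqrt_eq_rpow]
  norm_num

lemma l2norm_add_le {f g : X → F} (hf : MemLp f 2 ν) (hg : MemLp g 2 ν) :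
    l2norm ν (fun z => f z + g z) ≤ l2norm ν f + l2norm ν g := by
  have h : MemLp (f + g) 2 ν := hf.add hg
  change l2norm ν (f + g) ≤ _
  rw [l2norm_eq_toReal h, l2norm_eq_toReal hf, l2norm_eq_toReal hg,
    ← ENNReal.toReal_add hf.2.ne hg.2.ne]
  exact ENNReal.toReal_mono (ENNReal.add_lt_top.2 ⟨hf.2, hg.2⟩).ne
    (eLpNorm_add_le hf.1 hg.1 (by norm_num))

lemma l2norm_congr_norm {F' : Type*} [NormedAddCommGroup F'] {f : X → F} {g : X → F'}
    (h : ∀ᵐ z ∂ν, ‖f z‖ = ‖g z‖) : l2norm ν f = l2norm ν g := by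
  rw [l2norm, l2norm]
  congr 1
  exact integral_congr_ae (by filter_upwards [h] with z hz; rw [hz])

lemma l2norm_sub_le {f g : X → F} (hf : MemLp f 2 ν) (hg : MemLp g 2 ν) :
    l2norm ν (fun z => f z - g z) ≤ l2norm ν f + l2norm ν g := by
  have := l2norm_add_le hf hg.neg
  rw [l2norm_congr_norm (f := -g) (g := g) (by simp)] at this
  simpa [sub_eq_add_neg] using this

lemma l2norm_mono {F' : Type*} [NormedAddCommGroup F'] {f : X → F} {g : X → F'}
    (hg : MemLp g 2 ν) {c : ℝ} (hc : 0 ≤ c) (h : ∀ᵐ z ∂ν, ‖f z‖ ≤ c * ‖g z‖) :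
    l2norm ν f ≤ c * l2norm ν g := by
  rw [l2norm, l2norm, ← Real.sqrt_sq hc, ← Real.sqrt_mul (sq_nonneg c), ← integral_const_mul]
  refine Real.sqrt_le_sqrt (integral_mono_of_nonneg (ae_of_all _ fun _ => by positivity)
    (hg.integrable_norm_pow (by norm_num) |>.const_mul _) ?_)
  filter_upwards [h] with z hz
  calc ‖f z‖ ^ 2 ≤ (c * ‖g z‖) ^ 2 := by gcongr
    _ = c ^ 2 * ‖g z‖ ^ 2 := by ring

/-- The linear map into `L²(ν)` induced by a linear family of square integrable functions. -/
noncomputable def toL2 {U : Type*} [AddCommGroup U] [Module ℝ U] (T : U →ₗ[ℝ] (X → ℝ))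
    (h : ∀ u, MemLp (T u) 2 ν) : U →ₗ[ℝ] Lp ℝ 2 ν where
  toFun u := (h u).toLp (T u)
  map_add' u w := by
    rw [← MemLp.toLp_add]; congr 1; simp
  map_smul' c u := by
    rw [RingHom.id_apply, ← MemLp.toLp_const_smul]; congr 1; simp

lemma inner_toLp {f g : X → ℝ} (hf : MemLp f 2 ν) (hg : MemLp g 2 ν) :
    inner ℝ (hf.toLp f) (hg.toLp g) = ∫ z, f z * g z ∂ν := by
  rw [L2.inner_def]
  refine integral_congr_ae ?_
  filter_upwards [hf.coeFn_toLp, hg.coeFn_toLp] with z h1 h2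
  rw [h1, h2]
  simp [mul_comm]

lemma norm_toLp {f : X → ℝ} (hf : MemLp f 2 ν) : ‖hf.toLp f‖ = l2norm ν f := by
  rw [Lp.norm_toLp, l2norm_eq_toReal hf]

lemma norm_toL2 {U : Type*} [AddCommGroup U] [Module ℝ U] (T : U →ₗ[ℝ] (X → ℝ))
    (h : ∀ u, MemLp (T u) 2 ν) (u : U) : ‖toL2 T h u‖ = l2norm ν (T u) := norm_toLp (h u)

lemma abs_integral_mul_le {f g : X → ℝ} (hf : MemLp f 2 ν) (hg : MemLp g 2 ν) :
    |∫ z, f z * g z ∂ν| ≤ l2norm ν f * l2norm ν g := by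
  rw [← inner_toLp hf hg, ← norm_toLp hf, ← norm_toLp hg]
  exact abs_real_inner_le_norm _ _

lemma integrable_mul_of_memLp {f g : X → ℝ} (hf : MemLp f 2 ν) (hg : MemLp g 2 ν) :
    Integrable (fun z => f z * g z) ν := hf.integrable_mul hg

/-- If the kernel of the linear map `S` on a finite-dimensional space is contained in the kernel
of `R`, then `R` is bounded by `S`. -/
lemma exists_norm_le_of_ker_le {V E₁ E₂ : Type*} [AddCommGroup V] [Module ℝ V]
    [FiniteDimensional ℝ V] [NormedAddCommGroup E₁] [NormedSpace ℝ E₁]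
    [NormedAddCommGroup E₂] [NormedSpace ℝ E₂] (R : V →ₗ[ℝ] E₁) (S : V →ₗ[ℝ] E₂)
    (h : ∀ u, S u = 0 → R u = 0) : ∃ C : ℝ, 0 < C ∧ ∀ u, ‖R u‖ ≤ C * ‖S u‖ := by
  obtain ⟨g, hg⟩ : ∃ g : LinearMap.range S →ₗ[ℝ] E₁, g ∘ₗ S.rangeRestrict = R := by
    obtain ⟨s, hs⟩ := S.rangeRestrict.exists_rightInverse_of_surjective S.range_rangeRestrict
    refine ⟨R ∘ₗ s, LinearMap.ext fun u => ?_⟩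
    have h1 : S (s (S.rangeRestrict u) - u) = 0 := by
      have := congrArg Subtype.val (LinearMap.congr_fun hs (S.rangeRestrict u))
      simp only [LinearMap.comp_apply, LinearMap.id_apply] at this
      rw [map_sub, sub_eq_zero]
      exact this
    have h2 := h _ h1
    rw [map_sub, sub_eq_zero] at h2
    exact h2
  let G := LinearMap.toContinuousLinearMap g
  refine ⟨‖G‖ + 1, by positivity, fun u => ?_⟩
  have h1 : R u = G (S.rangeRestrict u) := by
    rw [← hg]; rfl
  rw [h1]
  refine (G.le_opNorm _).trans ?_
  have : ‖S.rangeRestrict u‖ = ‖S u‖ := rfl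
  rw [this]
  gcongr
  linarith

/-- On a finite-dimensional space of functions an `L²` seminorm is bounded by any other one that
vanishes only where the first one does. -/
lemma exists_l2norm_le_of_eq_zero {μ : Measure X} (V : Submodule ℝ (X → ℝ))
    [FiniteDimensional ℝ V] (hμ : ∀ u ∈ V, MemLp u 2 μ) (hν : ∀ u ∈ V, MemLp u 2 ν)
    (h : ∀ u ∈ V, l2norm ν u = 0 → l2norm μ u = 0) :
    ∃ C : ℝ, 0 < C ∧ ∀ u ∈ V, l2norm μ u ≤ C * l2norm ν u := by
  have h1 : ∀ u : V, MemLp (V.subtype u) 2 μ := fun u => hμ u u.2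
  have h2 : ∀ u : V, MemLp (V.subtype u) 2 ν := fun u => hν u u.2
  obtain ⟨C, hC, hb⟩ := exists_norm_le_of_ker_le (toL2 V.subtype h1) (toL2 V.subtype h2)
    (fun u hu => by
      rw [← norm_eq_zero, norm_toL2] at hu ⊢
      exact h u u.2 hu)
  refine ⟨C, hC, fun u hu => ?_⟩
  have := hb ⟨u, hu⟩
  rwa [norm_toL2, norm_toL2] at this

lemma ae_eq_zero_of_l2norm_eq_zero {g : X → ℝ} (hg : MemLp g 2 ν) (h : l2norm ν g = 0) :
    ∀ᵐ z ∂ν, g z = 0 := by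
  have h0 : ∫ z, g z ^ 2 ∂ν = 0 := by
    rw [← sq_l2norm_real, h]; norm_num
  rw [integral_eq_zero_iff_of_nonneg (fun z => by positivity) hg.integrable_sq] at h0
  filter_upwards [h0] with z hz
  simpa using hz

/-- A continuous function that vanishes in `L²(ν)` vanishes on every open set on which `ν`
dominates a measure that is positive on open sets. -/
lemma eqOn_zero_of_l2norm_eq_zero [TopologicalSpace X] [OpensMeasurableSpace X] {μ : Measure X}
    [μ.IsOpenPosMeasure] {s : Set X} (hs : IsOpen s) (hac : μ.restrict s ≪ ν) {g : X → ℝ}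
    (hg : Continuous g) (hgL : MemLp g 2 ν) (h : l2norm ν g = 0) : Set.EqOn g 0 s :=
  Measure.eqOn_open_of_ae_eq (hac.ae_le (ae_eq_zero_of_l2norm_eq_zero hgL h)) hs hg.continuousOn
    continuousOn_const

/-- Continuous functions are square integrable for finite measures on compact sets. -/
lemma memLp_of_continuous [TopologicalSpace X] [OpensMeasurableSpace X] [IsFiniteMeasure ν]
    {S : Set X} (hS : IsCompact S) (hν : ∀ᵐ z ∂ν, z ∈ S) {g : X → ℝ} (hg : Continuous g)
    {q : ENNReal} : MemLp g q ν := by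
  obtain ⟨C, hC⟩ := hS.exists_bound_of_continuousOn hg.continuousOn
  exact MemLp.of_bound hg.aestronglyMeasurable C (hν.mono fun z hz => hC z hz)

end L2

/-! ### Spaces of tensor product polynomials -/

section Polynomials

variable {X Y : Type*}

/-- The span of the products `t^k x^i y^j` with `i + j < r` and `k < m`, for three given
coordinate functions `t`, `x`, `y` on an arbitrary type. -/
def monoSpan (t x y : X → ℝ) (r m : ℕ) : Submodule ℝ (X → ℝ) :=
  Submodule.span ℝ {w | ∃ i j k : ℕ, i + j < r ∧ k < m ∧
    w = fun z => t z ^ k * (x z ^ i * y z ^ j)}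

lemma tensorPoly_eq_monoSpan (r m : ℕ) : tensorPoly r m =
    monoSpan (fun z : SpaceTime => z.1) (fun z => z.2 0) (fun z => z.2 1) r m := rfl

/-- The polynomials `P_{r-1} ⊗ P_{m-1}` in the reference coordinates `(t, (s, r))`. -/
def refPoly (r m : ℕ) : Submodule ℝ (ℝ × (ℝ × ℝ) → ℝ) :=
  monoSpan (fun z => z.1) (fun z => z.2.1) (fun z => z.2.2) r m

/-- The polynomials in two variables of total degree less than `r`. -/
def planePoly (r : ℕ) : Submodule ℝ (ℝ × ℝ → ℝ) :=
  monoSpan (fun _ => 1) (fun z => z.1) (fun z => z.2) r 1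

/-- The polynomials in one variable of degree less than `m`. -/
def linePoly (m : ℕ) : Submodule ℝ (ℝ → ℝ) :=
  monoSpan (fun z => z) (fun _ => 1) (fun _ => 1) 1 m

variable {t x y : X → ℝ} {r m : ℕ}

lemma mono_mem {i j k : ℕ} (h : i + j < r) (hk : k < m) :
    (fun z => t z ^ k * (x z ^ i * y z ^ j)) ∈ monoSpan t x y r m :=
  Submodule.subset_span ⟨i, j, k, h, hk, rfl⟩

/-- A linear map sends `monoSpan` into `S` as soon as it sends the generators there. -/
lemma monoSpan_le_comap {E : Type*} [AddCommGroup E] [Module ℝ E] (L : (X → ℝ) →ₗ[ℝ] E)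
    (S : Submodule ℝ E) (h : ∀ i j k, i + j < r → k < m →
      L (fun z => t z ^ k * (x z ^ i * y z ^ j)) ∈ S) {w : X → ℝ}
    (hw : w ∈ monoSpan t x y r m) : L w ∈ S := by
  have : monoSpan t x y r m ≤ S.comap L := by
    refine Submodule.span_le.2 ?_
    rintro _ ⟨i, j, k, h1, h2, rfl⟩
    exact h i j k h1 h2
  exact this hw

/-- Induction on the elements of `monoSpan`. -/
lemma monoSpan_induction {P : (X → ℝ) → Prop}
    (hm : ∀ i j k, i + j < r → k < m → P (fun z => t z ^ k * (x z ^ i * y z ^ j)))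
    (h0 : P 0) (ha : ∀ f g, P f → P g → P (f + g)) (hs : ∀ (c : ℝ) f, P f → P (c • f))
    {w : X → ℝ} (hw : w ∈ monoSpan t x y r m) : P w := by
  induction hw using Submodule.span_induction with
  | mem w h => obtain ⟨i, j, k, h1, h2, rfl⟩ := h; exact hm i j k h1 h2
  | zero => exact h0
  | add f g _ _ hf hg => exact ha f g hf hg
  | smul c f _ hf => exact hs c f hf

lemma monoSpan_mono {r' : ℕ} (h : r ≤ r') : monoSpan t x y r m ≤ monoSpan t x y r' m := by
  refine Submodule.span_mono ?_
  rintro _ ⟨i, j, k, h1, h2, rfl⟩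
  exact ⟨i, j, k, by omega, h2, rfl⟩

lemma affine_mul_mem {w : X → ℝ} (hw : w ∈ monoSpan t x y r m) {l : X → ℝ} {a b c : ℝ}
    (hl : ∀ z, l z = a + b * x z + c * y z) :
    (fun z => l z * w z) ∈ monoSpan t x y (r + 1) m := by
  refine monoSpan_induction (P := fun w => (fun z => l z * w z) ∈ monoSpan t x y (r + 1) m)
    ?_ ?_ ?_ ?_ hw
  · intro i j k h1 h2
    have e : (fun z => l z * (t z ^ k * (x z ^ i * y z ^ j))) =
        a • (fun z => t z ^ k * (x z ^ i * y z ^ j)) +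
        b • (fun z => t z ^ k * (x z ^ (i + 1) * y z ^ j)) +
        c • (fun z => t z ^ k * (x z ^ i * y z ^ (j + 1))) := by
      funext z
      simp only [hl, Pi.add_apply, Pi.smul_apply, smul_eq_mul]
      ring
    rw [e]
    exact add_mem (add_mem (Submodule.smul_mem _ _ (mono_mem (by omega) h2))
      (Submodule.smul_mem _ _ (mono_mem (by omega) h2)))
      (Submodule.smul_mem _ _ (mono_mem (by omega) h2))
  · convert! Submodule.zero_mem (monoSpan t x y (r + 1) m) using 1
    funext z; simp
  · intro f g hf hg
    convert! add_mem hf hg using 1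
    funext z; simp [mul_add]
  · intro c f hf
    convert! Submodule.smul_mem _ c hf using 1
    funext z; simp; ring

/-- The space does not grow under an affine change of the coordinates `x`, `y`. -/
lemma monoSpan_affine_le {ξ η : X → ℝ} {a b c a' b' c' : ℝ}
    (hξ : ∀ z, ξ z = a + b * x z + c * y z) (hη : ∀ z, η z = a' + b' * x z + c' * y z) :
    monoSpan t ξ η r m ≤ monoSpan t x y r m := by
  have key : ∀ i j k, k < m →
      (fun z => t z ^ k * (ξ z ^ i * η z ^ j)) ∈ monoSpan t x y (i + j + 1) m := by
    intro i
    induction i with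
    | zero =>
      intro j
      induction j with
      | zero => intro k hk; simpa using mono_mem (t := t) (x := x) (y := y) (i := 0) (j := 0)
                  (r := 1) (by norm_num) hk
      | succ j ih =>
        intro k hk
        convert! affine_mul_mem (ih k hk) hη using 1
        funext z; ring
    | succ i ih =>
      intro j k hk
      convert! affine_mul_mem (ih j k hk) hξ using 1
      · congr 1; ring
      · funext z; ring
  refine Submodule.span_le.2 ?_
  rintro _ ⟨i, j, k, h1, h2, rfl⟩
  exact monoSpan_mono (by omega) (key i j k h2)

lemma comp_mem_monoSpan {w : X → ℝ} (hw : w ∈ monoSpan t x y r m) (φ : Y → X) :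
    (fun z => w (φ z)) ∈ monoSpan (fun z => t (φ z)) (fun z => x (φ z)) (fun z => y (φ z)) r m :=
  monoSpan_le_comap (LinearMap.funLeft ℝ ℝ φ) _ (fun _ _ _ h1 h2 => mono_mem h1 h2) hw

instance finiteDimensional_monoSpan : FiniteDimensional ℝ (monoSpan t x y r m) := by
  refine FiniteDimensional.span_of_finite ℝ (Set.Finite.subset
    (((Set.finite_Iio r).prod ((Set.finite_Iio r).prod (Set.finite_Iio m))).image
      (fun (a : ℕ × ℕ × ℕ) => fun z => t z ^ a.2.2 * (x z ^ a.1 * y z ^ a.2.1))) ?_)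
  rintro _ ⟨i, j, k, h1, h2, rfl⟩
  exact ⟨(i, j, k), ⟨Set.mem_Iio.2 (by omega : i < r), Set.mem_Iio.2 (by omega : j < r), h2⟩, rfl⟩

instance : FiniteDimensional ℝ (planePoly r) := finiteDimensional_monoSpan
instance : FiniteDimensional ℝ (linePoly r) := finiteDimensional_monoSpan
instance : FiniteDimensional ℝ (spaceW r) := finiteDimensional_monoSpan
instance : FiniteDimensional ℝ (spaceWt r) := finiteDimensional_monoSpan

lemma pow_mem_linePoly {k : ℕ} (hk : k < m) : (fun z : ℝ => z ^ k) ∈ linePoly m := by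
  simpa [linePoly] using mono_mem (t := fun z : ℝ => z) (x := fun _ => 1) (y := fun _ => 1)
    (i := 0) (j := 0) (r := 1) (by norm_num) hk

lemma pow_mul_pow_mem_planePoly {i j : ℕ} (h : i + j < r) :
    (fun z : ℝ × ℝ => z.1 ^ i * z.2 ^ j) ∈ planePoly r := by
  simpa [planePoly] using mono_mem (t := fun _ : ℝ × ℝ => (1 : ℝ)) (x := fun z => z.1)
    (y := fun z => z.2) (k := 0) (m := 1) h (by norm_num)

lemma linePoly_comp_affine {f : ℝ → ℝ} (hf : f ∈ linePoly m) (c d : ℝ) :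
    (fun s => f (c + d * s)) ∈ linePoly m := by
  refine monoSpan_le_comap (LinearMap.funLeft ℝ ℝ (fun s : ℝ => c + d * s)) _ ?_ hf
  intro i j k _ hk
  have e : LinearMap.funLeft ℝ ℝ (fun s : ℝ => c + d * s)
      (fun z => z ^ k * ((1 : ℝ) ^ i * 1 ^ j)) =
      ∑ n ∈ Finset.range (k + 1), (c ^ n * d ^ (k - n) * (k.choose n : ℝ)) •
        (fun s : ℝ => s ^ (k - n)) := by
    funext s
    simp only [LinearMap.funLeft_apply, one_pow, mul_one, add_pow, Finset.sum_apply,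
      Pi.smul_apply, smul_eq_mul]
    refine Finset.sum_congr rfl fun n _ => ?_
    rw [mul_pow]; ring
  rw [e]
  exact Submodule.sum_mem _ fun n _ => Submodule.smul_mem _ _ (pow_mem_linePoly (by omega))

lemma refPoly_slice_space {w : ℝ × (ℝ × ℝ) → ℝ} (hw : w ∈ refPoly r m) (t : ℝ) :
    (fun y => w (t, y)) ∈ planePoly r := by
  refine monoSpan_le_comap (LinearMap.funLeft ℝ ℝ (fun y : ℝ × ℝ => (t, y))) _ ?_ hw
  intro i j k h1 _
  exact Submodule.smul_mem _ (t ^ k) (pow_mul_pow_mem_planePoly h1)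

lemma tensorPoly_slice_time {w : SpaceTime → ℝ} (hw : w ∈ tensorPoly r m) (x : Plane) :
    (fun t => w (t, x)) ∈ linePoly m := by
  refine monoSpan_le_comap (LinearMap.funLeft ℝ ℝ (fun t : ℝ => ((t, x) : SpaceTime))) _ ?_ hw
  intro i j k _ h2
  convert! Submodule.smul_mem _ (x 0 ^ i * x 1 ^ j) (pow_mem_linePoly h2) using 1
  funext s
  simp [LinearMap.funLeft_apply]; ring

lemma mul_mem_refPoly {f : ℝ → ℝ} (hf : f ∈ linePoly m) {u : ℝ × ℝ → ℝ} (hu : u ∈ planePoly r) :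
    (fun z : ℝ × (ℝ × ℝ) => f z.1 * u z.2) ∈ refPoly r m := by
  refine monoSpan_induction (P := fun f : ℝ → ℝ =>
    (fun z : ℝ × (ℝ × ℝ) => f z.1 * u z.2) ∈ refPoly r m) ?_ ?_ ?_ ?_ hf
  · intro i j k _ hk
    refine monoSpan_induction (P := fun u : ℝ × ℝ → ℝ =>
      (fun z : ℝ × (ℝ × ℝ) => (z.1 ^ k * ((1 : ℝ) ^ i * 1 ^ j)) * u z.2) ∈ refPoly r m)
      ?_ ?_ ?_ ?_ hu
    · intro i' j' k' h _
      convert! mono_mem (t := fun z : ℝ × (ℝ × ℝ) => z.1) (x := fun z => z.2.1)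
        (y := fun z => z.2.2) h hk using 1
      funext z; simp
    · convert! Submodule.zero_mem (refPoly r m) using 1
      funext z; simp
    · intro f g hf hg
      convert! add_mem hf hg using 1
      funext z; simp [mul_add]
    · intro c f hf
      convert! Submodule.smul_mem _ c hf using 1
      funext z; simp; ring
  · convert! Submodule.zero_mem (refPoly r m) using 1
    funext z; simp
  · intro f g hf hg
    convert! add_mem hf hg using 1
    funext z; simp [add_mul]
  · intro c f hf
    convert! Submodule.smul_mem _ c hf using 1
    funext z; simp; ring

/-- A bivariate polynomial splits off its part that is divisible by the second variable. -/
lemma planePoly_decomp {u : ℝ × ℝ → ℝ} (hu : u ∈ planePoly (r + 1)) :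
    ∃ g ∈ linePoly (r + 1), ∃ h ∈ planePoly r, ∀ z, u z = g z.1 + z.2 * h z := by
  refine monoSpan_induction (P := fun u : ℝ × ℝ → ℝ =>
    ∃ g ∈ linePoly (r + 1), ∃ h ∈ planePoly r, ∀ z, u z = g z.1 + z.2 * h z) ?_ ?_ ?_ ?_ hu
  · intro i j k h1 _
    cases j with
    | zero =>
      exact ⟨_, pow_mem_linePoly (k := i) (by omega), 0, zero_mem _, fun z => by simp⟩
    | succ j =>
      refine ⟨0, zero_mem _, _, pow_mul_pow_mem_planePoly (i := i) (j := j) (by omega),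
        fun z => ?_⟩
      simp; ring
  · exact ⟨0, zero_mem _, 0, zero_mem _, fun z => by simp⟩
  · rintro f f' ⟨g, hg, h, hh, e⟩ ⟨g', hg', h', hh', e'⟩
    exact ⟨g + g', add_mem hg hg', h + h', add_mem hh hh', fun z => by
      simp only [Pi.add_apply, e, e']; ring⟩
  · rintro c f ⟨g, hg, h, hh, e⟩
    exact ⟨c • g, Submodule.smul_mem _ _ hg, c • h, Submodule.smul_mem _ _ hh, fun z => by
      simp only [Pi.smul_apply, smul_eq_mul, e]; ring⟩

/-! ### Regularity and derivatives of polynomials -/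

lemma analyticOnNhd_monoSpan {E : Type*} [NormedAddCommGroup E] [NormedSpace ℝ E]
    {t x y : E → ℝ} (ht : AnalyticOnNhd ℝ t Set.univ) (hx : AnalyticOnNhd ℝ x Set.univ)
    (hy : AnalyticOnNhd ℝ y Set.univ) {w : E → ℝ} (hw : w ∈ monoSpan t x y r m) :
    AnalyticOnNhd ℝ w Set.univ := by
  refine monoSpan_induction (P := fun w => AnalyticOnNhd ℝ w Set.univ) ?_ ?_ ?_ ?_ hw
  · intro i j k _ _
    exact (ht.pow k).mul ((hx.pow i).mul (hy.pow j))
  · exact analyticOnNhd_const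
  · intro f g hf hg
    exact hf.add hg
  · intro c f hf
    exact analyticOnNhd_const.mul hf

lemma analyticOnNhd_tensorPoly {w : SpaceTime → ℝ} (hw : w ∈ tensorPoly r m) :
    AnalyticOnNhd ℝ w Set.univ := by
  have h (i : Fin 2) : AnalyticOnNhd ℝ (fun z : SpaceTime => z.2 i) Set.univ :=
    ((EuclideanSpace.proj i : Plane →L[ℝ] ℝ).comp
      (ContinuousLinearMap.snd ℝ ℝ Plane)).analyticOnNhd _
  exact analyticOnNhd_monoSpan ((ContinuousLinearMap.fst ℝ ℝ Plane).analyticOnNhd _) (h 0) (h 1) hw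

lemma contDiff_tensorPoly {w : SpaceTime → ℝ} (hw : w ∈ tensorPoly r m) : ContDiff ℝ ∞ w :=
  contDiffOn_univ.1 ((analyticOnNhd_tensorPoly hw).contDiffOn uniqueDiffOn_univ)

lemma analyticOnNhd_refPoly {w : ℝ × (ℝ × ℝ) → ℝ} (hw : w ∈ refPoly r m) :
    AnalyticOnNhd ℝ w Set.univ :=
  analyticOnNhd_monoSpan analyticOnNhd_fst
    (((ContinuousLinearMap.fst ℝ ℝ ℝ).comp (ContinuousLinearMap.snd ℝ ℝ (ℝ × ℝ))).analyticOnNhd _)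
    (((ContinuousLinearMap.snd ℝ ℝ ℝ).comp (ContinuousLinearMap.snd ℝ ℝ (ℝ × ℝ))).analyticOnNhd _)
    hw

lemma analyticOnNhd_planePoly {w : ℝ × ℝ → ℝ} (hw : w ∈ planePoly r) :
    AnalyticOnNhd ℝ w Set.univ :=
  analyticOnNhd_monoSpan analyticOnNhd_const analyticOnNhd_fst analyticOnNhd_snd hw

lemma analyticOnNhd_linePoly {w : ℝ → ℝ} (hw : w ∈ linePoly r) : AnalyticOnNhd ℝ w Set.univ :=
  analyticOnNhd_monoSpan analyticOnNhd_id analyticOnNhd_const analyticOnNhd_const hw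

lemma AnalyticOnNhd.continuous_of_univ {E : Type*} [NormedAddCommGroup E] [NormedSpace ℝ E]
    {w : E → ℝ} (h : AnalyticOnNhd ℝ w Set.univ) : Continuous w :=
  continuousOn_univ.1 h.continuousOn

/-- An analytic function that vanishes on a nonempty open set vanishes everywhere. -/
lemma AnalyticOnNhd.eq_zero_of_eqOn {E : Type*} [NormedAddCommGroup E] [NormedSpace ℝ E]
    {w : E → ℝ} (h : AnalyticOnNhd ℝ w Set.univ) {s : Set E} (hs : IsOpen s) (hne : s.Nonempty)
    (h0 : Set.EqOn w 0 s) : w = 0 := by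
  obtain ⟨z, hz⟩ := hne
  exact h.eq_of_eventuallyEq (z₀ := z) analyticOnNhd_const
    (Filter.eventuallyEq_of_mem (hs.mem_nhds hz) h0)

/-- The spatial partial derivatives lower the degree in space. -/
lemma fderiv_tensorPoly_mem {w : SpaceTime → ℝ} (hw : w ∈ tensorPoly (r + 1) m) (j : Fin 2) :
    (fun z => fderiv ℝ w z (coordDir j.succ)) ∈ tensorPoly r m := by
  suffices DifferentiableOn ℝ w Set.univ ∧
      (fun z => fderiv ℝ w z (coordDir j.succ)) ∈ tensorPoly r m from this.2
  refine monoSpan_induction (P := fun w : SpaceTime → ℝ => DifferentiableOn ℝ w Set.univ ∧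
      (fun z => fderiv ℝ w z (coordDir j.succ)) ∈ tensorPoly r m) ?_ ?_ ?_ ?_ hw
  · intro a b k h1 h2
    have hd : ∀ i : Fin 2, ∀ z : SpaceTime, HasFDerivAt (fun z : SpaceTime => z.2 i)
        ((EuclideanSpace.proj i : Plane →L[ℝ] ℝ).comp
          (ContinuousLinearMap.snd ℝ ℝ Plane)) z := fun i z =>
      ((EuclideanSpace.proj i : Plane →L[ℝ] ℝ).comp
          (ContinuousLinearMap.snd ℝ ℝ Plane)).hasFDerivAt
    have ht : ∀ z : SpaceTime, HasFDerivAt (fun z : SpaceTime => z.1)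
        (ContinuousLinearMap.fst ℝ ℝ Plane) z := fun z => hasFDerivAt_fst
    have hw : ∀ z : SpaceTime, _ := fun z =>
      ((ht z).pow k).mul (((hd 0 z).pow a).mul ((hd 1 z).pow b))
    refine ⟨fun z _ => (hw z).differentiableAt.differentiableWithinAt, ?_⟩
    have e : (fun z : SpaceTime => fderiv ℝ (fun z : SpaceTime =>
        z.1 ^ k * (z.2 0 ^ a * z.2 1 ^ b)) z (coordDir j.succ)) =
        fun z => z.1 ^ k * (z.2 0 ^ a * (b * z.2 1 ^ (b - 1) * (coordDir j.succ).2 1)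
          + z.2 1 ^ b * (a * z.2 0 ^ (a - 1) * (coordDir j.succ).2 0)) := by
      funext z
      refine (congrArg (fun L => L (coordDir j.succ)) (hw z).fderiv).trans ?_
      have h0 : (coordDir j.succ).1 = 0 := by fin_cases j <;> rfl
      simp [h0, mul_add]
    rw [e]
    have hmem : ∀ (c : ℝ) (i j : ℕ), i + j < r →
        (fun z : SpaceTime => c * (z.1 ^ k * (z.2 0 ^ i * z.2 1 ^ j))) ∈ tensorPoly r m :=
      fun c i j h => Submodule.smul_mem _ c (mono_mem h h2)
    have h3 : (fun z : SpaceTime => (b * (coordDir j.succ).2 1) *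
        (z.1 ^ k * (z.2 0 ^ a * z.2 1 ^ (b - 1)))) ∈ tensorPoly r m := by
      rcases Nat.eq_zero_or_pos b with rfl | hb
      · convert! Submodule.zero_mem (tensorPoly r m) using 1
        funext z; simp
      · exact hmem _ _ _ (by omega)
    have h4 : (fun z : SpaceTime => (a * (coordDir j.succ).2 0) *
        (z.1 ^ k * (z.2 0 ^ (a - 1) * z.2 1 ^ b))) ∈ tensorPoly r m := by
      rcases Nat.eq_zero_or_pos a with rfl | hb
      · convert! Submodule.zero_mem (tensorPoly r m) using 1
        funext z; simp
      · exact hmem _ _ _ (by omega)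
    convert! add_mem h3 h4 using 1
    funext z
    simp only [Pi.add_apply]
    ring
  · refine ⟨differentiableOn_const 0, ?_⟩
    convert! Submodule.zero_mem (tensorPoly r m) using 1
    funext z; simp
  · rintro f g ⟨hf, hf'⟩ ⟨hg, hg'⟩
    refine ⟨hf.add hg, ?_⟩
    convert! add_mem hf' hg' using 1
    funext z
    rw [fderiv_add (hf.differentiableAt univ_mem) (hg.differentiableAt univ_mem)]
    rfl
  · rintro c f ⟨hf, hf'⟩
    refine ⟨hf.const_smul c, ?_⟩
    convert! Submodule.smul_mem _ c hf' using 1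
    funext z
    rw [fderiv_const_smul (hf.differentiableAt univ_mem)]
    rfl

/-! ### Dimensions of the polynomial spaces -/

/-- The exponents `(i, j)` of the bivariate monomials of degree less than `r`. -/
def expo (r : ℕ) : Finset (ℕ × ℕ) :=
  (Finset.range r).biUnion fun n => Finset.HasAntidiagonal.antidiagonal n

lemma mem_expo {i j : ℕ} : (i, j) ∈ expo r ↔ i + j < r := by
  simp [expo]

lemma card_expo_succ : (expo (r + 1)).card = (expo r).card + (r + 1) := by
  have h : expo (r + 1) = expo r ∪ Finset.HasAntidiagonal.antidiagonal r := by
    ext ⟨i, j⟩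
    rw [Finset.mem_union, mem_expo, mem_expo, Finset.HasAntidiagonal.mem_antidiagonal]
    omega
  rw [h, Finset.card_union_of_disjoint, Finset.Nat.card_antidiagonal]
  rw [Finset.disjoint_left]
  rintro ⟨i, j⟩ h1 h2
  rw [mem_expo] at h1
  rw [Finset.HasAntidiagonal.mem_antidiagonal] at h2
  omega

/-- The monomials that span `monoSpan`, as a finite family. -/
def monoFamily (t x y : X → ℝ) (r m : ℕ) (a : (expo r ×ˢ Finset.range m : Finset _)) : X → ℝ :=
  fun z => t z ^ a.1.2 * (x z ^ a.1.1.1 * y z ^ a.1.1.2)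

lemma monoSpan_eq_span_range :
    monoSpan t x y r m = Submodule.span ℝ (Set.range (monoFamily t x y r m)) := by
  rw [monoSpan]
  congr 1
  ext w
  constructor
  · rintro ⟨i, j, k, h1, h2, rfl⟩
    exact ⟨⟨((i, j), k), Finset.mem_product.2 ⟨mem_expo.2 h1, Finset.mem_range.2 h2⟩⟩, rfl⟩
  · rintro ⟨⟨⟨⟨i, j⟩, k⟩, h⟩, rfl⟩
    rw [Finset.mem_product] at h
    exact ⟨i, j, k, mem_expo.1 h.1, Finset.mem_range.1 h.2, rfl⟩

lemma linearIndependent_monoFamily :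
    LinearIndependent ℝ (monoFamily (fun z : SpaceTime => z.1) (fun z => z.2 0)
      (fun z => z.2 1) r m) := by
  -- the monomials are images of the basis monomials of a polynomial ring in three variables
  let ev : MvPolynomial (Fin 3) ℝ →ₗ[ℝ] (SpaceTime → ℝ) :=
    LinearMap.pi fun z => (MvPolynomial.aeval ![z.1, z.2 0, z.2 1]).toLinearMap
  have hev : LinearMap.ker ev = ⊥ := by
    rw [LinearMap.ker_eq_bot']
    intro P hP
    refine MvPolynomial.funext fun v => ?_
    have h1 : ev P (v 0, !₂[v 1, v 2]) = 0 := by rw [hP]; rfl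
    have h2 : ev P (v 0, !₂[v 1, v 2]) = MvPolynomial.eval v P := by
      change MvPolynomial.aeval ![v 0, v 1, v 2] P = _
      have : ![v 0, v 1, v 2] = v := by funext i; fin_cases i <;> rfl
      rw [this, MvPolynomial.aeval_eq_eval]
    rw [← h2, h1, map_zero]
  let e : (expo r ×ˢ Finset.range m : Finset _) → (Fin 3 →₀ ℕ) := fun a =>
    Finsupp.equivFunOnFinite.symm ![a.1.2, a.1.1.1, a.1.1.2]
  have he : Function.Injective e := by
    rintro ⟨⟨⟨i, j⟩, k⟩, h⟩ ⟨⟨⟨i', j'⟩, k'⟩, h'⟩ hab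
    have h := Finsupp.equivFunOnFinite.symm.injective hab
    have h0 := congrFun h 0
    have h1 := congrFun h 1
    have h2 := congrFun h 2
    simp at h0 h1 h2
    subst h0 h1 h2
    rfl
  have h := ((MvPolynomial.basisMonomials (Fin 3) ℝ).linearIndependent.comp e he).map' ev hev
  convert! h using 1
  funext a z
  simp only [Function.comp_apply, MvPolynomial.coe_basisMonomials]
  change _ = MvPolynomial.aeval ![z.1, z.2 0, z.2 1] (MvPolynomial.monomial (e a) 1)
  rw [MvPolynomial.aeval_monomial, Finsupp.prod_fintype _ _ (by simp)]
  simp [Fin.prod_univ_three, e, monoFamily, mul_assoc]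

lemma finrank_tensorPoly : Module.finrank ℝ (tensorPoly r m) = (expo r).card * m := by
  rw [tensorPoly_eq_monoSpan, monoSpan_eq_span_range,
    finrank_span_eq_card linearIndependent_monoFamily]
  simp

lemma tensorQ_eq_span_range (p : ℕ) : tensorQ p = Submodule.span ℝ (Set.range
    (fun (a : Fin (p + 1) × Fin (p + 1)) (y : ℝ × ℝ) => y.1 ^ (a.1 : ℕ) * y.2 ^ (a.2 : ℕ))) := by
  rw [tensorQ]
  congr 1
  ext w
  constructor
  · rintro ⟨k, l, h1, h2, rfl⟩
    exact ⟨(⟨k, by omega⟩, ⟨l, by omega⟩), rfl⟩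
  · rintro ⟨⟨k, l⟩, rfl⟩
    exact ⟨k, l, by omega, by omega, rfl⟩

instance (p : ℕ) : FiniteDimensional ℝ (tensorQ p) := by
  rw [tensorQ_eq_span_range]
  exact FiniteDimensional.span_of_finite ℝ (Set.finite_range _)

lemma finrank_tensorQ_le (p : ℕ) : Module.finrank ℝ (tensorQ p) ≤ (p + 1) * (p + 1) := by
  rw [tensorQ_eq_span_range]
  refine (finrank_range_le_card _).trans ?_
  simp

lemma continuous_tensorQ {p : ℕ} {f : ℝ × ℝ → ℝ} (hf : f ∈ tensorQ p) : Continuous f := by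
  induction hf using Submodule.span_induction with
  | mem w h => obtain ⟨k, l, _, _, rfl⟩ := h; fun_prop
  | zero => exact continuous_zero
  | add f g _ _ hf hg => exact hf.add hg
  | smul c f _ hf => exact hf.const_smul c

/-- The restriction of a polynomial to the face `r = 0` of the reference prism. -/
lemma refPoly_face_mem {p : ℕ} {w : ℝ × (ℝ × ℝ) → ℝ} (hw : w ∈ refPoly (p + 1) (p + 1)) :
    (fun y : ℝ × ℝ => w (y.1, (y.2, 0))) ∈ tensorQ p := by
  refine monoSpan_le_comap (LinearMap.funLeft ℝ ℝ (fun y : ℝ × ℝ => (y.1, (y.2, (0 : ℝ))))) _ ?_ hw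
  intro i j k h1 h2
  have e : LinearMap.funLeft ℝ ℝ (fun y : ℝ × ℝ => (y.1, (y.2, (0 : ℝ))))
      (fun z : ℝ × (ℝ × ℝ) => z.1 ^ k * (z.2.1 ^ i * z.2.2 ^ j)) =
      (0 : ℝ) ^ j • fun y : ℝ × ℝ => y.1 ^ k * y.2 ^ i := by
    funext y
    simp [LinearMap.funLeft_apply]; ring
  rw [e]
  exact Submodule.smul_mem _ _ (Submodule.subset_span ⟨k, i, by omega, by omega, rfl⟩)

end Polynomials

/-! ### Geometry of the triangle -/

/-- The determinant of two plane vectors. -/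
def cross (u v : Plane) : ℝ := u 0 * v 1 - u 1 * v 0

lemma plane_inner (u v : Plane) : inner ℝ u v = u 0 * v 0 + u 1 * v 1 := by
  simp [PiLp.inner_apply, Fin.sum_univ_two, mul_comm]

lemma plane_norm_sq (u : Plane) : ‖u‖ ^ 2 = u 0 ^ 2 + u 1 ^ 2 := by
  simp [EuclideanSpace.norm_sq_eq, Fin.sum_univ_two]

lemma cross_sq_add_inner_sq (u v : Plane) :
    cross u v ^ 2 + inner ℝ u v ^ 2 = ‖u‖ ^ 2 * ‖v‖ ^ 2 := by
  rw [plane_inner, plane_norm_sq, plane_norm_sq, cross]; ring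

lemma abs_cross_le (u v : Plane) : |cross u v| ≤ ‖u‖ * ‖v‖ := by
  refine abs_le_of_sq_le_sq ?_ (by positivity)
  nlinarith [cross_sq_add_inner_sq u v, sq_nonneg (inner ℝ u v : ℝ)]

namespace Prism

variable (K : Prism)

/-- The vector along the `i`-th edge. -/
def edge (i : Fin 3) : Plane := K.edgeEnd i - K.edgeStart i

/-- The vector from the starting point of the `i`-th edge to the opposite vertex. -/
def side (i : Fin 3) : Plane := K.tri.points i - K.edgeStart i

/-- The determinant of the affine map from the reference triangle to the spatial triangle: twice
the signed area. -/
noncomputable def jac : ℝ := cross (K.edge 0) (K.side 0)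

lemma cross_edge_side (i : Fin 3) : cross (K.edge i) (K.side i) = K.jac := by
  fin_cases i <;> simp [jac, cross, edge, side, edgeStart, edgeEnd] <;> ring

lemma sum_edge : K.edge 0 + K.edge 1 + K.edge 2 = 0 := by
  simp [edge, edgeStart, edgeEnd]

lemma side_eq (i : Fin 3) : K.side i = -K.edge (i + 2) := by
  fin_cases i <;> simp [edge, side, edgeStart, edgeEnd]

lemma cross_edge_edge (i : Fin 3) : cross (K.edge i) (K.edge (i + 2)) = -K.jac := by
  rw [← cross_edge_side K i, side_eq]
  simp [cross]; ring

/-- Height times edge and determinant are both twice the area of the triangle. -/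
lemma height_mul_edge (i : Fin 3) : K.tri.height i * ‖K.edge i‖ = |K.jac| := by
  set v : Plane := K.tri.points i - K.tri.altitudeFoot i with hv
  have h1 : inner ℝ (K.side i) v = K.tri.height i ^ 2 := by
    have := K.tri.inner_vsub_vsub_altitudeFoot_eq_height_sq (i := i) (j := i + 1) (by
      fin_cases i <;> decide)
    exact this
  have h2 : inner ℝ (K.tri.points i - K.edgeEnd i) v = K.tri.height i ^ 2 := by
    have := K.tri.inner_vsub_vsub_altitudeFoot_eq_height_sq (i := i) (j := i + 2) (by
      fin_cases i <;> decide)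
    exact this
  have hn : ‖v‖ = K.tri.height i := by
    rw [hv, ← dist_eq_norm]; rfl
  have h3 : inner ℝ (K.edge i) v = 0 := by
    have : K.edge i = K.side i - (K.tri.points i - K.edgeEnd i) := by
      simp [edge, side]
    rw [this, inner_sub_left, h1, h2, sub_self]
  have hpos := K.tri.height_pos i
  have h4 : (cross (K.edge i) v) ^ 2 = (K.tri.height i * ‖K.edge i‖) ^ 2 := by
    have := cross_sq_add_inner_sq (K.edge i) v
    rw [h3, hn] at this
    linarith [mul_pow (K.tri.height i) ‖K.edge i‖ 2]
  have h5 : K.jac * cross (K.edge i) v = ‖K.edge i‖ ^ 2 * K.tri.height i ^ 2 := by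
    rw [← cross_edge_side K i]
    have : cross (K.edge i) (K.side i) * cross (K.edge i) v =
        ‖K.edge i‖ ^ 2 * inner ℝ (K.side i) v - inner ℝ (K.edge i) v * inner ℝ (K.side i) (K.edge i)
        := by
      simp only [plane_inner, plane_norm_sq, cross]; ring
    rw [this, h3, h1]; ring
  have h6 : |cross (K.edge i) v| = K.tri.height i * ‖K.edge i‖ := by
    rw [← abs_of_nonneg (show 0 ≤ K.tri.height i * ‖K.edge i‖ by positivity)]
    exact (sq_eq_sq_iff_abs_eq_abs _ _).1 h4
  have h7 : |K.jac| * (K.tri.height i * ‖K.edge i‖) = (K.tri.height i * ‖K.edge i‖) ^ 2 := by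
    rw [← h6, ← abs_mul, h5, h6, abs_of_nonneg (by positivity)]; ring
  rcases eq_or_lt_of_le (norm_nonneg (K.edge i)) with h0 | h0
  · exfalso
    have hz : K.edge i = 0 := norm_eq_zero.1 h0.symm
    have : K.tri.points (i + 2) = K.tri.points (i + 1) := by
      simpa [edge, edgeStart, edgeEnd, sub_eq_zero] using hz
    have := K.tri.independent.injective this
    revert this
    fin_cases i <;> decide
  · have : 0 < K.tri.height i * ‖K.edge i‖ := by positivity
    nlinarith

lemma edge_pos (i : Fin 3) : 0 < ‖K.edge i‖ := by
  rw [norm_pos_iff]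
  intro hz
  have : K.tri.points (i + 2) = K.tri.points (i + 1) := by
    simpa [edge, edgeStart, edgeEnd, sub_eq_zero] using hz
  have := K.tri.independent.injective this
  revert this
  fin_cases i <;> decide

lemma abs_jac_pos : 0 < |K.jac| := by
  rw [← height_mul_edge K 0]
  exact mul_pos (K.tri.height_pos 0) (K.edge_pos 0)

lemma jac_ne_zero : K.jac ≠ 0 := abs_pos.1 K.abs_jac_pos

lemma rho_pos : 0 < K.rho := K.tri.inradius_pos

lemma h_pos : 0 < K.h := K.tri.circumradius_pos

lemma rho_le_height (i : Fin 3) : K.rho ≤ K.tri.height i := by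
  have hs : (K.tri.height i)⁻¹ ≤ ∑ j, (K.tri.height j)⁻¹ :=
    Finset.single_le_sum (f := fun j => (K.tri.height j)⁻¹)
      (fun j _ => (inv_pos.2 (K.tri.height_pos j)).le) (Finset.mem_univ i)
  have hp : 0 < (K.tri.height i)⁻¹ := inv_pos.2 (K.tri.height_pos i)
  rw [rho, Affine.Simplex.inradius_eq_abs_inv_sum]
  simp only [Affine.Simplex.excenterWeightsUnnorm_empty_apply]
  rw [abs_of_nonneg (inv_nonneg.2 (hp.le.trans hs))]
  calc _ ≤ ((K.tri.height i)⁻¹)⁻¹ := inv_anti₀ hp hs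
    _ = _ := inv_inv _

lemma rho_mul_edge_le (i : Fin 3) : K.rho * ‖K.edge i‖ ≤ |K.jac| := by
  rw [← height_mul_edge K i]
  exact mul_le_mul_of_nonneg_right (K.rho_le_height i) (norm_nonneg _)

lemma abs_jac_le (i : Fin 3) : |K.jac| ≤ ‖K.edge i‖ * ‖K.edge (i + 2)‖ := by
  have := abs_cross_le (K.edge i) (K.edge (i + 2))
  rwa [cross_edge_edge, abs_neg] at this

lemma rho_le_edge (i : Fin 3) : K.rho ≤ ‖K.edge i‖ := by
  have h1 := K.rho_mul_edge_le (i + 1)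
  have h2 := K.abs_jac_le (i + 1)
  rw [show i + 1 + 2 = i by fin_cases i <;> rfl] at h2
  have := K.edge_pos (i + 1)
  nlinarith

lemma edge_le (i : Fin 3) : ‖K.edge i‖ ≤ 2 * K.h := by
  rw [edge, ← dist_eq_norm]
  refine (dist_triangle _ K.tri.circumcenter _).trans ?_
  rw [dist_comm K.tri.circumcenter]
  simp only [edgeEnd, edgeStart, Affine.Simplex.dist_circumcenter_eq_circumradius]
  rw [h]; linarith

lemma abs_jac_le_h (i : Fin 3) : |K.jac| ≤ ‖K.edge i‖ * (2 * K.h) :=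
  (K.abs_jac_le i).trans (mul_le_mul_of_nonneg_left (K.edge_le _) (norm_nonneg _))

/-! ### Normals -/

/-- The `i`-th edge rotated by a right angle is an outward normal up to the orientation of the
triangle, the same for all edges. -/
lemma edge_mul_normal (i : Fin 3) :
    ‖K.edge i‖ • K.normal i =
      (SignType.sign K.jac : ℝ) • (!₂[K.edge i 1, -K.edge i 0] : Plane) := by
  have hi : inner ℝ (!₂[K.edge i 1, -K.edge i 0] : Plane) (K.edgeStart i - K.tri.points i)
      = K.jac := by
    rw [← cross_edge_side K i, plane_inner]
    simp [cross, side]; ring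
  have he : K.edgeEnd i - K.edgeStart i = K.edge i := rfl
  rw [normal]
  simp only [he, hi]
  rw [smul_comm, smul_smul (‖K.edge i‖), mul_inv_cancel₀ (K.edge_pos i).ne', one_smul]

lemma edge_mul_normal_zero (i : Fin 3) :
    ‖K.edge i‖ * K.normal i 0 = SignType.sign K.jac * K.edge i 1 := by
  have := congrArg (fun v : Plane => v 0) (K.edge_mul_normal i)
  simpa using this

lemma edge_mul_normal_one (i : Fin 3) :
    ‖K.edge i‖ * K.normal i 1 = -(SignType.sign K.jac * K.edge i 0) := by
  have := congrArg (fun v : Plane => v 1) (K.edge_mul_normal i)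
  simpa using this

lemma abs_sign_jac : |(SignType.sign K.jac : ℝ)| = 1 := by
  rcases lt_or_gt_of_ne K.jac_ne_zero with h | h <;> simp [h]

lemma sign_mul_jac : (SignType.sign K.jac : ℝ) * K.jac = |K.jac| := by
  rcases lt_or_gt_of_ne K.jac_ne_zero with h | h <;> simp [h, abs_of_neg, abs_of_pos]

lemma edge_mul_abs_inner_normal (i : Fin 3) (y : Plane) :
    ‖K.edge i‖ * |inner ℝ y (K.normal i)| = |cross y (K.edge i)| := by
  have h : ‖K.edge i‖ * inner ℝ y (K.normal i) = SignType.sign K.jac * cross y (K.edge i) := by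
    rw [plane_inner, cross]
    linear_combination y 0 * K.edge_mul_normal_zero i + y 1 * K.edge_mul_normal_one i
  have h' := congrArg abs h
  rwa [abs_mul, abs_mul, abs_sign_jac, one_mul, abs_of_pos (K.edge_pos i)] at h'

/-- On a shape regular triangle a vector is controlled by its normal components. -/
lemma norm_le_sum_inner_normal {c : ℝ} (hc : K.h / K.rho ≤ c) (y : Plane) :
    ‖y‖ ≤ 4 * c ^ 2 * ∑ i, |inner ℝ y (K.normal i)| := by
  have hρ := K.rho_pos
  have hh := K.h_pos
  have h1 : K.h ≤ c * K.rho := (div_le_iff₀ hρ).1 hc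
  -- Cramer's rule for the basis of two edge vectors
  have h2 : K.jac • y = (-cross y (K.edge 2)) • K.edge 0 + cross y (K.edge 0) • K.edge 2 := by
    have := K.cross_edge_edge 0
    simp only [zero_add] at this
    have h3 : K.jac = -cross (K.edge 0) (K.edge 2) := by rw [this, neg_neg]
    rw [h3]
    ext i
    fin_cases i <;> simp [cross] <;> ring
  have h4 : |K.jac| * ‖y‖ ≤ |cross y (K.edge 2)| * ‖K.edge 0‖ + |cross y (K.edge 0)| * ‖K.edge 2‖ := by
    rw [← Real.norm_eq_abs, ← norm_smul, h2]
    refine (norm_add_le _ _).trans ?_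
    rw [norm_smul, norm_smul, norm_neg]
    simp
  rw [← edge_mul_abs_inner_normal, ← edge_mul_abs_inner_normal] at h4
  set S := ∑ i, |inner ℝ y (K.normal i)| with hS
  have hS' : |inner ℝ y (K.normal 0)| + |inner ℝ y (K.normal 2)| ≤ S := by
    rw [hS, Fin.sum_univ_three]
    linarith [abs_nonneg (inner ℝ y (K.normal 1))]
  have hJ : K.rho * K.rho ≤ |K.jac| :=
    (mul_le_mul_of_nonneg_left (K.rho_le_edge 0) hρ.le).trans (K.rho_mul_edge_le 0)
  have h0 := K.edge_le 0
  have h2' := K.edge_le 2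
  have hprod : ‖K.edge 0‖ * ‖K.edge 2‖ ≤ (2 * K.h) * (2 * K.h) := by gcongr
  have h5 : K.rho * K.rho * ‖y‖ ≤ (2 * K.h) * (2 * K.h) * S := by
    calc K.rho * K.rho * ‖y‖ ≤ |K.jac| * ‖y‖ := by gcongr
      _ ≤ _ := h4
      _ = ‖K.edge 0‖ * ‖K.edge 2‖ * (|inner ℝ y (K.normal 0)| + |inner ℝ y (K.normal 2)|) := by ring
      _ ≤ _ := by gcongr
  have hS0 : 0 ≤ S := Finset.sum_nonneg fun _ _ => abs_nonneg _
  have h6 : (2 * K.h) * (2 * K.h) * S ≤ (2 * (c * K.rho)) * (2 * (c * K.rho)) * S := by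
    have : 0 ≤ 2 * (c * K.rho) := by linarith
    gcongr
  have h7 : K.rho * K.rho * ‖y‖ ≤ K.rho * K.rho * (4 * c ^ 2 * S) := by linarith
  exact le_of_mul_le_mul_left h7 (by positivity)

lemma edge_le_mul_edge {c : ℝ} (hc : K.h / K.rho ≤ c) (i j : Fin 3) :
    ‖K.edge i‖ ≤ 2 * c * ‖K.edge j‖ := by
  have hρ := K.rho_pos
  have h1 : K.h ≤ c * K.rho := (div_le_iff₀ hρ).1 hc
  have hc0 : 0 < c := (div_pos K.h_pos hρ).trans_le hc
  calc ‖K.edge i‖ ≤ 2 * K.h := K.edge_le i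
    _ ≤ 2 * (c * ‖K.edge j‖) := by
      have := mul_le_mul_of_nonneg_left (K.rho_le_edge j) hc0.le
      linarith
    _ = _ := by ring

end Prism

/-! ### The reference triangle -/

/-- The open reference triangle. -/
def refTri : Set (ℝ × ℝ) := {y | 0 < y.1 ∧ 0 < y.2 ∧ y.1 + y.2 < 1}

/-- The closed reference triangle. -/
def refTriClosed : Set (ℝ × ℝ) := {y | 0 ≤ y.1 ∧ 0 ≤ y.2 ∧ y.1 + y.2 ≤ 1}

lemma isOpen_refTri : IsOpen refTri :=
  (isOpen_lt continuous_const continuous_fst).inter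
    ((isOpen_lt continuous_const continuous_snd).inter
      (isOpen_lt (continuous_fst.add continuous_snd) continuous_const))

lemma refTri_nonempty : refTri.Nonempty := ⟨(1 / 4, 1 / 4), by norm_num [refTri]⟩

lemma interior_refTriClosed : interior refTriClosed = refTri := by
  refine Set.Subset.antisymm ?_ (interior_maximal
    (fun y hy => ⟨hy.1.le, hy.2.1.le, hy.2.2.le⟩) isOpen_refTri)
  intro y hy
  have hmem : ∀ v : ℝ × ℝ, ∀ᶠ e : ℝ in 𝓝[>] 0, y + e • v ∈ refTriClosed := by
    intro v
    have hc : Tendsto (fun e : ℝ => y + e • v) (𝓝 0) (𝓝 y) := by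
      have : Continuous fun e : ℝ => y + e • v := by fun_prop
      simpa using this.tendsto 0
    exact ((hc.mono_left nhdsWithin_le_nhds).eventually (mem_interior_iff_mem_nhds.1 hy))
  obtain ⟨e, h1, h2, h3⟩ := ((hmem (-1, -1)).and
    ((hmem (1, 1)).and self_mem_nhdsWithin)).exists
  have h3 : 0 < e := h3
  obtain ⟨a1, a2, a3⟩ := h1
  obtain ⟨b1, b2, b3⟩ := h2
  simp at a1 a2 a3 b1 b2 b3
  exact ⟨by linarith, by linarith, by linarith⟩

lemma refTri_subset : refTri ⊆ Set.Icc 0 1 := by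
  rintro ⟨a, b⟩ ⟨h1, h2, h3⟩
  simp only at h1 h2 h3
  exact ⟨⟨h1.le, h2.le⟩, ⟨by simp; linarith, by simp; linarith⟩⟩

instance : IsFiniteMeasure (volume.restrict refTri) :=
  ⟨by
    rw [Measure.restrict_apply_univ]
    exact (measure_mono refTri_subset).trans_lt isCompact_Icc.measure_lt_top⟩

/-! ### The map from the reference prism -/

namespace Prism

variable (K : Prism)

/-- The affine map from the reference triangle to the spatial triangle that sends the edge `r = 0`
to the `i`-th edge. -/
noncomputable def refMap (i : Fin 3) : ℝ × ℝ ≃ₜ Plane where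
  toFun y := K.edgeStart i + (y.1 • K.edge i + y.2 • K.side i)
  invFun x := (cross (x - K.edgeStart i) (K.side i) / K.jac,
    cross (K.edge i) (x - K.edgeStart i) / K.jac)
  left_inv y := by
    have hJ := K.jac_ne_zero
    have h := K.cross_edge_side i
    simp only [cross] at h
    ext
    · simp only [add_sub_cancel_left, cross]
      rw [div_eq_iff hJ, ← h]
      simp; ring
    · simp only [add_sub_cancel_left, cross]
      rw [div_eq_iff hJ, ← h]
      simp; ring
  right_inv x := by
    have hJ := K.jac_ne_zero
    have h := K.cross_edge_side i
    have : K.jac • ((cross (x - K.edgeStart i) (K.side i) / K.jac) • K.edge i +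
        (cross (K.edge i) (x - K.edgeStart i) / K.jac) • K.side i) =
        K.jac • (x - K.edgeStart i) := by
      rw [smul_add, smul_smul, smul_smul, mul_div_cancel₀ _ hJ, mul_div_cancel₀ _ hJ, ← h]
      ext j
      fin_cases j <;> simp [cross] <;> ring
    have h' := smul_right_injective _ hJ this
    change K.edgeStart i + _ = x
    exact (congrArg (K.edgeStart i + ·) h').trans (by simp)
  continuous_toFun := by fun_prop
  continuous_invFun := by
    unfold cross
    fun_prop

lemma refMap_apply (i : Fin 3) (y : ℝ × ℝ) :
    K.refMap i y = K.edgeStart i + (y.1 • K.edge i + y.2 • K.side i) := rfl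

lemma refMap_symm_apply (i : Fin 3) (x : Plane) :
    (K.refMap i).symm x = (cross (x - K.edgeStart i) (K.side i) / K.jac,
      cross (K.edge i) (x - K.edgeStart i) / K.jac) := rfl

lemma refMap_preimage_triangle (i : Fin 3) : K.refMap i ⁻¹' K.triangle = refTriClosed := by
  have hpts : Set.range K.tri.points =
      {K.edgeStart i, K.edgeEnd i, K.tri.points i} := by
    ext x
    simp only [Set.mem_range, Set.mem_insert_iff, Set.mem_singleton_iff, edgeStart, edgeEnd]
    constructor
    · rintro ⟨j, rfl⟩
      fin_cases i <;> fin_cases j <;> simp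
    · rintro (rfl | rfl | rfl) <;> exact ⟨_, rfl⟩
  apply Set.Subset.antisymm
  · -- the image of the closed reference triangle is convex and contains the vertices
    have hconv : Convex ℝ {x | (K.refMap i).symm x ∈ refTriClosed} := by
      intro x hx z hz a b ha hb hab
      have hlin : (K.refMap i).symm (a • x + b • z) =
          a • (K.refMap i).symm x + b • (K.refMap i).symm z := by
        apply (K.refMap i).injective
        rw [Homeomorph.apply_symm_apply, refMap_apply]
        have h1 := (K.refMap i).apply_symm_apply x
        have h2 := (K.refMap i).apply_symm_apply z
        rw [refMap_apply] at h1 h2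
        conv_lhs => rw [← h1, ← h2]
        have hE : K.edgeStart i = (a + b) • K.edgeStart i := by rw [hab, one_smul]
        conv_rhs => rw [hE]
        simp only [Prod.fst_add, Prod.snd_add, Prod.smul_fst, Prod.smul_snd, smul_eq_mul]
        module
      obtain ⟨x1, x2, x3⟩ := hx
      obtain ⟨z1, z2, z3⟩ := hz
      change _ ∈ refTriClosed
      rw [hlin]
      refine ⟨?_, ?_, ?_⟩
      · simp only [Prod.fst_add, Prod.smul_fst, smul_eq_mul]; positivity
      · simp only [Prod.snd_add, Prod.smul_snd, smul_eq_mul]; positivity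
      · simp only [Prod.fst_add, Prod.snd_add, Prod.smul_fst, Prod.smul_snd, smul_eq_mul]
        nlinarith
    have hsub : K.triangle ⊆ {x | (K.refMap i).symm x ∈ refTriClosed} := by
      refine convexHull_min ?_ hconv
      rw [hpts]
      have e1 : (K.refMap i).symm (K.edgeStart i) = (0, 0) := by
        rw [Homeomorph.symm_apply_eq, refMap_apply]; simp
      have e2 : (K.refMap i).symm (K.edgeEnd i) = (1, 0) := by
        rw [Homeomorph.symm_apply_eq, refMap_apply]; simp [edge]
      have e3 : (K.refMap i).symm (K.tri.points i) = (0, 1) := by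
        rw [Homeomorph.symm_apply_eq, refMap_apply]; simp [side]
      rintro x (rfl | rfl | rfl)
      · change _ ∈ refTriClosed; rw [e1]; norm_num [refTriClosed]
      · change _ ∈ refTriClosed; rw [e2]; norm_num [refTriClosed]
      · change _ ∈ refTriClosed; rw [e3]; norm_num [refTriClosed]
    intro y hy
    simpa using hsub hy
  · rintro y ⟨h1, h2, h3⟩
    change K.refMap i y ∈ convexHull ℝ (Set.range K.tri.points)
    have hc := convex_convexHull ℝ (Set.range K.tri.points)
    have hs := subset_convexHull ℝ (Set.range K.tri.points)
    have := hc.sum_mem (t := Finset.univ) (w := ![1 - y.1 - y.2, y.1, y.2])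
      (z := ![K.edgeStart i, K.edgeEnd i, K.tri.points i])
      (by intro j _; fin_cases j <;> simp <;> linarith)
      (by simp [Fin.sum_univ_three]; ring)
      (by intro j _; fin_cases j <;> exact hs ⟨_, rfl⟩)
    convert! this using 1
    simp only [refMap_apply, Fin.sum_univ_three, edge, side, Matrix.cons_val]
    module

lemma refMap_preimage_interior (i : Fin 3) : K.refMap i ⁻¹' interior K.triangle = refTri := by
  rw [Homeomorph.preimage_interior, refMap_preimage_triangle, interior_refTriClosed]

lemma map_refMap_volume (i : Fin 3) :
    Measure.map (K.refMap i) volume = ENNReal.ofReal |K.jac⁻¹| • (volume : Measure Plane) := by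
  let M : Matrix (Fin 2) (Fin 2) ℝ := !![K.edge i 0, K.side i 0; K.edge i 1, K.side i 1]
  have hdet : M.det = K.jac := by
    rw [← K.cross_edge_side i, Matrix.det_fin_two_of, cross]; ring
  have h1 : Measure.map (MeasurableEquiv.finTwoArrow (α := ℝ)).symm volume = volume :=
    ((volume_preserving_finTwoArrow ℝ).symm _).map_eq
  have h2 : Measure.map (Matrix.toLin' M) volume = ENNReal.ofReal |K.jac⁻¹| • volume := by
    rw [← hdet]
    exact Real.map_matrix_volume_pi_eq_smul_volume_pi (by rw [hdet]; exact K.jac_ne_zero)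
  have h3 : Measure.map (WithLp.toLp 2 : (Fin 2 → ℝ) → Plane) volume = volume :=
    (PiLp.volume_preserving_toLp (Fin 2)).map_eq
  have h4 : Measure.map (fun x => x + K.edgeStart i) (volume : Measure Plane) = volume :=
    map_add_right_eq_self _ _
  have hfun : (K.refMap i : ℝ × ℝ → Plane) = (fun x => x + K.edgeStart i) ∘
      ((WithLp.toLp 2 : (Fin 2 → ℝ) → Plane) ∘ ((Matrix.toLin' M) ∘
        (MeasurableEquiv.finTwoArrow (α := ℝ)).symm)) := by
    funext y
    ext j
    fin_cases j <;>
      simp [refMap_apply, M, MeasurableEquiv.finTwoArrow] <;> ring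
  have m2 : Measurable (Matrix.toLin' M) :=
    (LinearMap.continuous_of_finiteDimensional _).measurable
  have m3 : Measurable (WithLp.toLp 2 : (Fin 2 → ℝ) → Plane) :=
    (PiLp.volume_preserving_toLp (Fin 2)).measurable
  have m1 := (MeasurableEquiv.finTwoArrow (α := ℝ)).symm.measurable
  rw [hfun, ← Measure.map_map (by fun_prop) (m3.comp (m2.comp m1)),
    ← Measure.map_map m3 (m2.comp m1), ← Measure.map_map m2 m1, h1, h2, Measure.map_smul, h3,
    Measure.map_smul, h4]

lemma volume_plane_eq (i : Fin 3) :
    (volume : Measure Plane) = ENNReal.ofReal |K.jac| • Measure.map (K.refMap i) volume := by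
  rw [map_refMap_volume, smul_smul, ← ENNReal.ofReal_mul (abs_nonneg _), abs_inv,
    mul_inv_cancel₀ K.abs_jac_pos.ne', ENNReal.ofReal_one, one_smul]

lemma measurableEmbedding_refMap (i : Fin 3) : MeasurableEmbedding (K.refMap i) :=
  (K.refMap i).measurableEmbedding

lemma volume_interior_eq (i : Fin 3) : volume.restrict (interior K.triangle) =
    ENNReal.ofReal |K.jac| • Measure.map (K.refMap i) (volume.restrict refTri) := by
  rw [K.volume_plane_eq i, Measure.restrict_smul,
    (K.measurableEmbedding_refMap i).restrict_map, refMap_preimage_interior]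

/-- The boundary of the triangle is a null set. -/
lemma restrict_triangle_eq :
    (volume : Measure Plane).restrict K.triangle = volume.restrict (interior K.triangle) := by
  refine (Measure.restrict_congr_set ?_).symm
  have hc : Convex ℝ K.triangle := convex_convexHull ℝ _
  refine interior_ae_eq_of_null_frontier (hc.addHaar_frontier volume)

/-- The map from the reference prism `ℝ × (reference triangle)` to space-time. -/
noncomputable def prismMap (i : Fin 3) : ℝ × (ℝ × ℝ) ≃ₜ SpaceTime :=
  (Homeomorph.refl ℝ).prodCongr (K.refMap i)

lemma prismMap_apply (i : Fin 3) (y : ℝ × (ℝ × ℝ)) : K.prismMap i y = (y.1, K.refMap i y.2) := rfl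

lemma faceParam_eq (i : Fin 3) (y : ℝ × ℝ) :
    K.faceParam i y = K.prismMap i (y.1, (y.2, 0)) := by
  rw [prismMap_apply, refMap_apply, faceParam, AffineMap.lineMap_apply]
  simp [edge, add_comm]

lemma continuous_faceParam (i : Fin 3) : Continuous (K.faceParam i) := by
  have : K.faceParam i = fun y => K.prismMap i (y.1, (y.2, 0)) := funext (K.faceParam_eq i)
  rw [this]
  exact (K.prismMap i).continuous.comp (by fun_prop)

lemma faceParam_injective (i : Fin 3) : Function.Injective (K.faceParam i) := by
  intro y z h
  rw [faceParam_eq, faceParam_eq] at h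
  have := (K.prismMap i).injective h
  simp only [Prod.mk.injEq] at this
  exact Prod.ext this.1 this.2.1

lemma measurableEmbedding_faceParam (i : Fin 3) : MeasurableEmbedding (K.faceParam i) :=
  (K.continuous_faceParam i).measurableEmbedding (K.faceParam_injective i)

/-! ### Weighted measures -/

/-- The measure `fₙ dμ`. -/
noncomputable def wmeas (a : ℝ) (μ : Measure SpaceTime) : Measure SpaceTime :=
  μ.withDensity fun z => ENNReal.ofReal (K.weight a z.1)

/-- The measure `fₙ dt` on the time interval `Iₙ`. -/
noncomputable def timeMeas (a : ℝ) : Measure ℝ :=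
  (volume.restrict K.interval).withDensity fun t => ENNReal.ofReal (K.weight a t)

lemma continuous_weight (a : ℝ) : Continuous (K.weight a) := by
  unfold weight; fun_prop

lemma measurable_weight (a : ℝ) : Measurable fun t => ENNReal.ofReal (K.weight a t) :=
  (K.continuous_weight a).measurable.ennreal_ofReal

lemma weight_pos (a t : ℝ) : 0 < K.weight a t := Real.exp_pos _

lemma integral_wmeas {E : Type*} [NormedAddCommGroup E] [NormedSpace ℝ E] (a : ℝ)
    (μ : Measure SpaceTime) (g : SpaceTime → E) :
    ∫ z, g z ∂(K.wmeas a μ) = ∫ z, K.weight a z.1 • g z ∂μ := by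
  have hm : Measurable fun z : SpaceTime => ENNReal.ofReal (K.weight a z.1) :=
    (K.measurable_weight a).comp measurable_fst
  rw [wmeas, integral_withDensity_eq_integral_toReal_smul hm
    (ae_of_all _ fun _ => ENNReal.ofReal_lt_top)]
  simp only [ENNReal.toReal_ofReal (K.weight_pos a _).le]

lemma wnorm_eq_l2norm {F : Type*} [NormedAddCommGroup F] (a : ℝ) (μ : Measure SpaceTime)
    (g : SpaceTime → F) : K.wnorm a μ g = l2norm (K.wmeas a μ) g := by
  rw [wnorm, l2norm, integral_wmeas]
  rfl

instance (a : ℝ) : IsFiniteMeasure (K.timeMeas a) := by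
  refine isFiniteMeasure_withDensity ?_
  have h : ∀ t ∈ K.interval, ENNReal.ofReal (K.weight a t) ≤
      ENNReal.ofReal (Real.exp (|a| * K.dt)) := by
    intro t ht
    refine ENNReal.ofReal_le_ofReal (Real.exp_le_exp.2 ?_)
    have h1 : 0 < t - K.t0 := by linarith [ht.1]
    have h2 : t - K.t0 ≤ K.dt := by linarith [ht.2]
    calc -a * (t - K.t0) ≤ |a| * (t - K.t0) := by
          gcongr; exact neg_le_abs a
      _ ≤ _ := by gcongr
  refine ne_of_lt (((setLIntegral_mono measurable_const h)).trans_lt ?_)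
  rw [setLIntegral_const]
  refine ENNReal.mul_lt_top ENNReal.ofReal_lt_top ?_
  simp [interval]

lemma wmeas_vol_eq_prod (a : ℝ) :
    K.wmeas a K.vol = (K.timeMeas a).prod (volume.restrict (interior K.triangle)) := by
  rw [timeMeas, prod_withDensity_left (K.measurable_weight a), Measure.prod_restrict]
  rfl

lemma wmeas_vol (a : ℝ) (i : Fin 3) :
    K.wmeas a K.vol = ENNReal.ofReal |K.jac| •
      Measure.map (K.prismMap i) ((K.timeMeas a).prod (volume.restrict refTri)) := by
  rw [wmeas_vol_eq_prod, K.volume_interior_eq i, Measure.prod_smul_right]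
  congr 1
  have := Measure.map_prod_map (f := id) (g := K.refMap i) (K.timeMeas a)
    (volume.restrict refTri) measurable_id (K.refMap i).measurable
  rw [Measure.map_id] at this
  exact this

lemma wmeas_face (a : ℝ) (i : Fin 3) :
    K.wmeas a (K.faceMeasure i) = ENNReal.ofReal ‖K.edge i‖ •
      Measure.map (K.faceParam i) ((K.timeMeas a).prod (volume.restrict (Set.Ioo 0 1))) := by
  have hd : dist (K.edgeStart i) (K.edgeEnd i) = ‖K.edge i‖ := by
    rw [dist_comm, dist_eq_norm]; rfl
  rw [wmeas, faceMeasure, withDensity_smul_measure, hd, timeMeas,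
    prod_withDensity_left (K.measurable_weight a), Measure.prod_restrict]
  congr 1
  ext s hs
  rw [withDensity_apply _ hs, (K.measurableEmbedding_faceParam i).restrict_map,
    (K.measurableEmbedding_faceParam i).lintegral_map, Measure.map_apply
      (K.continuous_faceParam i).measurable hs, withDensity_apply _
      ((K.continuous_faceParam i).measurable hs)]
  rfl

lemma wmeas_side (a : ℝ) : K.wmeas a K.sideMeasure = ∑ i, K.wmeas a (K.faceMeasure i) := by
  simp only [wmeas, sideMeasure, Fin.sum_univ_three, withDensity_add_measure]

/-- Integrals over the element in reference coordinates. -/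
lemma integral_vol (a : ℝ) (i : Fin 3) (g : SpaceTime → ℝ) :
    ∫ z, g z ∂(K.wmeas a K.vol) = |K.jac| *
      ∫ y, g (K.prismMap i y) ∂((K.timeMeas a).prod (volume.restrict refTri)) := by
  rw [K.wmeas_vol a i, integral_smul_measure,
    (K.prismMap i).measurableEmbedding.integral_map, ENNReal.toReal_ofReal (abs_nonneg _),
    smul_eq_mul]

/-- Integrals over a lateral face in reference coordinates. -/
lemma integral_face (a : ℝ) (i : Fin 3) (g : SpaceTime → ℝ) :
    ∫ z, g z ∂(K.wmeas a (K.faceMeasure i)) = ‖K.edge i‖ *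
      ∫ y, g (K.faceParam i y) ∂((K.timeMeas a).prod (volume.restrict (Set.Ioo 0 1))) := by
  rw [K.wmeas_face a i, integral_smul_measure,
    (K.measurableEmbedding_faceParam i).integral_map, ENNReal.toReal_ofReal (norm_nonneg _),
    smul_eq_mul]

end Prism

/-! ### Inequalities on the reference triangle -/

/-- The length measure on the edge `r = 0` of the reference triangle. -/
noncomputable def refEdge : Measure (ℝ × ℝ) :=
  (volume.restrict (Set.Ioo (0 : ℝ) 1)).map fun s => (s, 0)

lemma measurableEmbedding_refEdge : MeasurableEmbedding fun s : ℝ => (s, (0 : ℝ)) :=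
  (by fun_prop : Continuous fun s : ℝ => (s, (0 : ℝ))).measurableEmbedding fun s t h => by
    simpa using h

instance : IsFiniteMeasure refEdge := by
  unfold refEdge; infer_instance

lemma memLp_refTri {u : ℝ × ℝ → ℝ} (hu : Continuous u) : MemLp u 2 (volume.restrict refTri) :=
  memLp_of_continuous (isCompact_Icc (a := (0 : ℝ × ℝ)) (b := 1))
    ((ae_restrict_mem isOpen_refTri.measurableSet).mono fun _ h => refTri_subset h) hu

lemma memLp_refEdge {u : ℝ × ℝ → ℝ} (hu : Continuous u) : MemLp u 2 refEdge := by
  refine memLp_of_continuous (isCompact_Icc (a := (0 : ℝ × ℝ)) (b := 1)) ?_ hu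
  rw [refEdge, measurableEmbedding_refEdge.ae_map_iff]
  filter_upwards [ae_restrict_mem measurableSet_Ioo] with s hs
  exact ⟨⟨hs.1.le, le_rfl⟩, ⟨hs.2.le, zero_le_one⟩⟩

lemma sq_l2norm_refEdge (u : ℝ × ℝ → ℝ) :
    l2norm refEdge u ^ 2 = ∫ s in Set.Ioo (0 : ℝ) 1, u (s, 0) ^ 2 := by
  rw [sq_l2norm_real, refEdge, measurableEmbedding_refEdge.integral_map]

lemma continuous_planePoly {r : ℕ} {u : ℝ × ℝ → ℝ} (hu : u ∈ planePoly r) : Continuous u :=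
  (analyticOnNhd_planePoly hu).continuous_of_univ

/-- A polynomial of degree `r` that is orthogonal to all polynomials of lower degree and vanishes
on an edge is zero: it is a multiple of the linear function that vanishes on the edge, and is
orthogonal to the other factor. -/
lemma planePoly_eq_zero {r : ℕ} {u : ℝ × ℝ → ℝ} (hu : u ∈ planePoly (r + 1))
    (horth : ∀ v ∈ planePoly r, ∫ y in refTri, u y * v y = 0) (h0 : l2norm refEdge u = 0) :
    u = 0 := by
  obtain ⟨g, hg, h, hh, e⟩ := planePoly_decomp hu
  have hgc : Continuous g := (analyticOnNhd_linePoly hg).continuous_of_univ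
  have hg0 : g = 0 := by
    have h1 : l2norm (volume.restrict (Set.Ioo (0 : ℝ) 1)) g = 0 := by
      rw [← sq_eq_zero_iff, sq_l2norm_refEdge] at h0
      rw [← sq_eq_zero_iff, sq_l2norm_real]
      simpa [e] using h0
    refine (analyticOnNhd_linePoly hg).eq_zero_of_eqOn isOpen_Ioo
      (Set.nonempty_Ioo.2 one_pos) (eqOn_zero_of_l2norm_eq_zero (μ := volume) isOpen_Ioo
        Measure.AbsolutelyContinuous.rfl hgc ?_ h1)
    exact memLp_of_continuous (isCompact_Icc (a := (0 : ℝ)) (b := 1))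
      ((ae_restrict_mem measurableSet_Ioo).mono fun _ h => Set.Ioo_subset_Icc_self h) hgc
  have hhc := continuous_planePoly hh
  -- `u = y₂ h`, and `h` is an admissible test function
  have h1 : ∫ y in refTri, y.2 * h y ^ 2 = 0 := by
    rw [← horth h hh]
    refine integral_congr_ae (ae_of_all _ fun y => ?_)
    simp [e, hg0]; ring
  have hpos : 0 ≤ᵐ[volume.restrict refTri] fun y => y.2 * h y ^ 2 := by
    filter_upwards [ae_restrict_mem isOpen_refTri.measurableSet] with y hy
    exact mul_nonneg hy.2.1.le (sq_nonneg _)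
  rw [integral_eq_zero_iff_of_nonneg_ae hpos] at h1
  · have h2 : Set.EqOn (fun y : ℝ × ℝ => y.2 * h y ^ 2) 0 refTri :=
      Measure.eqOn_open_of_ae_eq h1 isOpen_refTri (by fun_prop) continuousOn_const
    have h3 : h = 0 := by
      refine (analyticOnNhd_planePoly hh).eq_zero_of_eqOn isOpen_refTri refTri_nonempty
        fun y hy => ?_
      have := h2 hy
      simpa [hy.2.1.ne'] using this
    funext y
    simp [e, hg0, h3]
  · exact (memLp_refTri (by fun_prop : Continuous fun y : ℝ × ℝ => y.2 * h y ^ 2)).integrable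
      (by norm_num)

/-- The polynomials of degree `r` orthogonal to those of lower degree are controlled by their
values on an edge. -/
lemma exists_l2norm_refTri_le (r : ℕ) : ∃ C : ℝ, 0 < C ∧ ∀ u ∈ planePoly (r + 1),
    (∀ v ∈ planePoly r, ∫ y in refTri, u y * v y = 0) →
      l2norm (volume.restrict refTri) u ≤ C * l2norm refEdge u := by
  let B : Submodule ℝ (ℝ × ℝ → ℝ) :=
    { carrier := {u | u ∈ planePoly (r + 1) ∧ ∀ v ∈ planePoly r, ∫ y in refTri, u y * v y = 0}
      add_mem' := by
        rintro f g ⟨hf, hf'⟩ ⟨hg, hg'⟩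
        refine ⟨add_mem hf hg, fun v hv => ?_⟩
        have i1 := integrable_mul_of_memLp (memLp_refTri (continuous_planePoly hf))
          (memLp_refTri (continuous_planePoly hv))
        have i2 := integrable_mul_of_memLp (memLp_refTri (continuous_planePoly hg))
          (memLp_refTri (continuous_planePoly hv))
        simp only [Pi.add_apply, add_mul]
        rw [integral_add i1 i2, hf' v hv, hg' v hv, add_zero]
      zero_mem' := ⟨zero_mem _, fun v _ => by simp⟩
      smul_mem' := by
        rintro c f ⟨hf, hf'⟩
        refine ⟨Submodule.smul_mem _ _ hf, fun v hv => ?_⟩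
        simp only [Pi.smul_apply, smul_eq_mul, mul_assoc]
        rw [integral_const_mul, hf' v hv, mul_zero] }
  have hB : B ≤ planePoly (r + 1) := fun u hu => hu.1
  have : FiniteDimensional ℝ B := Submodule.finiteDimensional_of_le hB
  obtain ⟨C, hC, hb⟩ := exists_l2norm_le_of_eq_zero (μ := volume.restrict refTri) (ν := refEdge) B
    (fun u hu => memLp_refTri (continuous_planePoly (hB hu)))
    (fun u hu => memLp_refEdge (continuous_planePoly (hB hu)))
    (fun u hu h0 => by
      rw [planePoly_eq_zero hu.1 hu.2 h0]
      simp [l2norm])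
  exact ⟨C, hC, fun u hu ho => hb u ⟨hu, ho⟩⟩

/-- The discrete trace inequality on the reference triangle. -/
lemma exists_l2norm_refEdge_le (r : ℕ) : ∃ C : ℝ, 0 < C ∧ ∀ u ∈ planePoly r,
    l2norm refEdge u ≤ C * l2norm (volume.restrict refTri) u :=
  exists_l2norm_le_of_eq_zero (planePoly r)
    (fun u hu => memLp_refEdge (continuous_planePoly hu))
    (fun u hu => memLp_refTri (continuous_planePoly hu)) (fun u hu h0 => by
      have : u = 0 := (analyticOnNhd_planePoly hu).eq_zero_of_eqOn isOpen_refTri refTri_nonempty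
        (eqOn_zero_of_l2norm_eq_zero (μ := volume) isOpen_refTri Measure.AbsolutelyContinuous.rfl
          (continuous_planePoly hu) (memLp_refTri (continuous_planePoly hu)) h0)
      rw [this]
      simp [l2norm])

/-- The values of a univariate polynomial at the end points of the unit interval are bounded by
its `L²` norm. -/
lemma exists_endpoints_le (m : ℕ) : ∃ C : ℝ, 0 < C ∧ ∀ u ∈ linePoly m,
    u 0 ^ 2 + u 1 ^ 2 ≤ C * ∫ s in Set.Ioo (0 : ℝ) 1, u s ^ 2 := by
  have hm : ∀ u ∈ linePoly m, MemLp u 2 (volume.restrict (Set.Ioo (0 : ℝ) 1)) := fun u hu =>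
    memLp_of_continuous (isCompact_Icc (a := (0 : ℝ)) (b := 1))
      ((ae_restrict_mem measurableSet_Ioo).mono fun _ h => Set.Ioo_subset_Icc_self h)
      (analyticOnNhd_linePoly hu).continuous_of_univ
  have hm' : ∀ u ∈ linePoly m, MemLp u 2 (Measure.dirac (0 : ℝ) + Measure.dirac 1) := fun u hu => by
    refine memLp_of_continuous (isCompact_Icc (a := (0 : ℝ)) (b := 1)) ?_
      (analyticOnNhd_linePoly hu).continuous_of_univ
    rw [ae_add_measure_iff, ae_dirac_eq, ae_dirac_eq]
    simp
  obtain ⟨C, hC, h⟩ := exists_l2norm_le_of_eq_zero (linePoly m) hm' hm (fun u hu h0 => by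
      have : u = 0 := (analyticOnNhd_linePoly hu).eq_zero_of_eqOn isOpen_Ioo
        (Set.nonempty_Ioo.2 one_pos)
        (eqOn_zero_of_l2norm_eq_zero (μ := volume) isOpen_Ioo Measure.AbsolutelyContinuous.rfl
          (analyticOnNhd_linePoly hu).continuous_of_univ (hm u hu) h0)
      rw [this]
      simp [l2norm])
  refine ⟨C ^ 2, by positivity, fun u hu => ?_⟩
  have h1 := pow_le_pow_left₀ (l2norm_nonneg _) (h u hu) 2
  rw [mul_pow, sq_l2norm_real, sq_l2norm_real, integral_add_measure, integral_dirac,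
    integral_dirac] at h1
  · exact h1
  · exact integrable_dirac (by simp)
  · exact integrable_dirac (by simp)

/-! ### Inequalities on the reference prism -/

section RefPrism

variable {θ : Measure ℝ} [IsFiniteMeasure θ] {S : Set ℝ}

lemma memLp_prod {Y : Type*} [TopologicalSpace Y] [MeasurableSpace Y] [OpensMeasurableSpace Y]
    [OpensMeasurableSpace (ℝ × Y)]
    {ν : Measure Y} [IsFiniteMeasure ν] {R : Set Y} (hS : IsCompact S) (hθ : ∀ᵐ t ∂θ, t ∈ S)
    (hR : IsCompact R) (hν : ∀ᵐ y ∂ν, y ∈ R) {g : ℝ × Y → ℝ} (hg : Continuous g) :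
    MemLp g 2 (θ.prod ν) := by
  refine memLp_of_continuous (hS.prod hR) ?_ hg
  have h1 : ∀ᵐ z ∂(θ.prod ν), z.1 ∈ S := Measure.quasiMeasurePreserving_fst.ae hθ
  have h2 : ∀ᵐ z ∂(θ.prod ν), z.2 ∈ R := Measure.quasiMeasurePreserving_snd.ae hν
  filter_upwards [h1, h2] with z hz hz'
  exact ⟨hz, hz'⟩

lemma ae_refTri_mem : ∀ᵐ y ∂(volume.restrict refTri), y ∈ Set.Icc (0 : ℝ × ℝ) 1 :=
  (ae_restrict_mem isOpen_refTri.measurableSet).mono fun _ h => refTri_subset h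

lemma ae_refIoo_mem : ∀ᵐ y ∂(volume.restrict (Set.Ioo (0 : ℝ) 1)), y ∈ Set.Icc (0 : ℝ) 1 :=
  (ae_restrict_mem measurableSet_Ioo).mono fun _ h => Set.Ioo_subset_Icc_self h

lemma continuous_refPoly {r m : ℕ} {w : ℝ × (ℝ × ℝ) → ℝ} (hw : w ∈ refPoly r m) : Continuous w :=
  (analyticOnNhd_refPoly hw).continuous_of_univ

/-- The moments of a tensor product polynomial in space are polynomials in time. -/
lemma moment_mem_linePoly {r m : ℕ} {w : ℝ × (ℝ × ℝ) → ℝ} (hw : w ∈ refPoly r m) {v : ℝ × ℝ → ℝ}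
    (hv : Continuous v) : (fun t => ∫ y in refTri, w (t, y) * v y) ∈ linePoly m := by
  suffices Continuous w ∧ (fun t => ∫ y in refTri, w (t, y) * v y) ∈ linePoly m from this.2
  have hint : ∀ {f : ℝ × (ℝ × ℝ) → ℝ}, Continuous f → ∀ t,
      Integrable (fun y => f (t, y) * v y) (volume.restrict refTri) := fun hf t =>
    integrable_mul_of_memLp (memLp_refTri (by fun_prop)) (memLp_refTri hv)
  refine monoSpan_induction (P := fun w => Continuous w ∧
    (fun t => ∫ y in refTri, w (t, y) * v y) ∈ linePoly m) ?_ ?_ ?_ ?_ hw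
  · intro i j k _ hk
    refine ⟨by fun_prop, ?_⟩
    convert! Submodule.smul_mem _ (∫ y in refTri, y.1 ^ i * y.2 ^ j * v y)
      (pow_mem_linePoly hk) using 1
    funext t
    simp only [mul_assoc, Pi.smul_apply, smul_eq_mul]
    rw [integral_const_mul, mul_comm]
  · refine ⟨continuous_zero, ?_⟩
    convert! Submodule.zero_mem (linePoly m) using 1
    funext t; simp
  · rintro f g ⟨hf, hf'⟩ ⟨hg, hg'⟩
    refine ⟨hf.add hg, ?_⟩
    convert! add_mem hf' hg' using 1
    funext t
    simp only [Pi.add_apply, add_mul]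
    rw [integral_add (hint hf t) (hint hg t)]
  · rintro c f ⟨hf, hf'⟩
    refine ⟨hf.const_smul c, ?_⟩
    convert! Submodule.smul_mem _ c hf' using 1
    funext t
    simp only [Pi.smul_apply, smul_eq_mul, mul_assoc]
    rw [integral_const_mul]

/-- Orthogonality to a tensor product space holds on every time slice: the moment against a spatial
polynomial is a polynomial in time, and may be used as the factor in time of a test function. -/
lemma slice_orthogonal (hS : IsCompact S) (hθ : ∀ᵐ t ∂θ, t ∈ S) {U : Set ℝ} (hU : IsOpen U)
    (hne : U.Nonempty) (hac : volume.restrict U ≪ θ) {r r' m : ℕ} {w : ℝ × (ℝ × ℝ) → ℝ}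
    (hw : w ∈ refPoly r m)
    (h : ∀ z ∈ refPoly r' m, ∫ y, w y * z y ∂(θ.prod (volume.restrict refTri)) = 0)
    {v : ℝ × ℝ → ℝ} (hv : v ∈ planePoly r') (t : ℝ) : ∫ y in refTri, w (t, y) * v y = 0 := by
  have hχ := moment_mem_linePoly hw (continuous_planePoly hv)
  set χ : ℝ → ℝ := fun t => ∫ y in refTri, w (t, y) * v y with hχd
  have hχc : Continuous χ := (analyticOnNhd_linePoly hχ).continuous_of_univ
  -- testing with `χ(t) v(y)` shows that `χ` vanishes in `L²(θ)`
  have hz := mul_mem_refPoly hχ hv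
  have hzc := continuous_refPoly hz
  have h1 := h _ hz
  rw [integral_prod] at h1
  · have h2 : ∫ t, χ t ^ 2 ∂θ = 0 := by
      rw [← h1]
      congr 1
      funext t
      rw [sq]
      conv_lhs => rw [hχd]
      simp only
      rw [← integral_mul_const]
      congr 1
      funext y
      ring
    have hL : MemLp χ 2 θ := memLp_of_continuous hS hθ hχc
    have h3 : l2norm θ χ = 0 := by rw [← sq_eq_zero_iff, sq_l2norm_real, h2]
    have := (analyticOnNhd_linePoly hχ).eq_zero_of_eqOn hU hne
      (eqOn_zero_of_l2norm_eq_zero hU hac hχc hL h3)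
    exact congrFun this t
  · exact integrable_mul_of_memLp
      (memLp_prod hS hθ isCompact_Icc ae_refTri_mem (continuous_refPoly hw))
      (memLp_prod hS hθ isCompact_Icc ae_refTri_mem hzc)

lemma sq_l2norm_refPrism (hS : IsCompact S) (hθ : ∀ᵐ t ∂θ, t ∈ S) {w : ℝ × (ℝ × ℝ) → ℝ}
    (hw : Continuous w) : l2norm (θ.prod (volume.restrict refTri)) w ^ 2 =
      ∫ t, l2norm (volume.restrict refTri) (fun y => w (t, y)) ^ 2 ∂θ := by
  rw [sq_l2norm_real, integral_prod]
  · simp only [sq_l2norm_real]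
  · exact (memLp_prod hS hθ isCompact_Icc ae_refTri_mem hw).integrable_sq

lemma sq_l2norm_refFace (hS : IsCompact S) (hθ : ∀ᵐ t ∂θ, t ∈ S) {w : ℝ × (ℝ × ℝ) → ℝ}
    (hw : Continuous w) :
    l2norm (θ.prod (volume.restrict (Set.Ioo 0 1))) (fun y => w (y.1, (y.2, 0))) ^ 2 =
      ∫ t, l2norm refEdge (fun y => w (t, y)) ^ 2 ∂θ := by
  rw [sq_l2norm_real, integral_prod]
  · simp only [sq_l2norm_refEdge]
  · exact (memLp_prod hS hθ isCompact_Icc ae_refIoo_mem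
      (g := fun y : ℝ × ℝ => w (y.1, (y.2, 0))) (by fun_prop)).integrable_sq

lemma integrable_sq_l2norm_refTri (hS : IsCompact S) (hθ : ∀ᵐ t ∂θ, t ∈ S)
    {w : ℝ × (ℝ × ℝ) → ℝ} (hw : Continuous w) :
    Integrable (fun t => l2norm (volume.restrict refTri) (fun y => w (t, y)) ^ 2) θ := by
  have := (memLp_prod hS hθ isCompact_Icc ae_refTri_mem hw).integrable_sq.integral_prod_left
  simpa only [sq_l2norm_real] using this

lemma integrable_sq_l2norm_refEdge (hS : IsCompact S) (hθ : ∀ᵐ t ∂θ, t ∈ S)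
    {w : ℝ × (ℝ × ℝ) → ℝ} (hw : Continuous w) :
    Integrable (fun t => l2norm refEdge (fun y => w (t, y)) ^ 2) θ := by
  have := (memLp_prod hS hθ isCompact_Icc ae_refIoo_mem
    (g := fun y : ℝ × ℝ => w (y.1, (y.2, 0))) (by fun_prop)).integrable_sq.integral_prod_left
  simpa only [sq_l2norm_refEdge] using this

/-- Inequalities between the norms on time slices integrate to the prism. -/
lemma sq_l2norm_refPrism_le (hS : IsCompact S) (hθ : ∀ᵐ t ∂θ, t ∈ S) {w : ℝ × (ℝ × ℝ) → ℝ}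
    (hw : Continuous w) {C : ℝ} (h : ∀ t, l2norm (volume.restrict refTri) (fun y => w (t, y)) ≤
      C * l2norm refEdge (fun y => w (t, y))) :
    l2norm (θ.prod (volume.restrict refTri)) w ^ 2 ≤
      C ^ 2 * l2norm (θ.prod (volume.restrict (Set.Ioo 0 1))) (fun y => w (y.1, (y.2, 0))) ^ 2 := by
  rw [sq_l2norm_refPrism hS hθ hw, sq_l2norm_refFace hS hθ hw, ← integral_const_mul]
  refine integral_mono (integrable_sq_l2norm_refTri hS hθ hw)
    ((integrable_sq_l2norm_refEdge hS hθ hw).const_mul _) fun t => ?_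
  simp only
  rw [← mul_pow]
  exact pow_le_pow_left₀ (l2norm_nonneg _) (h t) 2

lemma sq_l2norm_refFace_le (hS : IsCompact S) (hθ : ∀ᵐ t ∂θ, t ∈ S) {w : ℝ × (ℝ × ℝ) → ℝ}
    (hw : Continuous w) {C : ℝ} (h : ∀ t, l2norm refEdge (fun y => w (t, y)) ≤
      C * l2norm (volume.restrict refTri) (fun y => w (t, y))) :
    l2norm (θ.prod (volume.restrict (Set.Ioo 0 1))) (fun y => w (y.1, (y.2, 0))) ^ 2 ≤
      C ^ 2 * l2norm (θ.prod (volume.restrict refTri)) w ^ 2 := by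
  rw [sq_l2norm_refPrism hS hθ hw, sq_l2norm_refFace hS hθ hw, ← integral_const_mul]
  refine integral_mono (integrable_sq_l2norm_refEdge hS hθ hw)
    ((integrable_sq_l2norm_refTri hS hθ hw).const_mul _) fun t => ?_
  simp only
  rw [← mul_pow]
  exact pow_le_pow_left₀ (l2norm_nonneg _) (h t) 2

end RefPrism

namespace Prism

variable (K : Prism) {p r m : ℕ} {a : ℝ}

/-! ### Polynomials on the element in reference coordinates -/

lemma comp_prismMap_mem {w : SpaceTime → ℝ} (hw : w ∈ tensorPoly r m) (i : Fin 3) :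
    (fun y => w (K.prismMap i y)) ∈ refPoly r m := by
  have h := comp_mem_monoSpan (tensorPoly_eq_monoSpan r m ▸ hw) (K.prismMap i)
  refine monoSpan_affine_le (a := K.edgeStart i 0) (b := K.edge i 0) (c := K.side i 0)
    (a' := K.edgeStart i 1) (b' := K.edge i 1) (c' := K.side i 1) ?_ ?_ h
  · intro z; simp [prismMap_apply, refMap_apply]; ring
  · intro z; simp [prismMap_apply, refMap_apply]; ring

lemma comp_prismMap_symm_mem {w : ℝ × (ℝ × ℝ) → ℝ} (hw : w ∈ refPoly r m) (i : Fin 3) :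
    (fun z => w ((K.prismMap i).symm z)) ∈ tensorPoly r m := by
  have h := comp_mem_monoSpan hw (K.prismMap i).symm
  have e : ∀ z : SpaceTime, (K.prismMap i).symm z = (z.1, (K.refMap i).symm z.2) := fun z => rfl
  refine monoSpan_affine_le
    (a := -cross (K.edgeStart i) (K.side i) / K.jac) (b := K.side i 1 / K.jac)
    (c := -K.side i 0 / K.jac) (a' := -cross (K.edge i) (K.edgeStart i) / K.jac)
    (b' := -K.edge i 1 / K.jac) (c' := K.edge i 0 / K.jac) ?_ ?_ h
  · intro z; simp [e, refMap_symm_apply, cross]; ring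
  · intro z; simp [e, refMap_symm_apply, cross]; ring

lemma comp_faceParam_mem {w : SpaceTime → ℝ} (hw : w ∈ spaceW p) (i : Fin 3) :
    w ∈ K.spaceM p i := by
  have := refPoly_face_mem (K.comp_prismMap_mem hw i)
  simpa only [spaceM, Set.mem_ofPred_eq, faceParam_eq] using this

/-! ### Square integrability -/

/-- The closed space-time element. -/
def closedPrism : Set SpaceTime := Set.Icc K.t0 (K.t0 + K.dt) ×ˢ K.triangle

lemma isCompact_triangle : IsCompact K.triangle := (Set.finite_range _).isCompact_convexHull ℝ

lemma isCompact_closedPrism : IsCompact K.closedPrism := isCompact_Icc.prod K.isCompact_triangle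

lemma interval_subset : K.interval ⊆ Set.Icc K.t0 (K.t0 + K.dt) := Set.Ioo_subset_Icc_self

lemma volume_ac_timeMeas (a : ℝ) : volume.restrict K.interval ≪ K.timeMeas a :=
  withDensity_absolutelyContinuous' (K.measurable_weight a).aemeasurable
    (ae_of_all _ fun t => by simpa using K.weight_pos a t)

lemma ae_timeMeas_mem (a : ℝ) : ∀ᵐ t ∂(K.timeMeas a), t ∈ Set.Icc K.t0 (K.t0 + K.dt) :=
  (withDensity_absolutelyContinuous _ _).ae_le
    ((ae_restrict_mem measurableSet_Ioo).mono fun _ h => K.interval_subset h)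

lemma wmeas_ac (a : ℝ) (μ : Measure SpaceTime) : K.wmeas a μ ≪ μ :=
  withDensity_absolutelyContinuous _ _

lemma ac_wmeas (a : ℝ) (μ : Measure SpaceTime) : μ ≪ K.wmeas a μ :=
  withDensity_absolutelyContinuous'
    ((K.measurable_weight a).comp measurable_fst).aemeasurable
    (ae_of_all _ fun t => by simpa using K.weight_pos a t.1)

lemma ae_vol_mem : ∀ᵐ z ∂K.vol, z ∈ K.closedPrism := by
  have hm : MeasurableSet K.carrier :=
    (isOpen_Ioo.prod isOpen_interior).measurableSet
  filter_upwards [ae_restrict_mem hm] with z hz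
  exact ⟨K.interval_subset hz.1, interior_subset hz.2⟩

lemma faceParam_mem {i : Fin 3} {y : ℝ × ℝ} (hy : y ∈ K.interval ×ˢ Set.Ioo (0 : ℝ) 1) :
    K.faceParam i y ∈ K.closedPrism := by
  rw [faceParam_eq, prismMap_apply]
  refine ⟨K.interval_subset hy.1, ?_⟩
  have : ((y.2, 0) : ℝ × ℝ) ∈ K.refMap i ⁻¹' K.triangle := by
    rw [refMap_preimage_triangle]
    exact ⟨hy.2.1.le, le_rfl, by simpa using hy.2.2.le⟩
  exact this

lemma ae_face_mem (i : Fin 3) : ∀ᵐ z ∂(K.faceMeasure i), z ∈ K.closedPrism := by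
  refine Measure.smul_absolutelyContinuous.ae_le ?_
  change ∀ᵐ z ∂_, z ∈ K.closedPrism
  rw [(K.measurableEmbedding_faceParam i).ae_map_iff]
  filter_upwards [ae_restrict_mem (measurableSet_Ioo.prod measurableSet_Ioo)] with y hy
  exact K.faceParam_mem hy

lemma measurableEmbedding_slice (t : ℝ) : MeasurableEmbedding fun x : Plane => ((t, x) : SpaceTime) :=
  MeasurableEmbedding.prodMk_left t MeasurableEmbedding.id

lemma ae_end_mem : ∀ᵐ z ∂K.endMeasure, z ∈ K.closedPrism := by
  have hm : MeasurableSet K.triangle := K.isCompact_triangle.measurableSet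
  rw [endMeasure, ae_add_measure_iff, (measurableEmbedding_slice _).ae_map_iff,
    (measurableEmbedding_slice _).ae_map_iff]
  constructor
  · filter_upwards [ae_restrict_mem hm] with x hx
    exact ⟨⟨le_rfl, by linarith [K.dt_pos]⟩, hx⟩
  · filter_upwards [ae_restrict_mem hm] with x hx
    exact ⟨⟨by linarith [K.dt_pos], le_rfl⟩, hx⟩

/-- The weighted measure is dominated by the unweighted one, since the weight is at most one
after the initial time. -/
lemma wmeas_le (ha : 0 < a) {μ : Measure SpaceTime} (hμ : ∀ᵐ z ∂μ, z ∈ K.closedPrism) :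
    K.wmeas a μ ≤ μ := by
  conv_rhs => rw [← withDensity_one (μ := μ)]
  refine withDensity_mono ?_
  filter_upwards [hμ] with z hz
  have h1 : K.t0 ≤ z.1 := hz.1.1
  rw [Pi.one_apply, ENNReal.ofReal_le_one, weight, Real.exp_le_one_iff]
  nlinarith

lemma memLp_wmeas {F : Type*} [NormedAddCommGroup F] (ha : 0 < a) {μ : Measure SpaceTime}
    (hμ : ∀ᵐ z ∂μ, z ∈ K.closedPrism) {g : SpaceTime → F} (hg : MemLp g 2 μ) :
    MemLp g 2 (K.wmeas a μ) := hg.mono_measure (K.wmeas_le ha hμ)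

instance : IsFiniteMeasure K.vol := by
  have h : K.carrier ⊆ K.closedPrism := Set.prod_mono K.interval_subset interior_subset
  exact ⟨by
    rw [vol, Measure.restrict_apply_univ]
    exact (measure_mono h).trans_lt K.isCompact_closedPrism.measure_lt_top⟩

instance (i : Fin 3) : IsFiniteMeasure (K.faceMeasure i) := by
  have : IsFiniteMeasure ((volume : Measure (ℝ × ℝ)).restrict (K.interval ×ˢ Set.Ioo (0 : ℝ) 1)) := by
    refine ⟨?_⟩
    rw [Measure.restrict_apply_univ]
    exact (measure_mono (Set.prod_mono K.interval_subset Set.Ioo_subset_Icc_self)).trans_lt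
      (isCompact_Icc.prod isCompact_Icc).measure_lt_top
  unfold faceMeasure
  exact Measure.smul_finite _ ENNReal.ofReal_ne_top

instance : IsFiniteMeasure K.endMeasure := by
  have : IsFiniteMeasure ((volume : Measure Plane).restrict K.triangle) := ⟨by
    rw [Measure.restrict_apply_univ]
    exact K.isCompact_triangle.measure_lt_top⟩
  unfold endMeasure; infer_instance

lemma memLp_of_continuous {μ : Measure SpaceTime} [IsFiniteMeasure μ]
    (hμ : ∀ᵐ z ∂μ, z ∈ K.closedPrism) {g : SpaceTime → ℝ} (hg : Continuous g) {q : ENNReal} :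
    MemLp g q μ := _root_.memLp_of_continuous K.isCompact_closedPrism hμ hg

lemma continuous_of_mem_tensorPoly {w : SpaceTime → ℝ} (hw : w ∈ tensorPoly r m) :
    Continuous w := (contDiff_tensorPoly hw).continuous

lemma memLp_poly {μ : Measure SpaceTime} [IsFiniteMeasure μ]
    (hμ : ∀ᵐ z ∂μ, z ∈ K.closedPrism) {w : SpaceTime → ℝ} (hw : w ∈ tensorPoly r m) :
    MemLp w 2 μ := K.memLp_of_continuous hμ (continuous_of_mem_tensorPoly hw)

/-! ### Control of polynomials on the element by their values on faces -/

lemma sq_l2norm_vol (a : ℝ) (i : Fin 3) (w : SpaceTime → ℝ) :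
    l2norm (K.wmeas a K.vol) w ^ 2 = |K.jac| *
      l2norm ((K.timeMeas a).prod (volume.restrict refTri)) (fun y => w (K.prismMap i y)) ^ 2 := by
  rw [sq_l2norm_real, sq_l2norm_real, K.integral_vol a i]

lemma sq_l2norm_face (a : ℝ) (i : Fin 3) (w : SpaceTime → ℝ) :
    l2norm (K.wmeas a (K.faceMeasure i)) w ^ 2 = ‖K.edge i‖ *
      l2norm ((K.timeMeas a).prod (volume.restrict (Set.Ioo 0 1)))
        (fun y => w (K.prismMap i (y.1, (y.2, 0)))) ^ 2 := by
  rw [sq_l2norm_real, sq_l2norm_real, K.integral_face a i]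
  simp only [faceParam_eq]

lemma interval_nonempty : K.interval.Nonempty := Set.nonempty_Ioo.2 (by linarith [K.dt_pos])

/-- A function of `W_h` that is orthogonal to `W̃_h` is controlled by its values on any single
lateral face. -/
theorem exists_vol_le_face (p : ℕ) : ∃ C : ℝ, 0 < C ∧ ∀ (K : Prism) (a : ℝ) (i : Fin 3),
    ∀ w ∈ spaceW p, (∀ z ∈ spaceWt p, ∫ x, w x * z x ∂(K.wmeas a K.vol) = 0) →
      ‖K.edge i‖ * l2norm (K.wmeas a K.vol) w ^ 2 ≤
        C * |K.jac| * l2norm (K.wmeas a (K.faceMeasure i)) w ^ 2 := by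
  obtain ⟨C, hC, hb⟩ := exists_l2norm_refTri_le p
  refine ⟨C ^ 2, by positivity, fun K a i w hw ho => ?_⟩
  have hw' := K.comp_prismMap_mem hw i
  have hwc := continuous_refPoly hw'
  have hS := isCompact_Icc (a := K.t0) (b := K.t0 + K.dt)
  have hθ := K.ae_timeMeas_mem a
  have hslice : ∀ t, ∀ v ∈ planePoly p,
      ∫ y in refTri, w (K.prismMap i (t, y)) * v y = 0 := by
    intro t v hv
    refine slice_orthogonal hS hθ isOpen_Ioo K.interval_nonempty (K.volume_ac_timeMeas a) hw' ?_ hv t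
    intro z hz
    have h := ho _ (K.comp_prismMap_symm_mem hz i)
    rw [K.integral_vol a i] at h
    simpa [K.jac_ne_zero] using h
  have h1 := sq_l2norm_refPrism_le hS hθ hwc fun t =>
    hb _ (refPoly_slice_space hw' t) (hslice t)
  rw [K.sq_l2norm_vol a i, K.sq_l2norm_face a i]
  have := mul_le_mul_of_nonneg_left h1
    (show 0 ≤ ‖K.edge i‖ * |K.jac| by positivity)
  linarith

/-- The discrete trace inequality on the lateral faces. -/
theorem exists_face_le_vol (p : ℕ) : ∃ C : ℝ, 0 < C ∧ ∀ (K : Prism) (a : ℝ) (i : Fin 3),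
    ∀ w ∈ spaceW p, |K.jac| * l2norm (K.wmeas a (K.faceMeasure i)) w ^ 2 ≤
        C * ‖K.edge i‖ * l2norm (K.wmeas a K.vol) w ^ 2 := by
  obtain ⟨C, hC, hb⟩ := exists_l2norm_refEdge_le (p + 1)
  refine ⟨C ^ 2, by positivity, fun K a i w hw => ?_⟩
  have hw' := K.comp_prismMap_mem hw i
  have hwc := continuous_refPoly hw'
  have hS := isCompact_Icc (a := K.t0) (b := K.t0 + K.dt)
  have hθ := K.ae_timeMeas_mem a
  have h1 := sq_l2norm_refFace_le hS hθ hwc fun t => hb _ (refPoly_slice_space hw' t)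
  rw [K.sq_l2norm_vol a i, K.sq_l2norm_face a i]
  have := mul_le_mul_of_nonneg_left h1
    (show 0 ≤ ‖K.edge i‖ * |K.jac| by positivity)
  linarith

lemma carrier_nonempty : K.carrier.Nonempty := by
  obtain ⟨y, hy⟩ := refTri_nonempty
  rw [← K.refMap_preimage_interior 0] at hy
  exact K.interval_nonempty.prod ⟨_, hy⟩

lemma isFiniteMeasure_wmeas (ha : 0 < a) {μ : Measure SpaceTime} [IsFiniteMeasure μ]
    (hμ : ∀ᵐ z ∂μ, z ∈ K.closedPrism) : IsFiniteMeasure (K.wmeas a μ) :=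
  isFiniteMeasure_of_le μ (K.wmeas_le ha hμ)

/-- A polynomial whose weighted norm over the element is zero is the zero function. -/
lemma eq_zero_of_l2norm_vol_eq_zero (ha : 0 < a) {w : SpaceTime → ℝ} (hw : w ∈ tensorPoly r m)
    (h : l2norm (K.wmeas a K.vol) w = 0) : w = 0 :=
  (analyticOnNhd_tensorPoly hw).eq_zero_of_eqOn (isOpen_Ioo.prod isOpen_interior)
    K.carrier_nonempty (eqOn_zero_of_l2norm_eq_zero (μ := volume)
      (isOpen_Ioo.prod isOpen_interior) (K.ac_wmeas a K.vol)
      (contDiff_tensorPoly hw).continuous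
      (K.memLp_wmeas ha K.ae_vol_mem (K.memLp_poly K.ae_vol_mem hw)) h)

/-! ### The inverse inequality in time -/

lemma integral_wmeas_end (a : ℝ) {g : SpaceTime → ℝ} (hg : Continuous g) :
    ∫ z, g z ∂(K.wmeas a K.endMeasure) =
      ∫ x in interior K.triangle, (K.weight a K.t0 * g (K.t0, x) +
        K.weight a (K.t0 + K.dt) * g (K.t0 + K.dt, x)) := by
  have hfin : IsFiniteMeasure ((volume : Measure Plane).restrict K.triangle) := ⟨by
    rw [Measure.restrict_apply_univ]
    exact K.isCompact_triangle.measure_lt_top⟩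
  have hae : ∀ᵐ x ∂(volume : Measure Plane).restrict K.triangle, x ∈ K.triangle :=
    ae_restrict_mem K.isCompact_triangle.measurableSet
  have hi : ∀ t : ℝ, Integrable (fun x : Plane => K.weight a t * g (t, x))
      (volume.restrict K.triangle) := fun t =>
    (_root_.memLp_of_continuous (q := 1) K.isCompact_triangle hae (by fun_prop)).integrable le_rfl
  have hi' : ∀ t : ℝ, Integrable (fun z : SpaceTime => K.weight a z.1 • g z)
      ((volume.restrict K.triangle).map fun x => ((t, x) : SpaceTime)) := fun t => by
    rw [(measurableEmbedding_slice t).integrable_map_iff]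
    exact hi t
  rw [integral_wmeas, endMeasure, integral_add_measure (hi' _) (hi' _),
    (measurableEmbedding_slice _).integral_map, (measurableEmbedding_slice _).integral_map,
    ← restrict_triangle_eq, integral_add (hi _) (hi _)]
  rfl

/-- The values of a polynomial at the initial and the final time are controlled by its norm over
the element. -/
theorem exists_end_le_vol (p : ℕ) {a T : ℝ} (ha : 0 < a) : ∃ C : ℝ, 0 < C ∧
    ∀ K : Prism, K.dt ≤ T → ∀ w ∈ spaceW p,
      l2norm (K.wmeas a K.endMeasure) w ^ 2 ≤
        C * K.dt⁻¹ * l2norm (K.wmeas a K.vol) w ^ 2 := by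
  obtain ⟨C, hC, hb⟩ := exists_endpoints_le (p + 1)
  refine ⟨C * Real.exp (a * T), by positivity, fun K hT w hw => ?_⟩
  have hwc := (contDiff_tensorPoly hw).continuous
  have hdt := K.dt_pos
  have hweight : ∀ t ∈ K.interval, 1 ≤ Real.exp (a * T) * K.weight a t := by
    intro t ht
    rw [weight, ← Real.exp_add]
    refine Real.one_le_exp ?_
    have : t - K.t0 ≤ T := by linarith [ht.2]
    nlinarith
  have hend : ∀ t, K.t0 ≤ t → K.weight a t ≤ 1 := by
    intro t ht
    rw [weight, Real.exp_le_one_iff]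
    nlinarith
  -- the bound on the line over a fixed point in space
  have hline : ∀ x : Plane, w (K.t0, x) ^ 2 + w (K.t0 + K.dt, x) ^ 2 ≤
      C * Real.exp (a * T) * K.dt⁻¹ * ∫ t, w (t, x) ^ 2 ∂(K.timeMeas a) := by
    intro x
    have h1 := hb _ (linePoly_comp_affine (tensorPoly_slice_time hw x) K.t0 K.dt)
    simp only [mul_zero, add_zero, mul_one] at h1
    have h2 : ∫ s in Set.Ioo (0 : ℝ) 1, w (K.t0 + K.dt * s, x) ^ 2 =
        K.dt⁻¹ * ∫ t in K.interval, w (t, x) ^ 2 := by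
      rw [interval, ← integral_Ioc_eq_integral_Ioo, ← integral_Ioc_eq_integral_Ioo,
        ← intervalIntegral.integral_of_le zero_le_one,
        ← intervalIntegral.integral_of_le (by linarith),
        intervalIntegral.integral_comp_add_mul (fun t => w (t, x) ^ 2) hdt.ne']
      simp
    have hint : ∀ g : ℝ → ℝ, Continuous g → Integrable g (volume.restrict K.interval) := by
      intro g hg
      exact (_root_.memLp_of_continuous (q := 1) (ν := volume.restrict (Set.Ioo K.t0 (K.t0 + K.dt)))
        isCompact_Icc
        ((ae_restrict_mem measurableSet_Ioo).mono fun _ h => Set.Ioo_subset_Icc_self h)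
        hg).integrable le_rfl
    have hwt := K.continuous_weight a
    have h3 : ∫ t in K.interval, w (t, x) ^ 2 ≤
        Real.exp (a * T) * ∫ t, w (t, x) ^ 2 ∂(K.timeMeas a) := by
      rw [timeMeas, integral_withDensity_eq_integral_toReal_smul (K.measurable_weight a)
        (ae_of_all _ fun _ => ENNReal.ofReal_lt_top), ← integral_const_mul]
      simp only [ENNReal.toReal_ofReal (K.weight_pos a _).le, smul_eq_mul]
      refine integral_mono_ae (hint _ (by fun_prop)) (hint _ (by fun_prop)) ?_
      filter_upwards [ae_restrict_mem measurableSet_Ioo] with t ht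
      have := mul_le_mul_of_nonneg_right (hweight t ht) (sq_nonneg (w (t, x)))
      linarith
    rw [h2] at h1
    calc _ ≤ _ := h1
      _ ≤ C * (K.dt⁻¹ * (Real.exp (a * T) * ∫ t, w (t, x) ^ 2 ∂(K.timeMeas a))) := by gcongr
      _ = _ := by ring
  have hfin : IsFiniteMeasure ((volume : Measure Plane).restrict (interior K.triangle)) := by
    rw [← restrict_triangle_eq]
    exact ⟨by
      rw [Measure.restrict_apply_univ]
      exact K.isCompact_triangle.measure_lt_top⟩
  have hae : ∀ᵐ x ∂(volume : Measure Plane).restrict (interior K.triangle), x ∈ K.triangle :=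
    (ae_restrict_mem isOpen_interior.measurableSet).mono fun _ h => interior_subset h
  have hprod : Integrable (fun z : SpaceTime => w z ^ 2)
      ((K.timeMeas a).prod (volume.restrict (interior K.triangle))) :=
    (memLp_prod isCompact_Icc (K.ae_timeMeas_mem a) K.isCompact_triangle hae hwc).integrable_sq
  rw [sq_l2norm_real, sq_l2norm_real, K.integral_wmeas_end a (by fun_prop), wmeas_vol_eq_prod,
    integral_prod_symm _ hprod, ← integral_const_mul]
  have hwt := K.continuous_weight a
  refine integral_mono
    ((_root_.memLp_of_continuous (q := 1) K.isCompact_triangle hae (by fun_prop)).integrable le_rfl)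
    (hprod.integral_prod_right.const_mul _) fun x => ?_
  refine le_trans ?_ (hline x)
  have e1 := mul_le_mul_of_nonneg_right (hend K.t0 le_rfl) (sq_nonneg (w (K.t0, x)))
  have e2 := mul_le_mul_of_nonneg_right (hend (K.t0 + K.dt) (by linarith))
    (sq_nonneg (w (K.t0 + K.dt, x)))
  simp only at e1 e2 ⊢
  linarith

end Prism

/-! ### The divergence theorem and Green's formula on the element -/

/-- The fundamental theorem of calculus in the second variable, integrated over the reference
triangle. -/
lemma integral_refTri_deriv {g g' : ℝ × ℝ → ℝ} (hg' : Continuous g')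
    (hd : ∀ y, HasDerivAt (fun r => g (y.1, r)) (g' y) y.2) :
    ∫ y in refTri, g' y = ∫ s in Set.Ioo (0 : ℝ) 1, (g (s, 1 - s) - g (s, 0)) := by
  have hm := isOpen_refTri.measurableSet
  have hint : Integrable (refTri.indicator g') (volume.prod volume) := by
    rw [← Measure.volume_eq_prod, integrable_indicator_iff hm]
    exact (memLp_refTri hg').integrable (by norm_num)
  rw [← integral_indicator hm, Measure.volume_eq_prod, integral_prod _ hint,
    ← integral_indicator measurableSet_Ioo]
  congr 1
  funext s
  by_cases hs : s ∈ Set.Ioo (0 : ℝ) 1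
  · rw [Set.indicator_of_mem hs]
    have e : (fun r => refTri.indicator g' (s, r)) =
        (Set.Ioo 0 (1 - s)).indicator fun r => g' (s, r) := by
      funext r
      by_cases hr : r ∈ Set.Ioo 0 (1 - s)
      · rw [Set.indicator_of_mem hr, Set.indicator_of_mem]
        exact ⟨hs.1, hr.1, by simp only; linarith [hr.2]⟩
      · rw [Set.indicator_of_notMem hr, Set.indicator_of_notMem]
        rintro ⟨_, h2, h3⟩
        simp only at h2 h3
        exact hr ⟨h2, by linarith⟩
    rw [e, integral_indicator measurableSet_Ioo, ← integral_Ioc_eq_integral_Ioo,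
      ← intervalIntegral.integral_of_le (by linarith [hs.2])]
    exact intervalIntegral.integral_eq_sub_of_hasDerivAt (f := fun r => g (s, r))
      (fun r _ => hd (s, r)) (by
        refine Continuous.intervalIntegrable ?_ _ _
        fun_prop)
  · rw [Set.indicator_of_notMem hs]
    have e : (fun r => refTri.indicator g' (s, r)) = 0 := by
      funext r
      rw [Set.indicator_of_notMem]
      · rfl
      rintro ⟨h1, h2, h3⟩
      simp only at h1 h2 h3
      exact hs ⟨h1, by linarith⟩
    rw [e]
    simp

namespace Prism

variable (K : Prism) {p r m : ℕ} {a : ℝ}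

/-- The weighted integral of a function over the parameter domain `Iₙ × (0,1)` of a lateral face,
without the area factor. -/
noncomputable def faceMean (a : ℝ) (i : Fin 3) (φ : SpaceTime → ℝ) : ℝ :=
  ∫ y, φ (K.faceParam i y) ∂((K.timeMeas a).prod (volume.restrict (Set.Ioo 0 1)))

lemma integral_face_eq_faceMean (a : ℝ) (i : Fin 3) (φ : SpaceTime → ℝ) :
    ∫ z, φ z ∂(K.wmeas a (K.faceMeasure i)) = ‖K.edge i‖ * K.faceMean a i φ :=
  K.integral_face a i φ

lemma integral_Ioo_reflect (g : ℝ → ℝ) :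
    ∫ s in Set.Ioo (0 : ℝ) 1, g (1 - s) = ∫ s in Set.Ioo (0 : ℝ) 1, g s := by
  rw [← integral_Ioc_eq_integral_Ioo, ← integral_Ioc_eq_integral_Ioo,
    ← intervalIntegral.integral_of_le zero_le_one, ← intervalIntegral.integral_of_le zero_le_one,
    intervalIntegral.integral_comp_sub_left]
  simp

/-- The hypotenuse of the reference triangle is mapped to the next edge, with reversed
orientation. -/
lemma refMap_hypotenuse (i : Fin 3) (t s : ℝ) :
    K.prismMap i (t, (s, 1 - s)) = K.faceParam (i + 1) (t, 1 - s) := by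
  have e1 : i + 1 + 1 = i + 2 := by fin_cases i <;> rfl
  have e2 : i + 1 + 2 = i := by fin_cases i <;> rfl
  rw [prismMap_apply, refMap_apply, faceParam, AffineMap.lineMap_apply]
  simp only [edge, side, edgeStart, edgeEnd, e1, e2, vsub_eq_sub, vadd_eq_add, Prod.mk.injEq,
    true_and]
  module

/-- The derivative of a smooth function along a side, by integration over the lines in the direction
of the side, which run from the `i`-th face to the next one. -/
lemma integral_fderiv_side (a : ℝ) (i : Fin 3) {φ : SpaceTime → ℝ} (hφ : ContDiff ℝ ∞ φ) :
    ∫ z, fderiv ℝ φ z (0, K.side i) ∂(K.wmeas a K.vol) =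
      |K.jac| * (K.faceMean a (i + 1) φ - K.faceMean a i φ) := by
  have hφc := hφ.continuous
  have hdc : Continuous fun z => fderiv ℝ φ z (0, K.side i) :=
    (hφ.continuous_fderiv (by simp)).clm_apply continuous_const
  have hc : ∀ i, Continuous (K.prismMap i) := fun i => (K.prismMap i).continuous
  have hci := hc i
  have hθ := K.ae_timeMeas_mem a
  have hS := isCompact_Icc (a := K.t0) (b := K.t0 + K.dt)
  have hface : ∀ i, Integrable (fun y => φ (K.faceParam i y))
      ((K.timeMeas a).prod (volume.restrict (Set.Ioo 0 1))) := fun i =>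
    (memLp_prod hS hθ isCompact_Icc ae_refIoo_mem
      (hφc.comp (K.continuous_faceParam i))).integrable (by norm_num)
  rw [K.integral_vol a i]
  congr 1
  rw [integral_prod]
  · have hder : ∀ t, ∫ y in refTri, fderiv ℝ φ (K.prismMap i (t, y)) (0, K.side i) =
        (∫ s in Set.Ioo (0 : ℝ) 1, φ (K.faceParam (i + 1) (t, s))) -
          ∫ s in Set.Ioo (0 : ℝ) 1, φ (K.faceParam i (t, s)) := by
      intro t
      have hft : ∀ i, Integrable (fun s => φ (K.faceParam i (t, s)))
          (volume.restrict (Set.Ioo (0 : ℝ) 1)) := fun i =>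
        (_root_.memLp_of_continuous (q := 1) isCompact_Icc ae_refIoo_mem
          (hφc.comp ((K.continuous_faceParam i).comp (by fun_prop)))).integrable le_rfl
      have hft' : Integrable (fun s => φ (K.faceParam (i + 1) (t, 1 - s)))
          (volume.restrict (Set.Ioo (0 : ℝ) 1)) :=
        (_root_.memLp_of_continuous (q := 1) isCompact_Icc ae_refIoo_mem
          (hφc.comp ((K.continuous_faceParam (i + 1)).comp (by fun_prop)))).integrable le_rfl
      rw [integral_refTri_deriv (g := fun y => φ (K.prismMap i (t, y)))
        (g' := fun y => fderiv ℝ φ (K.prismMap i (t, y)) (0, K.side i))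
        (hdc.comp (hci.comp (by fun_prop)))]
      · simp only [refMap_hypotenuse]
        simp only [← K.faceParam_eq i (t, _)]
        rw [integral_sub hft' (hft i),
          integral_Ioo_reflect fun s => φ (K.faceParam (i + 1) (t, s))]
      · intro y
        have h1 : HasDerivAt (fun r : ℝ => K.prismMap i (t, (y.1, r))) (0, K.side i) y.2 := by
          refine (hasDerivAt_const y.2 t).prodMk ?_
          have h2 : HasDerivAt (fun r : ℝ => K.edgeStart i + (y.1 • K.edge i + r • K.side i))
              ((1 : ℝ) • K.side i) y.2 :=
            (((hasDerivAt_id y.2).smul_const (K.side i)).const_add _).const_add _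
          rw [one_smul] at h2
          exact h2
        have h3 : HasFDerivAt φ (fderiv ℝ φ (K.prismMap i (t, y))) (K.prismMap i (t, (y.1, y.2))) :=
          (hφ.differentiable (by simp) _).hasFDerivAt
        exact h3.comp_hasDerivAt y.2 h1
    simp only [hder]
    rw [integral_sub, faceMean, faceMean, integral_prod _ (hface (i + 1)), integral_prod _ (hface i)]
    · exact (hface (i + 1)).integral_prod_left
    · exact (hface i).integral_prod_left
  · exact (memLp_prod hS hθ isCompact_Icc ae_refTri_mem
      (g := fun y => fderiv ℝ φ (K.prismMap i y) (0, K.side i)) (hdc.comp hci)).integrable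
        (by norm_num)

/-- The divergence theorem for smooth functions on the element, with the weight in time. -/
theorem integral_fderiv_space (a : ℝ) {φ : SpaceTime → ℝ} (hφ : ContDiff ℝ ∞ φ) (y : Plane) :
    ∫ z, fderiv ℝ φ z (0, y) ∂(K.wmeas a K.vol) =
      ∑ i, inner ℝ y (K.normal i) * ∫ z, φ z ∂(K.wmeas a (K.faceMeasure i)) := by
  have hint : ∀ d : Plane, Integrable (fun z => fderiv ℝ φ z (0, d)) (K.wmeas a K.vol) := by
    intro d
    have hc : Continuous fun z => fderiv ℝ φ z (0, d) :=
      (hφ.continuous_fderiv (by simp)).clm_apply continuous_const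
    rw [K.wmeas_vol a 0]
    refine Integrable.smul_measure ?_ ENNReal.ofReal_ne_top
    rw [(K.prismMap 0).measurableEmbedding.integrable_map_iff]
    exact (memLp_prod isCompact_Icc (K.ae_timeMeas_mem a) isCompact_Icc ae_refTri_mem
      (hc.comp (K.prismMap 0).continuous)).integrable (by norm_num)
  have h0 := K.integral_fderiv_side a 0 hφ
  have h1 := K.integral_fderiv_side a 1 hφ
  -- Cramer's rule for the basis of two side vectors
  have hy : K.jac • y = (cross y (K.edge 2)) • K.side 1 - cross y (K.edge 0) • K.side 0 := by
    have := K.cross_edge_edge 0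
    simp only [zero_add] at this
    have h3 : K.jac = -cross (K.edge 0) (K.edge 2) := by rw [this, neg_neg]
    rw [h3, side_eq, side_eq]
    simp only [zero_add, show (1 : Fin 3) + 2 = 0 from rfl]
    ext i
    fin_cases i <;> simp [cross] <;> ring
  have hfd : ∀ z, K.jac * fderiv ℝ φ z (0, y) = cross y (K.edge 2) * fderiv ℝ φ z (0, K.side 1) -
      cross y (K.edge 0) * fderiv ℝ φ z (0, K.side 0) := by
    intro z
    have : K.jac • ((0, y) : SpaceTime) = (cross y (K.edge 2)) • ((0, K.side 1) : SpaceTime) -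
        cross y (K.edge 0) • ((0, K.side 0) : SpaceTime) := by
      ext1
      · simp
      · exact hy
    have := congrArg (fderiv ℝ φ z) this
    simpa only [map_sub, map_smul, smul_eq_mul] using this
  have hI : K.jac * ∫ z, fderiv ℝ φ z (0, y) ∂(K.wmeas a K.vol) =
      cross y (K.edge 2) * (|K.jac| * (K.faceMean a 2 φ - K.faceMean a 1 φ)) -
      cross y (K.edge 0) * (|K.jac| * (K.faceMean a 1 φ - K.faceMean a 0 φ)) := by
    rw [← integral_const_mul]
    simp only [hfd]
    rw [integral_sub ((hint _).const_mul _) ((hint _).const_mul _), integral_const_mul,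
      integral_const_mul, h0, h1]
    rfl
  have hn : ∀ i, ‖K.edge i‖ * inner ℝ y (K.normal i) =
      SignType.sign K.jac * cross y (K.edge i) := by
    intro i
    rw [plane_inner, cross]
    linear_combination y 0 * K.edge_mul_normal_zero i + y 1 * K.edge_mul_normal_one i
  have hsum : cross y (K.edge 0) + cross y (K.edge 1) + cross y (K.edge 2) = 0 := by
    have h := K.sum_edge
    have e0 := congrArg (fun v : Plane => v 0) h
    have e1 := congrArg (fun v : Plane => v 1) h
    simp at e0 e1
    simp only [cross]
    linear_combination y 0 * e1 - y 1 * e0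
  have hs := K.sign_mul_jac
  refine mul_left_cancel₀ K.jac_ne_zero (hI.trans ?_)
  simp only [integral_face_eq_faceMean, Fin.sum_univ_three]
  have hrw : ∀ i, inner ℝ y (K.normal i) * (‖K.edge i‖ * K.faceMean a i φ) =
      SignType.sign K.jac * cross y (K.edge i) * K.faceMean a i φ := by
    intro i; rw [← hn i]; ring
  rw [hrw, hrw, hrw, ← hs]
  linear_combination -(SignType.sign K.jac * K.jac * K.faceMean a 1 φ) * hsum

lemma faceMeasure_le_side (i : Fin 3) : K.faceMeasure i ≤ K.sideMeasure := by
  have h : ∀ s, K.faceMeasure i s ≤ K.sideMeasure s := by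
    intro s
    rw [sideMeasure, Measure.finsetSum_apply]
    exact Finset.single_le_sum (f := fun i => K.faceMeasure i s) (fun _ _ => zero_le)
      (Finset.mem_univ i)
  exact Measure.le_iff.2 fun s _ => h s

/-- Continuity of the `L²` pairing in its first argument. -/
lemma _root_.tendsto_integral_mul {X : Type*} [MeasurableSpace X] {ν : Measure X}
    {f : ℕ → X → ℝ} {g w : X → ℝ} (hf : ∀ k, MemLp (f k) 2 ν) (hg : MemLp g 2 ν)
    (hw : MemLp w 2 ν) (h : Tendsto (fun k => eLpNorm (fun z => f k z - g z) 2 ν) atTop (𝓝 0)) :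
    Tendsto (fun k => ∫ z, f k z * w z ∂ν) atTop (𝓝 (∫ z, g z * w z ∂ν)) := by
  rw [tendsto_iff_norm_sub_tendsto_zero]
  have h1 : Tendsto (fun k => (eLpNorm (fun z => f k z - g z) 2 ν).toReal * l2norm ν w) atTop
      (𝓝 0) := by
    have := (ENNReal.tendsto_toReal (by simp : (0 : ENNReal) ≠ ⊤)).comp h
    simpa using this.mul_const (l2norm ν w)
  refine squeeze_zero (fun _ => norm_nonneg _) (fun k => ?_) h1
  rw [← integral_sub (integrable_mul_of_memLp (hf k) hw) (integrable_mul_of_memLp hg hw)]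
  have h2 : MemLp (fun z => f k z - g z) 2 ν := (hf k).sub hg
  rw [← l2norm_eq_toReal h2, Real.norm_eq_abs]
  simp only [← sub_mul]
  exact abs_integral_mul_le h2 hw

lemma fderiv_mul_space {φ w : SpaceTime → ℝ} (hφ : ContDiff ℝ ∞ φ) (hw : ContDiff ℝ ∞ w)
    (z d : SpaceTime) : fderiv ℝ (fun z => φ z * w z) z d =
      φ z * fderiv ℝ w z d + fderiv ℝ φ z d * w z := by
  have h1 := (hφ.differentiable (by simp) z).hasFDerivAt
  have h2 := (hw.differentiable (by simp) z).hasFDerivAt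
  have h3 := (h1.mul h2).fderiv
  refine (congrArg (fun L => L d) h3).trans ?_
  simp [mul_comm]

lemma coordDir_succ (j : Fin 2) : coordDir j.succ = (0, EuclideanSpace.single j 1) := by
  fin_cases j <;> rfl

/-- Green's formula for a function of `H¹` with its trace, against a polynomial. -/
theorem green (ha : 0 < a) {v : SpaceTime → ℝ} {G : Fin 3 → SpaceTime → ℝ} {γ : SpaceTime → ℝ}
    (hv : K.HasH1Grad v G) (hγ : K.IsTrace v G γ) {w : SpaceTime → ℝ} (hw : w ∈ tensorPoly r m)
    (j : Fin 2) :
    ∫ z, v z * fderiv ℝ w z (coordDir j.succ) ∂(K.wmeas a K.vol) +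
      ∫ z, G j.succ z * w z ∂(K.wmeas a K.vol) =
      ∑ i, K.normal i j * ∫ z, γ z * w z ∂(K.wmeas a (K.faceMeasure i)) := by
  obtain ⟨hγL, φ, hφ, h1, h2, h3⟩ := hγ
  obtain ⟨hvL, hGL, -⟩ := hv
  have hws := contDiff_tensorPoly hw
  have hfc : ∀ {f : SpaceTime → ℝ}, ContDiff ℝ ∞ f →
      Continuous fun z => fderiv ℝ f z (coordDir j.succ) := fun hf =>
    (hf.continuous_fderiv (by simp)).clm_apply continuous_const
  have hle := K.wmeas_le ha K.ae_vol_mem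
  have hmem : ∀ {f : SpaceTime → ℝ}, Continuous f → MemLp f 2 (K.wmeas a K.vol) := fun hf =>
    K.memLp_wmeas ha K.ae_vol_mem (K.memLp_of_continuous K.ae_vol_mem hf)
  have hlef : ∀ i, K.wmeas a (K.faceMeasure i) ≤ K.sideMeasure + K.endMeasure := fun i =>
    ((K.wmeas_le ha (K.ae_face_mem i)).trans (K.faceMeasure_le_side i)).trans
      (Measure.le_add_right le_rfl)
  have hmemf : ∀ i, ∀ {f : SpaceTime → ℝ}, Continuous f → MemLp f 2 (K.wmeas a (K.faceMeasure i)) :=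
    fun i f hf => K.memLp_wmeas ha (K.ae_face_mem i) (K.memLp_of_continuous (K.ae_face_mem i) hf)
  have t1 : Tendsto (fun k => ∫ z, φ k z * fderiv ℝ w z (coordDir j.succ) ∂(K.wmeas a K.vol)) atTop
      (𝓝 (∫ z, v z * fderiv ℝ w z (coordDir j.succ) ∂(K.wmeas a K.vol))) :=
    tendsto_integral_mul (fun k => hmem (hφ k).continuous) (hvL.mono_measure hle) (hmem (hfc hws))
      (tendsto_of_tendsto_of_tendsto_of_le_of_le tendsto_const_nhds h1 (fun _ => zero_le)
        fun k => eLpNorm_mono_measure _ hle)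
  have t2 : Tendsto (fun k => ∫ z, fderiv ℝ (φ k) z (coordDir j.succ) * w z ∂(K.wmeas a K.vol)) atTop
      (𝓝 (∫ z, G j.succ z * w z ∂(K.wmeas a K.vol))) :=
    tendsto_integral_mul (fun k => hmem (hfc (hφ k))) ((hGL _).mono_measure hle)
      (hmem hws.continuous)
      (tendsto_of_tendsto_of_tendsto_of_le_of_le tendsto_const_nhds (h2 j.succ)
        (fun _ => zero_le) fun k => eLpNorm_mono_measure _ hle)
  have t3 : ∀ i, Tendsto (fun k => ∫ z, φ k z * w z ∂(K.wmeas a (K.faceMeasure i))) atTop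
      (𝓝 (∫ z, γ z * w z ∂(K.wmeas a (K.faceMeasure i)))) := fun i =>
    tendsto_integral_mul (fun k => hmemf i (hφ k).continuous) (hγL.mono_measure (hlef i))
      (hmemf i hws.continuous)
      (tendsto_of_tendsto_of_tendsto_of_le_of_le tendsto_const_nhds h3
        (fun _ => zero_le) fun k => eLpNorm_mono_measure _ (hlef i))
  have t4 := tendsto_finsetSum (Finset.univ : Finset (Fin 3))
    fun i _ => (t3 i).const_mul (K.normal i j)
  refine tendsto_nhds_unique (t1.add t2) (t4.congr fun k => ?_)
  have hs := K.integral_fderiv_space a ((hφ k).mul hws) (EuclideanSpace.single j 1)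
  rw [← coordDir_succ] at hs
  simp only [fderiv_mul_space (hφ k) hws] at hs
  rw [integral_add (integrable_mul_of_memLp (hmem (hφ k).continuous) (hmem (hfc hws)))
    (integrable_mul_of_memLp (hmem (hfc (hφ k))) (hmem hws.continuous))] at hs
  rw [hs]
  refine Finset.sum_congr rfl fun i _ => ?_
  rw [EuclideanSpace.inner_single_left]
  simp

end Prism

namespace Prism

variable (K : Prism) {p r m : ℕ} {a c Cmin Cmax : ℝ} {τ : SpaceTime → ℝ}

/-! ### Functions orthogonal to polynomials of lower degree -/

/-- The function `w` belongs to `W_h` and is orthogonal to `W̃_h`. -/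
structure IsTop (p : ℕ) (a : ℝ) (w : SpaceTime → ℝ) : Prop where
  mem : w ∈ spaceW p
  orth : ∀ z ∈ spaceWt p, ∫ x, w x * z x ∂(K.wmeas a K.vol) = 0

lemma memLp_vol (ha : 0 < a) {w : SpaceTime → ℝ} (hw : w ∈ tensorPoly r m) :
    MemLp w 2 (K.wmeas a K.vol) := K.memLp_wmeas ha K.ae_vol_mem (K.memLp_poly K.ae_vol_mem hw)

lemma memLp_face (ha : 0 < a) (i : Fin 3) {w : SpaceTime → ℝ} (hw : w ∈ tensorPoly r m) :
    MemLp w 2 (K.wmeas a (K.faceMeasure i)) :=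
  K.memLp_wmeas ha (K.ae_face_mem i) (K.memLp_poly (K.ae_face_mem i) hw)

variable {K} in
lemma IsTop.linear_comb (ha : 0 < a) {u w : SpaceTime → ℝ} (hu : K.IsTop p a u)
    (hw : K.IsTop p a w) (b c : ℝ) : K.IsTop p a (fun z => b * u z + c * w z) where
  mem := add_mem (Submodule.smul_mem _ b hu.mem) (Submodule.smul_mem _ c hw.mem)
  orth z hz := by
    have h1 := (integrable_mul_of_memLp (K.memLp_vol ha hu.mem) (K.memLp_vol ha hz)).const_mul b
    have h2 := (integrable_mul_of_memLp (K.memLp_vol ha hw.mem) (K.memLp_vol ha hz)).const_mul c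
    simp only [add_mul, mul_assoc]
    rw [integral_add h1 h2, integral_const_mul, integral_const_mul, hu.orth z hz, hw.orth z hz]
    simp

lemma l2norm_vol_le_face (p : ℕ) : ∃ C : ℝ, 0 < C ∧ ∀ (K : Prism) (a : ℝ) (i : Fin 3),
    ∀ w, K.IsTop p a w →
      l2norm (K.wmeas a K.vol) w ≤ C * √K.h * l2norm (K.wmeas a (K.faceMeasure i)) w := by
  obtain ⟨C, hC, hb⟩ := exists_vol_le_face p
  refine ⟨√(2 * C), by positivity, fun K a i w hw => ?_⟩
  have h1 := hb K a i w hw.mem hw.orth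
  have h2 := K.abs_jac_le_h i
  have he := K.edge_pos i
  have hh := K.h_pos
  refine abs_le_of_sq_le_sq' ?_ (by have := l2norm_nonneg (ν := K.wmeas a (K.faceMeasure i)) w
                                    positivity) |>.2
  rw [mul_pow, mul_pow, Real.sq_sqrt (by positivity), Real.sq_sqrt hh.le]
  have h3 : C * |K.jac| * l2norm (K.wmeas a (K.faceMeasure i)) w ^ 2 ≤
      C * (‖K.edge i‖ * (2 * K.h)) * l2norm (K.wmeas a (K.faceMeasure i)) w ^ 2 := by gcongr
  refine le_of_mul_le_mul_left ?_ he
  linarith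

/-- On a shape regular triangle the norms on any two lateral faces are comparable. -/
lemma l2norm_face_le_face (p : ℕ) (c : ℝ) : ∃ C : ℝ, 0 < C ∧
    ∀ (K : Prism) (a : ℝ), K.h / K.rho ≤ c → ∀ (i j : Fin 3) w, K.IsTop p a w →
      l2norm (K.wmeas a (K.faceMeasure i)) w ≤ C * l2norm (K.wmeas a (K.faceMeasure j)) w := by
  obtain ⟨C, hC, hb⟩ := exists_vol_le_face p
  obtain ⟨C', hC', hb'⟩ := exists_face_le_vol p
  -- the summand `1` only makes the constant positive
  refine ⟨√(C * C' * (2 * |c|) + 1), by positivity, fun K a hc i j w hw => ?_⟩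
  have h1 := hb K a j w hw.mem hw.orth
  have h2 := hb' K a i w hw.mem
  have h3 : ‖K.edge i‖ ≤ 2 * |c| * ‖K.edge j‖ := K.edge_le_mul_edge (hc.trans (le_abs_self c)) i j
  have he := K.edge_pos j
  have hi := K.edge_pos i
  have hJ := K.abs_jac_pos
  refine abs_le_of_sq_le_sq' ?_ (by have := l2norm_nonneg (ν := K.wmeas a (K.faceMeasure j)) w
                                    positivity) |>.2
  rw [mul_pow, Real.sq_sqrt (by positivity)]
  set x := l2norm (K.wmeas a (K.faceMeasure i)) w
  set y := l2norm (K.wmeas a (K.faceMeasure j)) w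
  set z := l2norm (K.wmeas a K.vol) w
  have h4 : ‖K.edge j‖ * |K.jac| * x ^ 2 ≤ ‖K.edge j‖ * |K.jac| * (C * C' * (2 * |c|) * y ^ 2) := by
    calc ‖K.edge j‖ * |K.jac| * x ^ 2 = ‖K.edge j‖ * (|K.jac| * x ^ 2) := by ring
      _ ≤ ‖K.edge j‖ * (C' * ‖K.edge i‖ * z ^ 2) := by gcongr
      _ = C' * ‖K.edge i‖ * (‖K.edge j‖ * z ^ 2) := by ring
      _ ≤ C' * ‖K.edge i‖ * (C * |K.jac| * y ^ 2) := by gcongr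
      _ ≤ C' * (2 * |c| * ‖K.edge j‖) * (C * |K.jac| * y ^ 2) := by gcongr
      _ = _ := by ring
  have h5 := le_of_mul_le_mul_left h4 (by positivity)
  nlinarith [sq_nonneg y]

/-! ### The error equations -/

/-- The stabilization function: measurable with `0 < Cmin ≤ τ ≤ Cmax` on the lateral boundary. -/
structure IsStab (τ : SpaceTime → ℝ) (Cmin Cmax : ℝ) : Prop where
  pos : 0 < Cmin
  meas : AEMeasurable τ K.sideMeasure
  bound : ∀ᵐ z ∂K.sideMeasure, Cmin ≤ τ z ∧ τ z ≤ Cmax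

lemma face_ac_side (a : ℝ) (i : Fin 3) : K.wmeas a (K.faceMeasure i) ≪ K.sideMeasure :=
  (K.wmeas_ac a _).trans (K.faceMeasure_le_side i).absolutelyContinuous

variable {K}

lemma IsStab.bound_face (h : K.IsStab τ Cmin Cmax) (a : ℝ) (i : Fin 3) :
    ∀ᵐ z ∂(K.wmeas a (K.faceMeasure i)), Cmin ≤ τ z ∧ τ z ≤ Cmax :=
  (K.face_ac_side a i).ae_le h.bound

lemma IsStab.norm_mul_le (h : K.IsStab τ Cmin Cmax) (a : ℝ) (i : Fin 3) (g : SpaceTime → ℝ) :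
    ∀ᵐ z ∂(K.wmeas a (K.faceMeasure i)), ‖τ z * g z‖ ≤ Cmax * ‖g z‖ := by
  filter_upwards [h.bound_face a i] with z hz
  rw [norm_mul, Real.norm_eq_abs (τ z), abs_of_nonneg (h.pos.le.trans hz.1)]
  exact mul_le_mul_of_nonneg_right hz.2 (norm_nonneg _)

lemma IsStab.memLp_mul (h : K.IsStab τ Cmin Cmax) {i : Fin 3} {g : SpaceTime → ℝ}
    (hg : MemLp g 2 (K.wmeas a (K.faceMeasure i))) :
    MemLp (fun z => τ z * g z) 2 (K.wmeas a (K.faceMeasure i)) :=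
  hg.of_le_mul ((h.meas.mono_ac (K.face_ac_side a i)).aestronglyMeasurable.mul hg.1)
    (h.norm_mul_le a i g)

/-- The lateral faces have positive measure. -/
lemma ae_face_neBot (K : Prism) (a : ℝ) (i : Fin 3) :
    (ae (K.wmeas a (K.faceMeasure i))).NeBot := by
  rw [ae_neBot]
  intro h0
  have h1 := K.integral_face a i fun _ => 1
  rw [h0, integral_zero_measure, eq_comm] at h1
  simp only [integral_const, smul_eq_mul, mul_one] at h1
  rw [mul_eq_zero, or_iff_right (K.edge_pos i).ne', Measure.real,
    ENNReal.toReal_eq_zero_iff, or_iff_left (measure_ne_top _ _),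
    ← Set.univ_prod_univ, Measure.prod_prod, mul_eq_zero, Measure.measure_univ_eq_zero,
    Measure.measure_univ_eq_zero] at h1
  rcases h1 with h1 | h1
  · have h2 := K.volume_ac_timeMeas a
    rw [h1, Measure.absolutelyContinuous_zero_iff, Measure.restrict_eq_zero, interval,
      Real.volume_Ioo] at h2
    have := K.dt_pos
    simp at h2
    linarith
  · rw [Measure.restrict_eq_zero, Real.volume_Ioo] at h1
    norm_num at h1

lemma IsStab.le (h : K.IsStab τ Cmin Cmax) : Cmin ≤ Cmax := by
  have := ae_face_neBot K 0 0
  obtain ⟨z, hz⟩ := (h.bound_face 0 0).exists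
  exact hz.1.trans hz.2

variable (K)

/-- The pair `(dV, dW)` is orthogonal to the polynomials of lower degree and solves the face
equations of the projection with right-hand side `b i` on the `i`-th face. -/
structure IsErrorPair (p : ℕ) (a : ℝ) (τ : SpaceTime → ℝ) (b : Fin 3 → SpaceTime → ℝ)
    (dV : SpaceTime → Plane) (dW : SpaceTime → ℝ) : Prop where
  topV : ∀ j, K.IsTop p a (fun z => dV z j)
  topW : K.IsTop p a dW
  face : ∀ i, ∀ σ ∈ spaceW p,
    ∫ z, (inner ℝ (dV z) (K.normal i) - τ z * dW z) * σ z ∂(K.wmeas a (K.faceMeasure i)) =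
      ∫ z, b i z * σ z ∂(K.wmeas a (K.faceMeasure i))

variable {K}

lemma isTop_inner (ha : 0 < a) {dV : SpaceTime → Plane} (h : ∀ j, K.IsTop p a (fun z => dV z j))
    (y : Plane) : K.IsTop p a (fun z => inner ℝ (dV z) y) := by
  have := (h 0).linear_comb ha (h 1) (y 0) (y 1)
  simpa only [plane_inner, mul_comm (y _)] using this

/-- Green's formula for two polynomials. -/
lemma green_poly (ha : 0 < a) {u w : SpaceTime → ℝ} (hu : u ∈ spaceW p) (hw : w ∈ spaceW p)
    (j : Fin 2) :
    ∫ z, u z * fderiv ℝ w z (coordDir j.succ) ∂(K.wmeas a K.vol) +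
      ∫ z, fderiv ℝ u z (coordDir j.succ) * w z ∂(K.wmeas a K.vol) =
      ∑ i, K.normal i j * ∫ z, u z * w z ∂(K.wmeas a (K.faceMeasure i)) := by
  have hus := contDiff_tensorPoly hu
  have hws := contDiff_tensorPoly hw
  have h1 := K.integral_fderiv_space a (hus.mul hws) (EuclideanSpace.single j 1)
  rw [← coordDir_succ] at h1
  simp only [fderiv_mul_space hus hws] at h1
  rw [integral_add
    (integrable_mul_of_memLp (K.memLp_vol ha hu) (K.memLp_vol ha (fderiv_tensorPoly_mem hw j)))
    (integrable_mul_of_memLp (K.memLp_vol ha (fderiv_tensorPoly_mem hu j)) (K.memLp_vol ha hw))]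
    at h1
  rw [h1]
  refine Finset.sum_congr rfl fun i _ => ?_
  rw [EuclideanSpace.inner_single_left]
  simp

/-- The normal components of a top order field and the values of a top order function are
orthogonal on the lateral boundary, by the divergence theorem. -/
lemma sum_integral_normal_mul (ha : 0 < a) {dV : SpaceTime → Plane} {dW : SpaceTime → ℝ}
    (hV : ∀ j, K.IsTop p a (fun z => dV z j)) (hW : K.IsTop p a dW) :
    ∑ i, ∫ z, inner ℝ (dV z) (K.normal i) * dW z ∂(K.wmeas a (K.faceMeasure i)) = 0 := by
  have hj : ∀ j : Fin 2, ∑ i, K.normal i j *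
      ∫ z, dV z j * dW z ∂(K.wmeas a (K.faceMeasure i)) = 0 := by
    intro j
    have h2 := hW.orth _ (fderiv_tensorPoly_mem (hV j).mem j)
    simp only [mul_comm (dW _)] at h2
    rw [← green_poly ha (hV j).mem hW.mem, (hV j).orth _ (fderiv_tensorPoly_mem hW.mem j), h2,
      add_zero]
  have h0 := hj 0
  have h1 := hj 1
  have e : ∀ i, ∫ z, inner ℝ (dV z) (K.normal i) * dW z ∂(K.wmeas a (K.faceMeasure i)) =
      K.normal i 0 * ∫ z, dV z 0 * dW z ∂(K.wmeas a (K.faceMeasure i)) +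
      K.normal i 1 * ∫ z, dV z 1 * dW z ∂(K.wmeas a (K.faceMeasure i)) := by
    intro i
    rw [← integral_const_mul, ← integral_const_mul, ← integral_add]
    · congr 1
      funext z
      rw [plane_inner]; ring
    · exact (integrable_mul_of_memLp (K.memLp_face ha i (hV 0).mem)
        (K.memLp_face ha i hW.mem)).const_mul _
    · exact (integrable_mul_of_memLp (K.memLp_face ha i (hV 1).mem)
        (K.memLp_face ha i hW.mem)).const_mul _
  simp only [e, Finset.sum_add_distrib, h0, h1, add_zero]

section Energy

variable {b : Fin 3 → SpaceTime → ℝ} {dV : SpaceTime → Plane} {dW : SpaceTime → ℝ}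

/-- The energy identity, obtained by testing the face equations with `dW`. -/
lemma IsErrorPair.energy (ha : 0 < a) (hτ : K.IsStab τ Cmin Cmax)
    (h : K.IsErrorPair p a τ b dV dW) :
    ∑ i, ∫ z, τ z * dW z * dW z ∂(K.wmeas a (K.faceMeasure i)) =
      -∑ i, ∫ z, b i z * dW z ∂(K.wmeas a (K.faceMeasure i)) := by
  have h0 := sum_integral_normal_mul ha h.topV h.topW
  have h1 : ∀ i, ∫ z, b i z * dW z ∂(K.wmeas a (K.faceMeasure i)) =
      ∫ z, inner ℝ (dV z) (K.normal i) * dW z ∂(K.wmeas a (K.faceMeasure i)) -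
      ∫ z, τ z * dW z * dW z ∂(K.wmeas a (K.faceMeasure i)) := by
    intro i
    have hw := K.memLp_face ha i h.topW.mem
    rw [← h.face i dW h.topW.mem, ← integral_sub]
    · simp only [sub_mul]
    · exact integrable_mul_of_memLp
        (K.memLp_face ha i (isTop_inner ha h.topV (K.normal i)).mem) hw
    · exact integrable_mul_of_memLp (hτ.memLp_mul hw) hw
  simp only [h1, Finset.sum_sub_distrib, h0]
  ring

lemma IsStab.mul_sq_le (ha : 0 < a) (hτ : K.IsStab τ Cmin Cmax) (i : Fin 3)
    {w : SpaceTime → ℝ} (hw : w ∈ spaceW p) {t : ℝ}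
    (ht : ∀ᵐ z ∂(K.wmeas a (K.faceMeasure i)), t ≤ τ z) :
    t * l2norm (K.wmeas a (K.faceMeasure i)) w ^ 2 ≤
      ∫ z, τ z * w z * w z ∂(K.wmeas a (K.faceMeasure i)) := by
  have hw' := K.memLp_face ha i hw
  rw [sq_l2norm_real, ← integral_const_mul]
  refine integral_mono_ae (hw'.integrable_sq.const_mul _)
    (integrable_mul_of_memLp (hτ.memLp_mul hw') hw') ?_
  filter_upwards [ht] with z hz
  have := mul_le_mul_of_nonneg_right hz (sq_nonneg (w z))
  linarith

/-- The estimate obtained by testing the face equations with the normal component of `dV`. -/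
lemma IsErrorPair.l2norm_normal_le (ha : 0 < a) (hτ : K.IsStab τ Cmin Cmax)
    (h : K.IsErrorPair p a τ b dV dW) (i : Fin 3)
    (hb : MemLp (b i) 2 (K.wmeas a (K.faceMeasure i))) :
    l2norm (K.wmeas a (K.faceMeasure i)) (fun z => inner ℝ (dV z) (K.normal i)) ≤
      l2norm (K.wmeas a (K.faceMeasure i)) (fun z => τ z * dW z) +
      l2norm (K.wmeas a (K.faceMeasure i)) (b i) := by
  have ht := isTop_inner ha h.topV (K.normal i)
  have hn := K.memLp_face ha i ht.mem
  have hw := hτ.memLp_mul (K.memLp_face ha i h.topW.mem)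
  have h1 := h.face i _ ht.mem
  simp only [sub_mul] at h1
  rw [integral_sub (integrable_mul_of_memLp hn hn) (integrable_mul_of_memLp hw hn)] at h1
  have h2 := (le_abs_self _).trans (abs_integral_mul_le hb hn)
  have h3 := (le_abs_self _).trans (abs_integral_mul_le hw hn)
  have h4 := sq_l2norm_real (ν := K.wmeas a (K.faceMeasure i))
    (fun z => inner ℝ (dV z) (K.normal i))
  simp only [sq (inner ℝ _ _)] at h4
  set x := l2norm (K.wmeas a (K.faceMeasure i)) (fun z => inner ℝ (dV z) (K.normal i)) with hx
  have hx0 : 0 ≤ x := l2norm_nonneg _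
  rcases hx0.eq_or_lt with h0 | h0
  · rw [← h0]
    exact add_nonneg (l2norm_nonneg _) (l2norm_nonneg _)
  · refine le_of_mul_le_mul_right ?_ h0
    linarith [sq x]

end Energy

lemma sq_l2norm_side {g : SpaceTime → ℝ}
    (hg : ∀ i, MemLp g 2 (K.wmeas a (K.faceMeasure i))) :
    l2norm (K.wmeas a K.sideMeasure) g ^ 2 =
      ∑ i, l2norm (K.wmeas a (K.faceMeasure i)) g ^ 2 := by
  simp only [sq_l2norm_real]
  rw [wmeas_side, integral_finsetSum_measure fun i _ => (hg i).integrable_sq]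

lemma l2norm_face_le_side {g : SpaceTime → ℝ}
    (hg : ∀ i, MemLp g 2 (K.wmeas a (K.faceMeasure i))) (i : Fin 3) :
    l2norm (K.wmeas a (K.faceMeasure i)) g ≤ l2norm (K.wmeas a K.sideMeasure) g := by
  refine abs_le_of_sq_le_sq' ?_ (l2norm_nonneg _) |>.2
  rw [sq_l2norm_side hg]
  exact Finset.single_le_sum (f := fun i => l2norm (K.wmeas a (K.faceMeasure i)) g ^ 2)
    (fun _ _ => sq_nonneg _) (Finset.mem_univ i)

lemma l2norm_vec_sq {ν : Measure SpaceTime} {g : SpaceTime → Plane}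
    (hg : ∀ j, MemLp (fun z => g z j) 2 ν) :
    l2norm ν g ^ 2 = l2norm ν (fun z => g z 0) ^ 2 + l2norm ν (fun z => g z 1) ^ 2 := by
  rw [sq_l2norm, sq_l2norm_real, sq_l2norm_real,
    ← integral_add (hg 0).integrable_sq (hg 1).integrable_sq]
  simp only [plane_norm_sq]

/-- On shape regular elements a top order field is controlled by its normal components. -/
lemma l2norm_vec_vol_le (p : ℕ) (c : ℝ) : ∃ C : ℝ, 0 < C ∧
    ∀ (K : Prism) (a : ℝ), 0 < a → K.h / K.rho ≤ c → ∀ dV : SpaceTime → Plane,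
      (∀ j, K.IsTop p a (fun z => dV z j)) →
      l2norm (K.wmeas a K.vol) dV ≤ C * √K.h *
        ∑ i, l2norm (K.wmeas a (K.faceMeasure i)) (fun z => inner ℝ (dV z) (K.normal i)) := by
  obtain ⟨C, hC, hb⟩ := l2norm_vol_le_face p
  -- the summand `1` only makes the constant positive
  refine ⟨(4 * c ^ 2 + 1) * C, by positivity, fun K a ha hc dV hV => ?_⟩
  have ht := fun i => isTop_inner ha hV (K.normal i)
  have hL := fun i => K.memLp_vol ha (ht i).mem
  have hL' : ∀ i, MemLp (fun z => |inner ℝ (dV z) (K.normal i)|) 2 (K.wmeas a K.vol) :=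
    fun i => (hL i).norm
  have hsum : MemLp (fun z => ∑ i, |inner ℝ (dV z) (K.normal i)|) 2 (K.wmeas a K.vol) :=
    memLp_finsetSum _ fun i _ => hL' i
  have h1 : l2norm (K.wmeas a K.vol) dV ≤ (4 * c ^ 2) *
      l2norm (K.wmeas a K.vol) (fun z => ∑ i, |inner ℝ (dV z) (K.normal i)|) := by
    refine l2norm_mono hsum (by positivity) (ae_of_all _ fun z => ?_)
    rw [Real.norm_eq_abs, abs_of_nonneg (Finset.sum_nonneg fun _ _ => abs_nonneg _)]
    exact K.norm_le_sum_inner_normal hc (dV z)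
  have h2 : l2norm (K.wmeas a K.vol) (fun z => ∑ i, |inner ℝ (dV z) (K.normal i)|) ≤
      ∑ i, l2norm (K.wmeas a K.vol) (fun z => inner ℝ (dV z) (K.normal i)) := by
    simp only [Fin.sum_univ_three]
    have e : ∀ i, l2norm (K.wmeas a K.vol) (fun z => |inner ℝ (dV z) (K.normal i)|) =
        l2norm (K.wmeas a K.vol) (fun z => inner ℝ (dV z) (K.normal i)) := fun i =>
      l2norm_congr_norm (by simp)
    have h01 : MemLp (fun z => |inner ℝ (dV z) (K.normal 0)| + |inner ℝ (dV z) (K.normal 1)|) 2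
      (K.wmeas a K.vol) := (hL' 0).add (hL' 1)
    have s1 := l2norm_add_le h01 (hL' 2)
    have s2 := l2norm_add_le (hL' 0) (hL' 1)
    rw [e] at s1
    rw [e, e] at s2
    linarith
  have h3 : ∑ i, l2norm (K.wmeas a K.vol) (fun z => inner ℝ (dV z) (K.normal i)) ≤
      C * √K.h * ∑ i, l2norm (K.wmeas a (K.faceMeasure i))
        (fun z => inner ℝ (dV z) (K.normal i)) := by
    rw [Finset.mul_sum]
    exact Finset.sum_le_sum fun i _ => hb K a i _ (ht i)
  have h4 : 0 ≤ ∑ i, l2norm (K.wmeas a K.vol) (fun z => inner ℝ (dV z) (K.normal i)) :=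
    Finset.sum_nonneg fun _ _ => l2norm_nonneg _
  have h5 : (4 * c ^ 2) * ∑ i, l2norm (K.wmeas a K.vol) (fun z => inner ℝ (dV z) (K.normal i)) ≤
      (4 * c ^ 2 + 1) * ∑ i, l2norm (K.wmeas a K.vol) (fun z => inner ℝ (dV z) (K.normal i)) := by
    linarith
  have h6 := mul_le_mul_of_nonneg_left h2 (show 0 ≤ 4 * c ^ 2 by positivity)
  have h7 := mul_le_mul_of_nonneg_left h3 (show 0 ≤ 4 * c ^ 2 + 1 by positivity)
  linarith

/-- The homogeneous error equations have only the zero solution. -/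
theorem IsErrorPair.eq_zero (ha : 0 < a) (hτ : K.IsStab τ Cmin Cmax) {dV : SpaceTime → Plane}
    {dW : SpaceTime → ℝ} (h : K.IsErrorPair p a τ (fun _ _ => 0) dV dW) : dV = 0 ∧ dW = 0 := by
  have hface : l2norm (K.wmeas a (K.faceMeasure 0)) dW = 0 := by
    have h1 := h.energy ha hτ
    simp only [zero_mul, integral_zero, Finset.sum_const_zero, neg_zero] at h1
    have h2 : ∀ i, Cmin * l2norm (K.wmeas a (K.faceMeasure i)) dW ^ 2 ≤
        ∫ z, τ z * dW z * dW z ∂(K.wmeas a (K.faceMeasure i)) := fun i =>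
      hτ.mul_sq_le ha i h.topW.mem ((hτ.bound_face a i).mono fun _ hz => hz.1)
    rw [Fin.sum_univ_three] at h1
    have p1 := mul_nonneg hτ.pos.le (sq_nonneg (l2norm (K.wmeas a (K.faceMeasure 1)) dW))
    have p2 := mul_nonneg hτ.pos.le (sq_nonneg (l2norm (K.wmeas a (K.faceMeasure 2)) dW))
    have h3 : Cmin * l2norm (K.wmeas a (K.faceMeasure 0)) dW ^ 2 ≤ 0 := by
      linarith [h2 0, h2 1, h2 2]
    have h4 : l2norm (K.wmeas a (K.faceMeasure 0)) dW ^ 2 ≤ 0 :=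
      nonpos_of_mul_nonpos_right h3 hτ.pos
    exact sq_eq_zero_iff.1 (le_antisymm h4 (sq_nonneg _))
  have hW : dW = 0 := by
    obtain ⟨C, hC, hb⟩ := l2norm_vol_le_face p
    have h1 := hb K a 0 dW h.topW
    rw [hface, mul_zero] at h1
    exact K.eq_zero_of_l2norm_vol_eq_zero ha h.topW.mem (le_antisymm h1 (l2norm_nonneg _))
  refine ⟨?_, hW⟩
  have hn : ∀ i, l2norm (K.wmeas a (K.faceMeasure i)) (fun z => inner ℝ (dV z) (K.normal i)) = 0 := by
    intro i
    have h1 := h.l2norm_normal_le ha hτ i MemLp.zero'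
    have e1 : l2norm (K.wmeas a (K.faceMeasure i)) (fun z => τ z * dW z) = 0 := by
      simp [hW, l2norm]
    have e2 : l2norm (K.wmeas a (K.faceMeasure i)) (fun _ => (0 : ℝ)) = 0 := by simp [l2norm]
    rw [e1, e2, add_zero] at h1
    exact le_antisymm h1 (l2norm_nonneg _)
  obtain ⟨C, hC, hb⟩ := l2norm_vec_vol_le p (K.h / K.rho)
  have h1 := hb K a ha le_rfl dV h.topV
  simp only [hn, Finset.sum_const_zero, mul_zero] at h1
  have h2 := l2norm_vec_sq fun j => K.memLp_vol ha (h.topV j).mem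
  rw [le_antisymm h1 (l2norm_nonneg _)] at h2
  have z0 : l2norm (K.wmeas a K.vol) (fun z => dV z 0) = 0 :=
    sq_eq_zero_iff.1 (by
      linarith [sq_nonneg (l2norm (K.wmeas a K.vol) (fun z => dV z 0)),
        sq_nonneg (l2norm (K.wmeas a K.vol) (fun z => dV z 1))])
  have z1 : l2norm (K.wmeas a K.vol) (fun z => dV z 1) = 0 :=
    sq_eq_zero_iff.1 (by
      linarith [sq_nonneg (l2norm (K.wmeas a K.vol) (fun z => dV z 0)),
        sq_nonneg (l2norm (K.wmeas a K.vol) (fun z => dV z 1))])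
  have w0 := K.eq_zero_of_l2norm_vol_eq_zero ha (h.topV 0).mem z0
  have w1 := K.eq_zero_of_l2norm_vol_eq_zero ha (h.topV 1).mem z1
  funext z
  ext j
  fin_cases j
  · exact congrFun w0 z
  · exact congrFun w1 z

end Prism

namespace Prism

variable {K : Prism} {p r m : ℕ} {a c Cmin Cmax : ℝ} {τ : SpaceTime → ℝ}

/-! ### The projection equations in components -/

lemma integral_weight_mul (K : Prism) (a : ℝ) (μ : Measure SpaceTime) (g : SpaceTime → ℝ) :
    ∫ z, K.weight a z.1 * g z ∂μ = ∫ z, g z ∂(K.wmeas a μ) := (K.integral_wmeas a μ g).symm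

lemma single_mem_vecSpace {S : Submodule ℝ (SpaceTime → ℝ)} {z : SpaceTime → ℝ} (hz : z ∈ S)
    (j : Fin 2) : (fun x => EuclideanSpace.single j (z x)) ∈ vecSpace S := by
  intro i
  by_cases h : i = j
  · subst h; simpa using hz
  · simp only [PiLp.single_apply, if_neg h]
    exact zero_mem S

lemma spaceWt_le_spaceW (p : ℕ) : spaceWt p ≤ spaceW p := monoSpan_mono (Nat.le_succ p)

/-- Testing with vector fields amounts to testing the components. -/
lemma integral_inner_eq_iff {S : Submodule ℝ (SpaceTime → ℝ)} {ν : Measure SpaceTime}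
    (hS : ∀ z ∈ S, MemLp z 2 ν) {f g : SpaceTime → Plane} (hf : ∀ j, MemLp (fun z => f z j) 2 ν)
    (hg : ∀ j, MemLp (fun z => g z j) 2 ν) :
    (∀ s ∈ vecSpace S, ∫ z, inner ℝ (f z) (s z) ∂ν = ∫ z, inner ℝ (g z) (s z) ∂ν) ↔
      ∀ j, ∀ w ∈ S, ∫ z, f z j * w z ∂ν = ∫ z, g z j * w z ∂ν := by
  constructor
  · intro h j w hw
    have := h _ (single_mem_vecSpace hw j)
    simpa [EuclideanSpace.inner_single_right, mul_comm] using this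
  · intro h s hs
    simp only [plane_inner]
    rw [integral_add (integrable_mul_of_memLp (hf 0) (hS _ (hs 0)))
      (integrable_mul_of_memLp (hf 1) (hS _ (hs 1))),
      integral_add (integrable_mul_of_memLp (hg 0) (hS _ (hs 0)))
      (integrable_mul_of_memLp (hg 1) (hS _ (hs 1))), h 0 _ (hs 0), h 1 _ (hs 1)]

/-- The projection equations in terms of components and weighted measures. -/
lemma isHDGProj_iff (ha : 0 < a) {q γq : SpaceTime → Plane} {v γv : SpaceTime → ℝ}
    {PV : SpaceTime → Plane} {PW : SpaceTime → ℝ} (hq : ∀ j, MemLp (fun z => q z j) 2 K.vol) :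
    K.IsHDGProj p a τ q γq v γv PV PW ↔
      (∀ j, (fun z => PV z j) ∈ spaceW p) ∧ PW ∈ spaceW p ∧
      (∀ j, ∀ w ∈ spaceWt p, ∫ z, PV z j * w z ∂(K.wmeas a K.vol) =
        ∫ z, q z j * w z ∂(K.wmeas a K.vol)) ∧
      (∀ w ∈ spaceWt p, ∫ z, PW z * w z ∂(K.wmeas a K.vol) =
        ∫ z, v z * w z ∂(K.wmeas a K.vol)) ∧
      ∀ i, ∀ σ ∈ K.spaceM p i,
        ∫ z, (inner ℝ (PV z) (K.normal i) - τ z * PW z) * σ z ∂(K.wmeas a (K.faceMeasure i)) =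
        ∫ z, (inner ℝ (γq z) (K.normal i) - τ z * γv z) * σ z
          ∂(K.wmeas a (K.faceMeasure i)) := by
  simp only [IsHDGProj, integral_weight_mul]
  refine and_congr_right fun hV => and_congr_right fun hW => and_congr_left fun _ => ?_
  exact integral_inner_eq_iff (fun z hz => K.memLp_vol ha hz) (fun j => K.memLp_vol ha (hV j))
    fun j => K.memLp_wmeas ha K.ae_vol_mem (hq j)

/-! ### Existence and uniqueness of the projection -/

/-- The difference of two solutions of the projection equations solves the error equations. -/
lemma isErrorPair_sub (ha : 0 < a) (hτ : K.IsStab τ Cmin Cmax)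
    {PV PV' : SpaceTime → Plane} {PW PW' : SpaceTime → ℝ} {b : Fin 3 → SpaceTime → ℝ}
    (hV : ∀ j, (fun z => PV z j) ∈ spaceW p) (hV' : ∀ j, (fun z => PV' z j) ∈ spaceW p)
    (hW : PW ∈ spaceW p) (hW' : PW' ∈ spaceW p)
    (oV : ∀ j, ∀ w ∈ spaceWt p, ∫ z, PV z j * w z ∂(K.wmeas a K.vol) =
      ∫ z, PV' z j * w z ∂(K.wmeas a K.vol))
    (oW : ∀ w ∈ spaceWt p, ∫ z, PW z * w z ∂(K.wmeas a K.vol) =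
      ∫ z, PW' z * w z ∂(K.wmeas a K.vol))
    (hf : ∀ i, ∀ σ ∈ spaceW p,
      ∫ z, (inner ℝ (PV z) (K.normal i) - τ z * PW z) * σ z ∂(K.wmeas a (K.faceMeasure i)) =
      ∫ z, (inner ℝ (PV' z) (K.normal i) - τ z * PW' z) * σ z ∂(K.wmeas a (K.faceMeasure i)) +
      ∫ z, b i z * σ z ∂(K.wmeas a (K.faceMeasure i))) :
    K.IsErrorPair p a τ b (fun z => PV z - PV' z) (fun z => PW z - PW' z) where
  topV j := by
    refine ⟨sub_mem (hV j) (hV' j), fun z hz => ?_⟩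
    have h1 := integrable_mul_of_memLp (K.memLp_vol ha (hV j)) (K.memLp_vol ha hz)
    have h2 := integrable_mul_of_memLp (K.memLp_vol ha (hV' j)) (K.memLp_vol ha hz)
    simp only [PiLp.sub_apply, sub_mul]
    rw [integral_sub h1 h2, oV j z hz, sub_self]
  topW := by
    refine ⟨sub_mem hW hW', fun z hz => ?_⟩
    have h1 := integrable_mul_of_memLp (K.memLp_vol ha hW) (K.memLp_vol ha hz)
    have h2 := integrable_mul_of_memLp (K.memLp_vol ha hW') (K.memLp_vol ha hz)
    simp only [sub_mul]
    rw [integral_sub h1 h2, oW z hz, sub_self]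
  face i σ hσ := by
    have hs := K.memLp_face ha i hσ
    have hn : ∀ {P : SpaceTime → Plane} {Q : SpaceTime → ℝ},
        (∀ j, (fun z => P z j) ∈ spaceW p) → Q ∈ spaceW p →
        MemLp (fun z => inner ℝ (P z) (K.normal i) - τ z * Q z) 2
          (K.wmeas a (K.faceMeasure i)) := by
      intro P Q hP hQ
      simp only [plane_inner]
      exact (((K.memLp_face ha i (hP 0)).mul_const _).add
        ((K.memLp_face ha i (hP 1)).mul_const _)).sub (hτ.memLp_mul (K.memLp_face ha i hQ))
    have h1 := integrable_mul_of_memLp (hn hV hW) hs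
    have h2 := integrable_mul_of_memLp (hn hV' hW') hs
    have e1 : ∀ z, (inner ℝ (PV z - PV' z) (K.normal i) - τ z * (PW z - PW' z)) * σ z =
        (inner ℝ (PV z) (K.normal i) - τ z * PW z) * σ z -
        (inner ℝ (PV' z) (K.normal i) - τ z * PW' z) * σ z := by
      intro z; rw [inner_sub_left]; ring
    simp only [e1]
    rw [integral_sub h1 h2, hf i σ hσ, add_sub_cancel_left]

/-- The coordinates of the projection of a point to the `i`-th face along a side; a continuous left
inverse of the parametrization of the face. -/
noncomputable def faceCoord (K : Prism) (i : Fin 3) (z : SpaceTime) : ℝ × ℝ :=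
  (z.1, ((K.refMap i).symm z.2).1)

lemma continuous_faceCoord (K : Prism) (i : Fin 3) : Continuous (K.faceCoord i) := by
  have := (K.refMap i).symm.continuous
  unfold faceCoord
  fun_prop

lemma faceCoord_faceParam (K : Prism) (i : Fin 3) (y : ℝ × ℝ) :
    K.faceCoord i (K.faceParam i y) = y := by
  rw [faceParam_eq, prismMap_apply, faceCoord]
  simp

/-- A test function on a face enters only through its values on the face, and may be replaced by one
that depends on the face coordinates alone. -/
lemma integral_mul_faceCoord (K : Prism) (a : ℝ) (i : Fin 3) (f σ : SpaceTime → ℝ) :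
    ∫ z, f z * σ z ∂(K.wmeas a (K.faceMeasure i)) =
      ∫ z, f z * σ (K.faceParam i (K.faceCoord i z)) ∂(K.wmeas a (K.faceMeasure i)) := by
  rw [integral_face, integral_face]
  simp only [faceCoord_faceParam]

/-- The unknowns of the projection. -/
abbrev Unknown (p : ℕ) : Type := (Fin 2 → spaceW p) × spaceW p

/-- The functionals on the test functions of the projection. -/
abbrev TestDual (p : ℕ) : Type :=
  (Fin 2 → Module.Dual ℝ (spaceWt p)) × Module.Dual ℝ (spaceWt p) ×
    (Fin 3 → Module.Dual ℝ (tensorQ p))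

/-- There are at most as many equations as unknowns: going from degree `p - 1` to `p` in space gains
`p + 1` monomials for each of the three components, as many as there are on each of the three
edges. -/
lemma finrank_testDual_le (p : ℕ) :
    Module.finrank ℝ (TestDual p) ≤ Module.finrank ℝ (Unknown p) := by
  have h1 : Module.finrank ℝ (spaceW p) = (expo (p + 1)).card * (p + 1) := finrank_tensorPoly
  have h2 : Module.finrank ℝ (spaceWt p) = (expo p).card * (p + 1) := finrank_tensorPoly
  have h3 := finrank_tensorQ_le p
  rw [Module.finrank_prod, Module.finrank_prod, Module.finrank_prod, Module.finrank_pi_fintype,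
    Module.finrank_pi_fintype, Module.finrank_pi_fintype]
  simp only [Subspace.dual_finrank_eq, Finset.sum_const, Finset.card_univ, Fintype.card_fin,
    smul_eq_mul, h1, h2, card_expo_succ]
  nlinarith

/-- The face expression `PV · n - τ PW` as a linear function of the unknowns. -/
noncomputable def faceOp (K : Prism) (p : ℕ) (τ : SpaceTime → ℝ) (i : Fin 3) :
    Unknown p →ₗ[ℝ] (SpaceTime → ℝ) where
  toFun u z := ((u.1 0 : SpaceTime → ℝ) z * K.normal i 0 + (u.1 1 : SpaceTime → ℝ) z * K.normal i 1)
    - τ z * (u.2 : SpaceTime → ℝ) z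
  map_add' u w := by funext z; simp; ring
  map_smul' b u := by funext z; simp; ring

/-- The pairing of square integrable functions with the elements of a space of test functions. -/
noncomputable def testAgainst {X V : Type*} [MeasurableSpace X] {ν : Measure X} [AddCommGroup V]
    [Module ℝ V] (T : V →ₗ[ℝ] (X → ℝ)) (h : ∀ u, MemLp (T u) 2 ν) :
    Lp ℝ 2 ν →ₗ[ℝ] Module.Dual ℝ V :=
  LinearMap.lcomp ℝ ℝ (toL2 T h) ∘ₗ innerₗ (Lp ℝ 2 ν)

lemma testAgainst_apply {X V : Type*} [MeasurableSpace X] {ν : Measure X} [AddCommGroup V]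
    [Module ℝ V] (T : V →ₗ[ℝ] (X → ℝ)) (h : ∀ u, MemLp (T u) 2 ν) {f : X → ℝ}
    (hf : MemLp f 2 ν) (u : V) : testAgainst T h (hf.toLp f) u = ∫ x, f x * T u x ∂ν :=
  inner_toLp hf (h u)

/-- The projection equations are uniquely solvable: the system is square by a dimension count, and
its homogeneous version has only the zero solution. -/
theorem existsUnique_isHDGProj (ha : 0 < a) (hτ : K.IsStab τ Cmin Cmax)
    {q γq : SpaceTime → Plane} {v γv : SpaceTime → ℝ} (hq : ∀ j, MemLp (fun z => q z j) 2 K.vol)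
    (hv : MemLp v 2 K.vol) (hγq : ∀ i j, MemLp (fun z => γq z j) 2 (K.wmeas a (K.faceMeasure i)))
    (hγv : ∀ i, MemLp γv 2 (K.wmeas a (K.faceMeasure i))) :
    ∃! P : (SpaceTime → Plane) × (SpaceTime → ℝ), K.IsHDGProj p a τ q γq v γv P.1 P.2 := by
  have hb : ∀ i, MemLp (fun z => inner ℝ (γq z) (K.normal i) - τ z * γv z) 2
      (K.wmeas a (K.faceMeasure i)) := by
    intro i
    simp only [plane_inner]
    exact (((hγq i 0).mul_const _).add ((hγq i 1).mul_const _)).sub (hτ.memLp_mul (hγv i))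
  have hfin : ∀ i, IsFiniteMeasure (K.wmeas a (K.faceMeasure i)) := fun i =>
    K.isFiniteMeasure_wmeas ha (K.ae_face_mem i)
  have hWt : ∀ w : spaceWt p, MemLp ((spaceWt p).subtype w) 2 (K.wmeas a K.vol) :=
    fun w => K.memLp_vol ha w.2
  have hWW : ∀ w : spaceW p, MemLp ((spaceW p).subtype w) 2 (K.wmeas a K.vol) :=
    fun w => K.memLp_vol ha w.2
  let ext : ∀ i : Fin 3, tensorQ p →ₗ[ℝ] (SpaceTime → ℝ) := fun i =>
    LinearMap.funLeft ℝ ℝ (K.faceCoord i) ∘ₗ (tensorQ p).subtype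
  have hext : ∀ i σ, MemLp (ext i σ) 2 (K.wmeas a (K.faceMeasure i)) := fun i σ =>
    K.memLp_of_continuous ((K.wmeas_ac a _).ae_le (K.ae_face_mem i))
      ((continuous_tensorQ σ.2).comp (K.continuous_faceCoord i))
  have hextv : ∀ i σ z, ext i σ z = (σ : ℝ × ℝ → ℝ) (K.faceCoord i z) := fun _ _ _ => rfl
  have hop : ∀ i u, MemLp (K.faceOp p τ i u) 2 (K.wmeas a (K.faceMeasure i)) := fun i u =>
    (((K.memLp_face ha i (u.1 0).2).mul_const _).add
      ((K.memLp_face ha i (u.1 1).2).mul_const _)).sub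
      (hτ.memLp_mul (K.memLp_face ha i u.2.2))
  -- the left-hand sides of the projection equations, as a linear map
  let Λ : Unknown p →ₗ[ℝ] TestDual p := LinearMap.prod
    (LinearMap.pi fun j => testAgainst (spaceWt p).subtype hWt ∘ₗ toL2 (spaceW p).subtype hWW ∘ₗ
      LinearMap.proj j ∘ₗ LinearMap.fst ℝ _ _)
    (LinearMap.prod
      (testAgainst (spaceWt p).subtype hWt ∘ₗ toL2 (spaceW p).subtype hWW ∘ₗ
        LinearMap.snd ℝ _ _)
      (LinearMap.pi fun i => testAgainst (ext i) (hext i) ∘ₗ toL2 (K.faceOp p τ i) (hop i)))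
  have hΛ1 : ∀ u j w, (Λ u).1 j w =
      ∫ z, (u.1 j : SpaceTime → ℝ) z * (w : SpaceTime → ℝ) z ∂(K.wmeas a K.vol) :=
    fun u j w => testAgainst_apply _ hWt (hWW (u.1 j)) w
  have hΛ2 : ∀ u w, (Λ u).2.1 w =
      ∫ z, (u.2 : SpaceTime → ℝ) z * (w : SpaceTime → ℝ) z ∂(K.wmeas a K.vol) :=
    fun u w => testAgainst_apply _ hWt (hWW u.2) w
  have hΛ3 : ∀ u i σ, (Λ u).2.2 i σ =
      ∫ z, K.faceOp p τ i u z * ext i σ z ∂(K.wmeas a (K.faceMeasure i)) :=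
    fun u i σ => testAgainst_apply _ (hext i) (hop i u) σ
  -- the vector field that belongs to the unknowns
  let fld : Unknown p → SpaceTime → Plane := fun u z =>
    !₂[(u.1 0 : SpaceTime → ℝ) z, (u.1 1 : SpaceTime → ℝ) z]
  have hfld : ∀ u (j : Fin 2), (fun z => fld u z j) = (u.1 j : SpaceTime → ℝ) := by
    intro u j; funext z; fin_cases j <;> rfl
  have hfop : ∀ u i z, K.faceOp p τ i u z =
      inner ℝ (fld u z) (K.normal i) - τ z * (u.2 : SpaceTime → ℝ) z := by
    intro u i z; rw [plane_inner]; rfl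
  have hface : ∀ u i (b : SpaceTime → ℝ),
      (∀ σ, (Λ u).2.2 i σ = ∫ z, b z * ext i σ z ∂(K.wmeas a (K.faceMeasure i))) →
      ∀ σ ∈ K.spaceM p i,
      ∫ z, (inner ℝ (fld u z) (K.normal i) - τ z * (u.2 : SpaceTime → ℝ) z) * σ z
        ∂(K.wmeas a (K.faceMeasure i)) = ∫ z, b z * σ z ∂(K.wmeas a (K.faceMeasure i)) := by
    intro u i b h σ hσ
    have := h ⟨_, hσ⟩
    rw [hΛ3] at this
    simp only [hfop, hextv] at this
    rw [integral_mul_faceCoord, this, ← integral_mul_faceCoord K a i b σ]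
  have hker : LinearMap.ker Λ = ⊥ := by
    rw [LinearMap.ker_eq_bot']
    intro u hu
    have hpair : K.IsErrorPair p a τ (fun _ _ => 0) (fld u) u.2 := by
      refine ⟨fun j => ?_, ⟨u.2.2, fun w hw => ?_⟩, fun i σ hσ => ?_⟩
      · rw [hfld u j]
        refine ⟨(u.1 j).2, fun w hw => ?_⟩
        rw [← hΛ1 u j ⟨w, hw⟩, hu]; rfl
      · rw [← hΛ2 u ⟨w, hw⟩, hu]; rfl
      · exact hface u i (fun _ => 0) (fun σ => by rw [hu]; simp) σ (K.comp_faceParam_mem hσ i)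
    obtain ⟨h1, h2⟩ := hpair.eq_zero ha hτ
    refine Prod.ext (funext fun j => Subtype.ext ?_) (Subtype.ext h2)
    rw [← hfld u j, h1]
    rfl
  have hsurj : Function.Surjective Λ := by
    rw [← LinearMap.range_eq_top]
    refine Submodule.eq_top_of_finrank_eq (le_antisymm (Submodule.finrank_le _) ?_)
    rw [LinearMap.finrank_range_of_inj (LinearMap.ker_eq_bot.1 hker)]
    exact finrank_testDual_le p
  have hqw : ∀ j, MemLp (fun z => q z j) 2 (K.wmeas a K.vol) := fun j =>
    K.memLp_wmeas ha K.ae_vol_mem (hq j)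
  have hvw : MemLp v 2 (K.wmeas a K.vol) := K.memLp_wmeas ha K.ae_vol_mem hv
  obtain ⟨u, hu⟩ := hsurj
    (fun j => testAgainst (spaceWt p).subtype hWt ((hqw j).toLp _),
      testAgainst (spaceWt p).subtype hWt (hvw.toLp _),
      fun i => testAgainst (ext i) (hext i) ((hb i).toLp _))
  refine existsUnique_of_exists_of_unique ⟨(fld u, u.2), (isHDGProj_iff ha hq).2 ⟨fun j => ?_,
    u.2.2, fun j w hw => ?_, fun w hw => ?_, fun i => hface u i _ fun σ => ?_⟩⟩ ?_
  · change (fun z => fld u z j) ∈ _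
    rw [hfld u j]; exact (u.1 j).2
  · have h1 := hΛ1 u j ⟨w, hw⟩
    rw [hu] at h1
    have h2 : ∫ z, fld u z j * w z ∂(K.wmeas a K.vol) =
        ∫ z, (u.1 j : SpaceTime → ℝ) z * w z ∂(K.wmeas a K.vol) := by
      congr 1
      funext z
      rw [← congrFun (hfld u j) z]
    exact h2.trans (h1.symm.trans (testAgainst_apply _ hWt (hqw j) ⟨w, hw⟩))
  · have h1 := hΛ2 u ⟨w, hw⟩
    rw [hu] at h1
    exact h1.symm.trans (testAgainst_apply _ hWt hvw ⟨w, hw⟩)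
  · rw [hu]
    exact testAgainst_apply _ (hext i) (hb i) σ
  · rintro ⟨PV, PW⟩ ⟨PV', PW'⟩ h h'
    obtain ⟨m1, m2, o1, o2, f1⟩ := (isHDGProj_iff ha hq).1 h
    obtain ⟨m1', m2', o1', o2', f1'⟩ := (isHDGProj_iff ha hq).1 h'
    have hpair : K.IsErrorPair p a τ (fun _ _ => 0) (fun z => PV z - PV' z)
        (fun z => PW z - PW' z) := by
      refine isErrorPair_sub ha hτ m1 m1' m2 m2' (fun j w hw => by rw [o1 j w hw, o1' j w hw])
        (fun w hw => by rw [o2 w hw, o2' w hw]) fun i σ hσ => ?_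
      have hσ' := K.comp_faceParam_mem hσ i
      rw [f1 i σ hσ', f1' i σ hσ']
      simp
    obtain ⟨h1, h2⟩ := hpair.eq_zero ha hτ
    exact Prod.ext (funext fun z => sub_eq_zero.1 (congrFun h1 z))
      (funext fun z => sub_eq_zero.1 (congrFun h2 z))

end Prism

namespace Prism

variable {K : Prism} {p r m : ℕ} {a c Cmin Cmax : ℝ} {τ : SpaceTime → ℝ}

/-! ### Estimates for the error equations -/

section Estimates

variable {b : Fin 3 → SpaceTime → ℝ} {dV : SpaceTime → Plane} {dW : SpaceTime → ℝ}

lemma mul_le_of_mul_sq_le {c x B : ℝ} (hx : 0 ≤ x) (hB : 0 ≤ B) (h : c * x ^ 2 ≤ B * x) :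
    c * x ≤ B := by
  rcases hx.eq_or_lt with h0 | h0
  · rw [← h0, mul_zero]; exact hB
  · exact le_of_mul_le_mul_right (by linarith [sq x]) h0

/-- The energy identity bounds `dW` on the lateral boundary by the right-hand side. -/
lemma IsErrorPair.mul_l2norm_side_le (ha : 0 < a) (hτ : K.IsStab τ Cmin Cmax)
    (h : K.IsErrorPair p a τ b dV dW) {B : ℝ} (hB : 0 ≤ B)
    (hb : -∑ i, ∫ z, b i z * dW z ∂(K.wmeas a (K.faceMeasure i)) ≤
      B * l2norm (K.wmeas a K.sideMeasure) dW) :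
    Cmin * l2norm (K.wmeas a K.sideMeasure) dW ≤ B := by
  refine mul_le_of_mul_sq_le (l2norm_nonneg _) hB (le_trans ?_ hb)
  rw [← h.energy ha hτ, sq_l2norm_side fun i => K.memLp_face ha i h.topW.mem, Finset.mul_sum]
  exact Finset.sum_le_sum fun i _ =>
    hτ.mul_sq_le ha i h.topW.mem ((hτ.bound_face a i).mono fun _ hz => hz.1)

/-- The bound for `dW` on the element, if the data on the faces are `f i - τ g` and the functional
`∑ i ∫ f i ·` is represented by the function `R` on the element. -/
theorem exists_l2norm_scalar_le (p : ℕ) : ∃ C : ℝ, 0 < C ∧ ∀ (K : Prism) (a : ℝ), 0 < a →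
    ∀ (Cmin Cmax : ℝ) (τ : SpaceTime → ℝ), K.IsStab τ Cmin Cmax →
    ∀ (f : Fin 3 → SpaceTime → ℝ) (g R : SpaceTime → ℝ) (dV : SpaceTime → Plane)
      (dW : SpaceTime → ℝ), K.IsErrorPair p a τ (fun i z => f i z - τ z * g z) dV dW →
      (∀ i, MemLp (f i) 2 (K.wmeas a (K.faceMeasure i))) →
      (∀ i, MemLp g 2 (K.wmeas a (K.faceMeasure i))) → MemLp R 2 (K.wmeas a K.vol) →
      ∑ i, ∫ z, f i z * dW z ∂(K.wmeas a (K.faceMeasure i)) =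
        ∫ z, R z * dW z ∂(K.wmeas a K.vol) →
      l2norm (K.wmeas a K.vol) dW ≤ C * (Cmax / Cmin) * √K.h * l2norm (K.wmeas a K.sideMeasure) g +
        C / Cmin * K.h * l2norm (K.wmeas a K.vol) R := by
  obtain ⟨C, hC, hb⟩ := l2norm_vol_le_face p
  refine ⟨3 * C + C ^ 2, by positivity, fun K a ha Cmin Cmax τ hτ f g R dV dW h hf hg hR hdiv => ?_⟩
  have hd : ∀ i, MemLp dW 2 (K.wmeas a (K.faceMeasure i)) := fun i => K.memLp_face ha i h.topW.mem
  have hpos := hτ.pos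
  have hmax : 0 < Cmax := hpos.trans_le hτ.le
  have hh := K.h_pos
  set X := l2norm (K.wmeas a K.sideMeasure) dW with hX
  set G := l2norm (K.wmeas a K.sideMeasure) g with hG
  set M := l2norm (K.wmeas a K.vol) R with hM
  have hX0 : 0 ≤ X := l2norm_nonneg _
  have hG0 : 0 ≤ G := l2norm_nonneg _
  have hM0 : 0 ≤ M := l2norm_nonneg _
  have hvol : l2norm (K.wmeas a K.vol) dW ≤ C * √K.h * X :=
    (hb K a 0 dW h.topW).trans (by gcongr; exact l2norm_face_le_side hd 0)
  have hτg : ∀ i, ∫ z, τ z * g z * dW z ∂(K.wmeas a (K.faceMeasure i)) ≤ Cmax * G * X := by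
    intro i
    refine ((le_abs_self _).trans (abs_integral_mul_le (hτ.memLp_mul (hg i)) (hd i))).trans ?_
    have h1 := l2norm_mono (hg i) hmax.le (hτ.norm_mul_le a i g)
    have h2 := l2norm_face_le_side hg i
    gcongr
    · exact l2norm_nonneg _
    · exact h1.trans (by gcongr)
    · exact l2norm_face_le_side hd i
  have hmain : Cmin * X ≤ 3 * Cmax * G + C * √K.h * M := by
    refine h.mul_l2norm_side_le ha hτ (by positivity) ?_
    have e : ∀ i, ∫ z, (f i z - τ z * g z) * dW z ∂(K.wmeas a (K.faceMeasure i)) =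
        ∫ z, f i z * dW z ∂(K.wmeas a (K.faceMeasure i)) -
        ∫ z, τ z * g z * dW z ∂(K.wmeas a (K.faceMeasure i)) := by
      intro i
      rw [← integral_sub (integrable_mul_of_memLp (hf i) (hd i))
        (integrable_mul_of_memLp (hτ.memLp_mul (hg i)) (hd i))]
      simp only [sub_mul]
    simp only [e, Finset.sum_sub_distrib, hdiv]
    have h1 : -∫ z, R z * dW z ∂(K.wmeas a K.vol) ≤ M * (C * √K.h * X) :=
      ((neg_le_abs _).trans (abs_integral_mul_le hR (K.memLp_vol ha h.topW.mem))).trans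
        (by gcongr)
    rw [Fin.sum_univ_three]
    linarith [hτg 0, hτg 1, hτg 2]
  have hX1 : X ≤ (3 * Cmax * G + C * √K.h * M) / Cmin := by
    rw [le_div_iff₀ hpos]; linarith
  calc l2norm (K.wmeas a K.vol) dW ≤ C * √K.h * ((3 * Cmax * G + C * √K.h * M) / Cmin) :=
        hvol.trans (by gcongr)
    _ = 3 * C * (Cmax / Cmin) * √K.h * G + C ^ 2 / Cmin * (√K.h * √K.h) * M := by
        field_simp
    _ = 3 * C * (Cmax / Cmin) * √K.h * G + C ^ 2 / Cmin * K.h * M := by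
        rw [Real.mul_self_sqrt hh.le]
    _ ≤ _ := by
        gcongr
        · linarith [sq_nonneg C]
        · linarith

/-- The bound for `dV` on the element in terms of face data of size at most `A`. -/
theorem exists_l2norm_vec_le (p : ℕ) (c : ℝ) : ∃ C : ℝ, 0 < C ∧ ∀ (K : Prism) (a : ℝ), 0 < a →
    K.h / K.rho ≤ c → ∀ (Cmin Cmax : ℝ) (τ : SpaceTime → ℝ), K.IsStab τ Cmin Cmax →
    ∀ (b : Fin 3 → SpaceTime → ℝ) (dV : SpaceTime → Plane) (dW : SpaceTime → ℝ),
      K.IsErrorPair p a τ b dV dW → (∀ i, MemLp (b i) 2 (K.wmeas a (K.faceMeasure i))) →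
      ∀ A : ℝ, (∀ i, l2norm (K.wmeas a (K.faceMeasure i)) (b i) ≤ A) →
      l2norm (K.wmeas a K.vol) dV ≤ C * (Cmax / Cmin) * √K.h * A := by
  obtain ⟨C, hC, hvec⟩ := l2norm_vec_vol_le p c
  refine ⟨12 * C, by positivity, fun K a ha hc Cmin Cmax τ hτ b dV dW h hb A hA => ?_⟩
  have hd : ∀ i, MemLp dW 2 (K.wmeas a (K.faceMeasure i)) := fun i => K.memLp_face ha i h.topW.mem
  have hpos := hτ.pos
  have hmax : 0 < Cmax := hpos.trans_le hτ.le
  have hA0 : 0 ≤ A := (l2norm_nonneg _).trans (hA 0)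
  set X := l2norm (K.wmeas a K.sideMeasure) dW with hX
  have hX0 : 0 ≤ X := l2norm_nonneg _
  have hmain : Cmin * X ≤ 3 * A := by
    refine h.mul_l2norm_side_le ha hτ (by positivity) ?_
    have h1 : ∀ i, -∫ z, b i z * dW z ∂(K.wmeas a (K.faceMeasure i)) ≤ A * X := fun i =>
      ((neg_le_abs _).trans (abs_integral_mul_le (hb i) (hd i))).trans
        (mul_le_mul (hA i) (l2norm_face_le_side hd i) (l2norm_nonneg _) hA0)
    rw [Fin.sum_univ_three]
    linarith [h1 0, h1 1, h1 2]
  have hX1 : X ≤ 3 * A / Cmin := by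
    rw [le_div_iff₀ hpos]; linarith
  have hq : 1 ≤ Cmax / Cmin := by
    rw [le_div_iff₀ hpos]; linarith [hτ.le]
  have hn : ∀ i, l2norm (K.wmeas a (K.faceMeasure i)) (fun z => inner ℝ (dV z) (K.normal i)) ≤
      4 * (Cmax / Cmin) * A := by
    intro i
    calc _ ≤ Cmax * (3 * A / Cmin) + A := by
          refine (h.l2norm_normal_le ha hτ i (hb i)).trans (add_le_add ?_ (hA i))
          refine (l2norm_mono (hd i) hmax.le (hτ.norm_mul_le a i dW)).trans ?_
          gcongr
          exact (l2norm_face_le_side hd i).trans hX1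
      _ = 3 * (Cmax / Cmin) * A + 1 * A := by field_simp
      _ ≤ 3 * (Cmax / Cmin) * A + (Cmax / Cmin) * A := by gcongr
      _ = _ := by ring
  calc l2norm (K.wmeas a K.vol) dV ≤ C * √K.h * ∑ _i : Fin 3, 4 * (Cmax / Cmin) * A :=
        (hvec K a ha hc dV h.topV).trans (by gcongr with i; exact hn i)
    _ = _ := by simp; ring

/-- If `τ` is constant on each face, the bound for `dV` does not depend on `τ`: `dW` is estimated
on the face where `τ` is largest, which controls it on the other faces. -/
theorem exists_l2norm_vec_le_of_facewiseConst (p : ℕ) (c : ℝ) : ∃ C : ℝ, 0 < C ∧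
    ∀ (K : Prism) (a : ℝ), 0 < a → K.h / K.rho ≤ c →
    ∀ (Cmin Cmax : ℝ) (τ : SpaceTime → ℝ), K.IsStab τ Cmin Cmax → K.FacewiseConst τ →
    ∀ (b : Fin 3 → SpaceTime → ℝ) (dV : SpaceTime → Plane) (dW : SpaceTime → ℝ),
      K.IsErrorPair p a τ b dV dW → (∀ i, MemLp (b i) 2 (K.wmeas a (K.faceMeasure i))) →
      ∀ A : ℝ, (∀ i, l2norm (K.wmeas a (K.faceMeasure i)) (b i) ≤ A) →
      l2norm (K.wmeas a K.vol) dV ≤ C * √K.h * A := by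
  obtain ⟨C, hC, hvec⟩ := l2norm_vec_vol_le p c
  obtain ⟨κ, hκ, hface⟩ := l2norm_face_le_face p c
  refine ⟨3 * C * (3 * κ ^ 2 + 1), by positivity,
    fun K a ha hc Cmin Cmax τ hτ hconst b dV dW h hb A hA => ?_⟩
  have hd : ∀ i, MemLp dW 2 (K.wmeas a (K.faceMeasure i)) := fun i => K.memLp_face ha i h.topW.mem
  have hA0 : 0 ≤ A := (l2norm_nonneg _).trans (hA 0)
  choose t ht' using hconst
  have ht : ∀ i, ∀ᵐ z ∂(K.wmeas a (K.faceMeasure i)), τ z = t i := fun i =>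
    (K.wmeas_ac a _).ae_le (ht' i)
  have htpos : ∀ i, 0 < t i := by
    intro i
    have := ae_face_neBot K a i
    obtain ⟨z, hz, hz'⟩ := ((hτ.bound_face a i).and (ht i)).exists
    rw [← hz']
    exact hτ.pos.trans_le hz.1
  obtain ⟨m, hm⟩ := Finite.exists_max t
  have hκm : ∀ i, l2norm (K.wmeas a (K.faceMeasure i)) dW ≤
      κ * l2norm (K.wmeas a (K.faceMeasure m)) dW := fun i => hface K a hc i m dW h.topW
  set N := l2norm (K.wmeas a (K.faceMeasure m)) dW with hN
  have hN0 : 0 ≤ N := l2norm_nonneg _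
  -- the energy on the face `m` alone is bounded by the right-hand side on all faces
  have hmain : t m * N ≤ 3 * κ * A := by
    refine mul_le_of_mul_sq_le hN0 (by positivity) ?_
    have h1 : ∀ i, -∫ z, b i z * dW z ∂(K.wmeas a (K.faceMeasure i)) ≤ A * (κ * N) := fun i =>
      ((neg_le_abs _).trans (abs_integral_mul_le (hb i) (hd i))).trans
        (mul_le_mul (hA i) (hκm i) (l2norm_nonneg _) hA0)
    have h2 : ∀ i, t i * l2norm (K.wmeas a (K.faceMeasure i)) dW ^ 2 ≤
        ∫ z, τ z * dW z * dW z ∂(K.wmeas a (K.faceMeasure i)) := fun i =>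
      hτ.mul_sq_le ha i h.topW.mem ((ht i).mono fun _ hz => hz.ge)
    have h3 : t m * N ^ 2 ≤ ∑ i, ∫ z, τ z * dW z * dW z ∂(K.wmeas a (K.faceMeasure i)) :=
      (h2 m).trans (Finset.single_le_sum
        (f := fun i => ∫ z, τ z * dW z * dW z ∂(K.wmeas a (K.faceMeasure i)))
        (fun i _ => (mul_nonneg (htpos i).le (sq_nonneg _)).trans (h2 i)) (Finset.mem_univ m))
    rw [h.energy ha hτ, Fin.sum_univ_three] at h3
    linarith [h1 0, h1 1, h1 2]
  have hn : ∀ i, l2norm (K.wmeas a (K.faceMeasure i)) (fun z => inner ℝ (dV z) (K.normal i)) ≤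
      (3 * κ ^ 2 + 1) * A := by
    intro i
    have h1 : l2norm (K.wmeas a (K.faceMeasure i)) (fun z => τ z * dW z) ≤
        t i * l2norm (K.wmeas a (K.faceMeasure i)) dW := by
      refine l2norm_mono (hd i) (htpos i).le ((ht i).mono fun z hz => ?_)
      rw [hz, norm_mul, Real.norm_of_nonneg (htpos i).le]
    calc _ ≤ t m * (κ * N) + A := by
          refine (h.l2norm_normal_le ha hτ i (hb i)).trans (add_le_add (h1.trans ?_) (hA i))
          exact mul_le_mul (hm i) (hκm i) (l2norm_nonneg _) (htpos m).le
      _ = κ * (t m * N) + A := by ring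
      _ ≤ κ * (3 * κ * A) + A := by gcongr
      _ = _ := by ring
  calc l2norm (K.wmeas a K.vol) dV ≤ C * √K.h * ∑ _i : Fin 3, (3 * κ ^ 2 + 1) * A :=
        (hvec K a ha hc dV h.topV).trans (by gcongr with i; exact hn i)
    _ = _ := by simp; ring

end Estimates

/-- Vector fields with components in `W_h` are controlled on the bases of the prism by their values
in the element. -/
theorem exists_vec_end_le_vol (p : ℕ) {a T : ℝ} (ha : 0 < a) : ∃ C : ℝ, 0 < C ∧
    ∀ K : Prism, K.dt ≤ T → ∀ s ∈ vecSpace (spaceW p),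
      l2norm (K.wmeas a K.endMeasure) s ≤ C * (√K.dt)⁻¹ * l2norm (K.wmeas a K.vol) s := by
  obtain ⟨C, hC, hb⟩ := exists_end_le_vol p (T := T) ha
  refine ⟨√C, by positivity, fun K hT s hs => ?_⟩
  have hdt := K.dt_pos
  refine abs_le_of_sq_le_sq' ?_
    (mul_nonneg (by positivity) (l2norm_nonneg _)) |>.2
  rw [mul_pow, mul_pow, Real.sq_sqrt hC.le, inv_pow, Real.sq_sqrt hdt.le,
    l2norm_vec_sq fun j => K.memLp_wmeas ha K.ae_end_mem (K.memLp_poly K.ae_end_mem (hs j)),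
    l2norm_vec_sq fun j => K.memLp_vol ha (hs j)]
  linarith [hb K hT _ (hs 0), hb K hT _ (hs 1)]

/-! ### The error equations of the projection -/

lemma l2norm_le_normalNorm (K : Prism) (a : ℝ) (g : SpaceTime → Plane) (i : Fin 3) :
    l2norm (K.wmeas a (K.faceMeasure i)) (fun z => inner ℝ (g z) (K.normal i)) ≤
      K.normalNorm a g := by
  refine Real.le_sqrt_of_sq_le ?_
  simp only [integral_weight_mul, ← sq_l2norm_real]
  exact Finset.single_le_sum
    (f := fun i => l2norm (K.wmeas a (K.faceMeasure i)) (fun z => inner ℝ (g z) (K.normal i)) ^ 2)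
    (fun _ _ => sq_nonneg _) (Finset.mem_univ i)

lemma IsWeightedProj.scalar {S : Submodule ℝ (SpaceTime → ℝ)} {g Pg : SpaceTime → ℝ}
    (h : K.IsWeightedProj a (S : Set (SpaceTime → ℝ)) g Pg) :
    Pg ∈ S ∧ ∀ w ∈ S, ∫ z, Pg z * w z ∂(K.wmeas a K.vol) =
      ∫ z, g z * w z ∂(K.wmeas a K.vol) := by
  refine ⟨h.1, fun w hw => ?_⟩
  have := h.2 w hw
  simp only [integral_weight_mul] at this
  simpa [mul_comm] using this

lemma IsWeightedProj.vec (ha : 0 < a) {q PV : SpaceTime → Plane}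
    (hq : ∀ j, MemLp (fun z => q z j) 2 (K.wmeas a K.vol))
    (h : K.IsWeightedProj a (vecSpace (spaceW p)) q PV) :
    (∀ j, (fun z => PV z j) ∈ spaceW p) ∧ ∀ j, ∀ w ∈ spaceW p,
      ∫ z, PV z j * w z ∂(K.wmeas a K.vol) = ∫ z, q z j * w z ∂(K.wmeas a K.vol) := by
  refine ⟨h.1, (integral_inner_eq_iff (fun z hz => K.memLp_vol ha hz)
    (fun j => K.memLp_vol ha (h.1 j)) hq).1 fun s hs => ?_⟩
  have := h.2 s hs
  simpa only [integral_weight_mul] using this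

/-- The difference of the two projections solves the error equations. -/
lemma IsHDGProj.isErrorPair (ha : 0 < a) (hτ : K.IsStab τ Cmin Cmax)
    {q γq PV piV : SpaceTime → Plane} {v γv PW piW : SpaceTime → ℝ}
    (hq : ∀ j, MemLp (fun z => q z j) 2 K.vol)
    (hγq : ∀ i j, MemLp (fun z => γq z j) 2 (K.wmeas a (K.faceMeasure i)))
    (hγv : ∀ i, MemLp γv 2 (K.wmeas a (K.faceMeasure i)))
    (h : K.IsHDGProj p a τ q γq v γv piV piW)
    (hV : K.IsWeightedProj a (vecSpace (spaceW p)) q PV)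
    (hW : K.IsWeightedProj a (spaceW p : Set (SpaceTime → ℝ)) v PW) :
    K.IsErrorPair p a τ
      (fun i z => inner ℝ (γq z - PV z) (K.normal i) - τ z * (γv z - PW z))
      (fun z => piV z - PV z) (fun z => piW z - PW z) := by
  obtain ⟨m1, m2, o1, o2, f1⟩ := (isHDGProj_iff ha hq).1 h
  obtain ⟨n1, e1⟩ := hV.vec ha fun j => K.memLp_wmeas ha K.ae_vol_mem (hq j)
  obtain ⟨n2, e2⟩ := hW.scalar
  refine isErrorPair_sub ha hτ m1 n1 m2 n2
    (fun j w hw => by rw [o1 j w hw, e1 j w (spaceWt_le_spaceW p hw)])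
    (fun w hw => by rw [o2 w hw, e2 w (spaceWt_le_spaceW p hw)]) fun i σ hσ => ?_
  rw [f1 i σ (K.comp_faceParam_mem hσ i)]
  have hs := K.memLp_face ha i hσ
  have k1 : MemLp (fun z => inner ℝ (PV z) (K.normal i) - τ z * PW z) 2
      (K.wmeas a (K.faceMeasure i)) := by
    simp only [plane_inner]
    exact (((K.memLp_face ha i (n1 0)).mul_const _).add
      ((K.memLp_face ha i (n1 1)).mul_const _)).sub (hτ.memLp_mul (K.memLp_face ha i n2))
  have k2 : MemLp (fun z => inner ℝ (γq z) (K.normal i) - τ z * γv z) 2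
      (K.wmeas a (K.faceMeasure i)) := by
    simp only [plane_inner]
    exact (((hγq i 0).mul_const _).add ((hγq i 1).mul_const _)).sub (hτ.memLp_mul (hγv i))
  rw [← sub_eq_iff_eq_add', ← integral_sub (integrable_mul_of_memLp k2 hs)
    (integrable_mul_of_memLp k1 hs)]
  congr 1
  funext z
  rw [inner_sub_left]; ring

/-- Integration by parts turns the normal component of the error of the `L²` projection into the
error of the projection of the divergence, against functions orthogonal to `W̃_h`. -/
lemma sum_integral_normal_error (ha : 0 < a) {q γq PV : SpaceTime → Plane}
    {Gq : Fin 2 → Fin 3 → SpaceTime → ℝ} {D dW : SpaceTime → ℝ}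
    (hq : ∀ j, K.HasH1Grad (fun z => q z j) (Gq j))
    (hγ : ∀ j, K.IsTrace (fun z => q z j) (Gq j) (fun z => γq z j))
    (hγq : ∀ i j, MemLp (fun z => γq z j) 2 (K.wmeas a (K.faceMeasure i)))
    (hV : K.IsWeightedProj a (vecSpace (spaceW p)) q PV) (hD : D ∈ spaceWt p)
    (hW : K.IsTop p a dW) :
    ∑ i, ∫ z, inner ℝ (γq z - PV z) (K.normal i) * dW z ∂(K.wmeas a (K.faceMeasure i)) =
      ∫ z, (Gq 0 1 z + Gq 1 2 z - D z) * dW z ∂(K.wmeas a K.vol) := by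
  obtain ⟨n1, e1⟩ := hV.vec ha fun j => K.memLp_wmeas ha K.ae_vol_mem (hq j).1
  have hdf := fun i => K.memLp_face ha i hW.mem
  have hdv := K.memLp_vol ha hW.mem
  have hG : ∀ j k, MemLp (Gq j k) 2 (K.wmeas a K.vol) := fun j k =>
    K.memLp_wmeas ha K.ae_vol_mem ((hq j).2.1 k)
  have hj : ∀ j : Fin 2, ∑ i, K.normal i j *
      ∫ z, (γq z j - PV z j) * dW z ∂(K.wmeas a (K.faceMeasure i)) =
      ∫ z, Gq j j.succ z * dW z ∂(K.wmeas a K.vol) := by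
    intro j
    have g1 := K.green ha (hq j) (hγ j) hW.mem j
    have g2 := green_poly (K := K) ha (n1 j) hW.mem j
    have o := hW.orth _ (fderiv_tensorPoly_mem (n1 j) j)
    simp only [mul_comm (dW _)] at o
    rw [o, add_zero, e1 j _ (spaceWt_le_spaceW p (fderiv_tensorPoly_mem hW.mem j))] at g2
    rw [g2] at g1
    rw [eq_comm, ← sub_eq_iff_eq_add'.2 g1.symm, ← Finset.sum_sub_distrib]
    refine Finset.sum_congr rfl fun i _ => ?_
    rw [← mul_sub, ← integral_sub (integrable_mul_of_memLp (hγq i j) (hdf i))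
      (integrable_mul_of_memLp (K.memLp_face ha i (n1 j)) (hdf i))]
    simp only [sub_mul]
  have e : ∀ i, ∫ z, inner ℝ (γq z - PV z) (K.normal i) * dW z ∂(K.wmeas a (K.faceMeasure i)) =
      K.normal i 0 * ∫ z, (γq z 0 - PV z 0) * dW z ∂(K.wmeas a (K.faceMeasure i)) +
      K.normal i 1 * ∫ z, (γq z 1 - PV z 1) * dW z ∂(K.wmeas a (K.faceMeasure i)) := by
    intro i
    have hi : ∀ j, Integrable (fun z => (γq z j - PV z j) * dW z) (K.wmeas a (K.faceMeasure i)) :=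
      fun j => integrable_mul_of_memLp ((hγq i j).sub (K.memLp_face ha i (n1 j))) (hdf i)
    rw [← integral_const_mul, ← integral_const_mul,
      ← integral_add ((hi 0).const_mul _) ((hi 1).const_mul _)]
    congr 1
    funext z
    rw [plane_inner, PiLp.sub_apply, PiLp.sub_apply]; ring
  have hDo := hW.orth _ hD
  simp only [mul_comm (dW _)] at hDo
  have h12 : Integrable (fun z => (Gq 0 1 z + Gq 1 2 z) * dW z) (K.wmeas a K.vol) :=
    integrable_mul_of_memLp ((hG 0 1).add (hG 1 2)) hdv
  have hR : ∫ z, (Gq 0 1 z + Gq 1 2 z - D z) * dW z ∂(K.wmeas a K.vol) =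
      ∫ z, Gq 0 1 z * dW z ∂(K.wmeas a K.vol) + ∫ z, Gq 1 2 z * dW z ∂(K.wmeas a K.vol) := by
    rw [← integral_add (integrable_mul_of_memLp (hG 0 1) hdv)
      (integrable_mul_of_memLp (hG 1 2) hdv)]
    simp only [sub_mul _ (D _)]
    rw [integral_sub h12 (integrable_mul_of_memLp (K.memLp_vol ha hD) hdv), hDo, sub_zero]
    simp only [add_mul]
  simp only [e, Finset.sum_add_distrib, hj, hR]
  rfl

end Prism

namespace Prism

variable {K : Prism} {p : ℕ} {a Cmin Cmax : ℝ} {τ : SpaceTime → ℝ}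

/-! ### The approximation estimates -/

lemma IsTrace.memLp_face (ha : 0 < a) {v γ : SpaceTime → ℝ} {G : Fin 3 → SpaceTime → ℝ}
    (h : K.IsTrace v G γ) (i : Fin 3) : MemLp γ 2 (K.wmeas a (K.faceMeasure i)) :=
  K.memLp_wmeas ha (K.ae_face_mem i)
    (h.1.mono_measure ((K.faceMeasure_le_side i).trans (Measure.le_add_right le_rfl)))

lemma IsTrace.memLp_end (ha : 0 < a) {v γ : SpaceTime → ℝ} {G : Fin 3 → SpaceTime → ℝ}
    (h : K.IsTrace v G γ) : MemLp γ 2 (K.wmeas a K.endMeasure) :=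
  K.memLp_wmeas ha K.ae_end_mem (h.1.mono_measure (Measure.le_add_left le_rfl))

/-- The triangle inequality through an intermediate function. -/
lemma l2norm_sub_le_add {F : Type*} [NormedAddCommGroup F] {ν : Measure SpaceTime}
    {f g h : SpaceTime → F} (hf : MemLp f 2 ν) (hg : MemLp g 2 ν) (hh : MemLp h 2 ν) :
    l2norm ν (fun z => f z - h z) ≤
      l2norm ν (fun z => f z - g z) + l2norm ν (fun z => h z - g z) := by
  have h1 : MemLp (fun z => f z - g z) 2 ν := hf.sub hg
  have h2 : MemLp (fun z => h z - g z) 2 ν := hh.sub hg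
  simpa using l2norm_sub_le h1 h2

/-- The data of the error equations on the faces, in terms of the errors of the `L²` projections. -/
lemma l2norm_face_data_le (hτ : K.IsStab τ Cmin Cmax) {g : SpaceTime → Plane}
    {u : SpaceTime → ℝ} (i : Fin 3) (hg : ∀ j, MemLp (fun z => g z j) 2
      (K.wmeas a (K.faceMeasure i))) (hu : ∀ i, MemLp u 2 (K.wmeas a (K.faceMeasure i))) :
    l2norm (K.wmeas a (K.faceMeasure i)) (fun z => inner ℝ (g z) (K.normal i) - τ z * u z) ≤
      K.normalNorm a g + Cmax * l2norm (K.wmeas a K.sideMeasure) u := by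
  have hmax : 0 < Cmax := hτ.pos.trans_le hτ.le
  have hn : MemLp (fun z => inner ℝ (g z) (K.normal i)) 2 (K.wmeas a (K.faceMeasure i)) := by
    simp only [plane_inner]
    exact ((hg 0).mul_const _).add ((hg 1).mul_const _)
  refine (l2norm_sub_le hn (hτ.memLp_mul (hu i))).trans
    (add_le_add (K.l2norm_le_normalNorm a g i) ?_)
  refine (l2norm_mono (hu i) hmax.le (hτ.norm_mul_le a i u)).trans ?_
  gcongr
  exact l2norm_face_le_side hu i

end Prism

theorem mainTheorem3 (p : ℕ) (c_r a T : ℝ) (ha : 0 < a) (hT : 0 < T) :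
    ∃ C : ℝ, 0 < C ∧
      ∀ K : Prism, K.h / K.rho ≤ c_r → K.dt ≤ T →
      ∀ (Cmin Cmax : ℝ) (τ : SpaceTime → ℝ), 0 < Cmin → AEMeasurable τ K.sideMeasure →
        (∀ᵐ z ∂K.sideMeasure, Cmin ≤ τ z ∧ τ z ≤ Cmax) →
      ∀ (v : SpaceTime → ℝ) (Gv : Fin 3 → SpaceTime → ℝ) (γv : SpaceTime → ℝ)
        (q : SpaceTime → Plane) (Gq : Fin 2 → Fin 3 → SpaceTime → ℝ) (γq : SpaceTime → Plane),
        K.HasH1Grad v Gv → K.IsTrace v Gv γv →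
        (∀ i, K.HasH1Grad (fun z => q z i) (Gq i)) →
        (∀ i, K.IsTrace (fun z => q z i) (Gq i) (fun z => γq z i)) →
      (∃! P : (SpaceTime → Plane) × (SpaceTime → ℝ), K.IsHDGProj p a τ q γq v γv P.1 P.2) ∧
      ∀ (piV : SpaceTime → Plane) (piW : SpaceTime → ℝ), K.IsHDGProj p a τ q γq v γv piV piW →
      ∀ (PV : SpaceTime → Plane) (PW D : SpaceTime → ℝ),
        K.IsWeightedProj a (vecSpace (spaceW p)) q PV →
        K.IsWeightedProj a (spaceW p : Set (SpaceTime → ℝ)) v PW →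
        K.IsWeightedProj a (spaceWt p : Set (SpaceTime → ℝ)) (fun z => Gq 0 1 z + Gq 1 2 z) D →
      -- the bound for `v - Π_W v` on the element
      (K.wnorm a K.vol (fun z => v z - piW z) ≤
        K.wnorm a K.vol (fun z => v z - PW z)
        + C * (Cmax / Cmin) * K.h ^ (1 / 2 : ℝ) *
            K.wnorm a K.sideMeasure (fun z => γv z - PW z)
        + C / Cmin * K.h * K.wnorm a K.vol (fun z => (Gq 0 1 z + Gq 1 2 z) - D z)) ∧
      -- the bound for `q - Π_V q` on the element, for `τ` constant on each face
      (K.FacewiseConst τ →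
        K.wnorm a K.vol (fun z => q z - piV z) ≤
          K.wnorm a K.vol (fun z => q z - PV z)
          + C * K.h ^ (1 / 2 : ℝ) * K.normalNorm a (fun z => γq z - PV z)
          + C * Cmax * K.h ^ (1 / 2 : ℝ) * K.wnorm a K.sideMeasure (fun z => γv z - PW z)) ∧
      -- the bound for `q - Π_V q` on the element, for `τ` varying on the faces
      (K.wnorm a K.vol (fun z => q z - piV z) ≤
        K.wnorm a K.vol (fun z => q z - PV z)
        + C * (Cmax / Cmin) * K.h ^ (1 / 2 : ℝ) * K.normalNorm a (fun z => γq z - PV z)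
        + C * (Cmax / Cmin) * Cmax * K.h ^ (1 / 2 : ℝ) *
            K.wnorm a K.sideMeasure (fun z => γv z - PW z)) ∧
      -- the bound for `q - Π_V q` on the time faces
      (K.wnorm a K.endMeasure (fun z => γq z - piV z) ≤
        K.wnorm a K.endMeasure (fun z => γq z - PV z)
        + C * K.dt ^ (-(1 / 2) : ℝ) * K.wnorm a K.vol (fun z => q z - PV z)
        + C * K.dt ^ (-(1 / 2) : ℝ) * K.wnorm a K.vol (fun z => q z - piV z)) := by
  obtain ⟨C₁, hC₁, est₁⟩ := Prism.exists_l2norm_scalar_le p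
  obtain ⟨C₂, hC₂, est₂⟩ := Prism.exists_l2norm_vec_le p c_r
  obtain ⟨C₃, hC₃, est₃⟩ := Prism.exists_l2norm_vec_le_of_facewiseConst p c_r
  obtain ⟨C₄, hC₄, est₄⟩ := Prism.exists_vec_end_le_vol p (T := T) ha
  -- the sum of the constants dominates each of them
  obtain ⟨C, hC⟩ : ∃ C, C = C₁ + C₂ + C₃ + C₄ := ⟨_, rfl⟩
  have l₁ : C₁ ≤ C := by linarith
  have l₂ : C₂ ≤ C := by linarith
  have l₃ : C₃ ≤ C := by linarith
  have l₄ : C₄ ≤ C := by linarith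
  refine ⟨C, hC₁.trans_le l₁, ?_⟩
  intro K hshape hdt Cmin Cmax τ hpos hmeas hbd v Gv γv q Gq γq hv hγv hq hγq
  have hτ : K.IsStab τ Cmin Cmax := ⟨hpos, hmeas, hbd⟩
  have tq : ∀ i j, MemLp (fun z => γq z j) 2 (K.wmeas a (K.faceMeasure i)) :=
    fun i j => (hγq j).memLp_face ha i
  have tv : ∀ i, MemLp γv 2 (K.wmeas a (K.faceMeasure i)) := hγv.memLp_face ha
  refine ⟨Prism.existsUnique_isHDGProj ha hτ (fun j => (hq j).1) hv.1 tq tv, ?_⟩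
  intro piV piW hpi PV PW D hPV hPW hD
  have herr := hpi.isErrorPair ha hτ (fun j => (hq j).1) tq tv hPV hPW
  have hmax : 0 < Cmax := hpos.trans_le hτ.le
  have hqL : MemLp q 2 (K.wmeas a K.vol) :=
    MemLp.of_eval_piLp fun j => K.memLp_wmeas ha K.ae_vol_mem (hq j).1
  have hpiVL : MemLp piV 2 (K.wmeas a K.vol) := MemLp.of_eval_piLp fun j => K.memLp_vol ha (hpi.1 j)
  have hPVL : MemLp PV 2 (K.wmeas a K.vol) := MemLp.of_eval_piLp fun j => K.memLp_vol ha (hPV.1 j)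
  have hdV := Prism.l2norm_sub_le_add hqL hPVL hpiVL
  have gq : ∀ i j, MemLp (fun z => (γq z - PV z) j) 2 (K.wmeas a (K.faceMeasure i)) :=
    fun i j => (tq i j).sub (K.memLp_face ha i (hPV.1 j))
  have gv : ∀ i, MemLp (fun z => γv z - PW z) 2 (K.wmeas a (K.faceMeasure i)) :=
    fun i => (tv i).sub (K.memLp_face ha i hPW.1)
  have gqn : ∀ i, MemLp (fun z => inner ℝ (γq z - PV z) (K.normal i)) 2
      (K.wmeas a (K.faceMeasure i)) := by
    intro i
    simp only [plane_inner]
    exact ((gq i 0).mul_const _).add ((gq i 1).mul_const _)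
  have hb := fun i => (gqn i).sub (hτ.memLp_mul (gv i))
  have hbA := fun i => Prism.l2norm_face_data_le hτ i (gq i) gv
  have hN : 0 ≤ K.normalNorm a (fun z => γq z - PV z) := Real.sqrt_nonneg _
  have hV0 := l2norm_nonneg (ν := K.wmeas a K.sideMeasure) (fun z => γv z - PW z)
  simp only [Prism.wnorm_eq_l2norm, Real.rpow_neg K.dt_pos.le, ← Real.sqrt_eq_rpow]
  refine ⟨?_, fun hconst => ?_, ?_, ?_⟩
  · have hR : MemLp (fun z => Gq 0 1 z + Gq 1 2 z - D z) 2 (K.wmeas a K.vol) :=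
      ((K.memLp_wmeas ha K.ae_vol_mem ((hq 0).2.1 1)).add
        (K.memLp_wmeas ha K.ae_vol_mem ((hq 1).2.1 2))).sub (K.memLp_vol ha hD.1)
    have h1 := est₁ K a ha Cmin Cmax τ hτ (fun i z => inner ℝ (γq z - PV z) (K.normal i))
      (fun z => γv z - PW z) _ _ _ herr gqn gv hR
      (Prism.sum_integral_normal_error ha hq hγq tq hPV hD.1 herr.topW)
    have h2 := Prism.l2norm_sub_le_add (K.memLp_wmeas ha K.ae_vol_mem hv.1) (K.memLp_vol ha hPW.1)
      (K.memLp_vol ha hpi.2.1)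
    rw [add_assoc]
    refine h2.trans (add_le_add le_rfl (h1.trans ?_))
    have := K.h_pos
    have := l2norm_nonneg (ν := K.wmeas a K.vol) (fun z => Gq 0 1 z + Gq 1 2 z - D z)
    gcongr
  · have h1 := est₃ K a ha hshape Cmin Cmax τ hτ hconst _ _ _ herr hb _ hbA
    rw [add_assoc]
    refine hdV.trans (add_le_add le_rfl (h1.trans ?_))
    calc _ ≤ C * √K.h * (K.normalNorm a (fun z => γq z - PV z) +
          Cmax * l2norm (K.wmeas a K.sideMeasure) (fun z => γv z - PW z)) := by gcongr
      _ = _ := by ring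
  · have h1 := est₂ K a ha hshape Cmin Cmax τ hτ _ _ _ herr hb _ hbA
    rw [add_assoc]
    refine hdV.trans (add_le_add le_rfl (h1.trans ?_))
    calc _ ≤ C * (Cmax / Cmin) * √K.h * (K.normalNorm a (fun z => γq z - PV z) +
          Cmax * l2norm (K.wmeas a K.sideMeasure) (fun z => γv z - PW z)) := by gcongr
      _ = _ := by ring
  · have hend : ∀ {s}, s ∈ vecSpace (spaceW p) → MemLp s 2 (K.wmeas a K.endMeasure) :=
      fun hs => MemLp.of_eval_piLp fun j =>
        K.memLp_wmeas ha K.ae_end_mem (K.memLp_poly K.ae_end_mem (hs j))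
    have h1 := Prism.l2norm_sub_le_add
      (MemLp.of_eval_piLp fun j => (hγq j).memLp_end ha) (hend hPV.1) (hend hpi.1)
    have h2 := est₄ K hdt _ fun j => (herr.topV j).mem
    -- back from the difference of the projections to the two errors
    have h3 : l2norm (K.wmeas a K.vol) (fun z => piV z - PV z) ≤
        l2norm (K.wmeas a K.vol) (fun z => q z - PV z) +
        l2norm (K.wmeas a K.vol) (fun z => q z - piV z) := by
      have k1 : MemLp (fun z => q z - PV z) 2 (K.wmeas a K.vol) := hqL.sub hPVL
      have k2 : MemLp (fun z => q z - piV z) 2 (K.wmeas a K.vol) := hqL.sub hpiVL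
      simpa using l2norm_sub_le k1 k2
    have h0 := l2norm_nonneg (ν := K.wmeas a K.vol) (fun z => piV z - PV z)
    rw [add_assoc, ← mul_add]
    refine h1.trans (add_le_add le_rfl (h2.trans ?_))
    have hC0 := hC₁.trans_le l₁
    gcongr
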